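/- Notation. Let $\widehat{\mathbb Z}=\varprojlim_n \mathbb Z/n\mathbb Z$ be the profinite completion of $\mathbb Z$, let $\overline{\mathbb Q}$ be an algebraic closure of $\mathbb Q$, let $\operatorname{Gal}_{\mathbb Q}=\operatorname{Gal}(\overline{\mathbb Q}/\mathbb Q)$, and let $\chi_{\mathrm{cyc}}\colon \operatorname{Gal}_{\mathbb Q}\to\widehat{\mathbb Z}^\times$ be the cyclotomic character. For an elliptic curve $E/\mathbb Q$, a choice of compatible bases of the free $\mathbb Z/n\mathbb Z$-modules $E[n]$ ($n\ge 1$) gives a Galois representation $\rho_E\colon \operatorname{Gal}_{\mathbb Q}\to \operatorname{GL}_2(\widehat{\mathbb Z})$ on the torsion points of $E(\overline{\mathbb Q})$. Let $\rho_E^*(\sigma)$ be the transpose of $\rho_E(\sigma^{-1})$ and put $G_E:=\rho_E^*(\operatorname{Gal}_{\mathbb Q})$. The curve $E$ is non-CM if all endomorphisms of $E$ over $\overline{\mathbb Q}$ are multiplications by integers. A non-CM curve $E$ is a *Serre curve* if $[\operatorname{GL}_2(\widehat{\mathbb Z}):G_E]=2$. The *level* of an open subgroup of $\operatorname{GL}_2(\widehat{\mathbb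 Z})$ (or $\operatorname{SL}_2(\widehat{\mathbb Z})$) is the smallest positive integer $n$ such that the subgroup contains the kernel of reduction modulo $n$. A subgroup $H$ of $\operatorname{GL}_2(\widehat{\mathbb Z})$ is *agreeable* if it is open, satisfies $\det(H)=\widehat{\mathbb Z}^\times$, contains all scalar matrices $\widehat{\mathbb Z}^\times\cdot I$, and the level of $H$ in $\operatorname{GL}_2(\widehat{\mathbb Z})$ and the level of $H\cap\operatorname{SL}_2(\widehat{\mathbb Z})$ in $\operatorname{SL}_2(\widehat{\mathbb Z})$ have the same odd prime divisors. The *agreeable closure* $\mathcal G_E$ of $G_E$ is the smallest agreeable subgroup containing $G_E$, that is, the intersection of all agreeable subgroups containing $G_E$. Let $G$ be the unique subgroup of $\operatorname{GL}_2(\widehat{\mathbb Z})$ of level $2$ and index $2$. For a squarefree integer $d$, let $\gamma_d\colon\widehat{\mathbb Z}^\times\to \operatorname{GL}_2(\widehat{\mathbb Z})/G$ be the unique homomorphism for which $\sigma\mapsto\gamma_d(\chi_{\mathrm{cyc}}(\sigma)^{-1})$ is the restriction map $\operatorname{Gal}_{\mathbb Q}\to\operatorname{Gal}(\mathbb Q(\sqrt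 d)/\mathbb Q)$ followed by an injective homomorphism into $\operatorname{GL}_2(\widehat{\mathbb Z})/G$, and put \[ G_{\gamma_d}:=\{g\in \operatorname{GL}_2(\widehat{\mathbb Z}) : g\cdot G=\gamma_d(\det g)\}. \] Proposition. Let $E$ be a non-CM elliptic curve over $\mathbb Q$, and let $\mathcal G_E$ be the agreeable closure of $G_E$ (for any choice of compatible bases of the $E[n]$). Then $E$ is a Serre curve if and only if $\mathcal G_E$ is equal to $\operatorname{GL}_2(\widehat{\mathbb Z})$, $G_{\gamma_2}$ or $G_{\gamma_{-2}}$. -/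

import Mathlib

open scoped WeierstrassCurve.Affine MatrixGroups

noncomputable section

namespace SerreCurve

/-! ### The ring of profinite integers and the groups `GL₂`, `SL₂` over it -/

/-- The profinite integers: compatible families of residues modulo all positive integers. -/
def zHat : Subring (∀ n : ℕ+, ZMod n) where
  carrier := {x | ∀ (m n : ℕ+) (h : (m : ℕ) ∣ n), ZMod.castHom h (ZMod m) (x n) = x m}
  mul_mem' hx hy m n h := by simp only [Pi.mul_apply, map_mul, hx m n h, hy m n h]
  one_mem' m n h := by simp only [Pi.one_apply, map_one]
  add_mem' hx hy m n h := by simp only [Pi.add_apply, map_add, hx m n h, hy m n h]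
  zero_mem' m n h := by simp only [Pi.zero_apply, map_zero]
  neg_mem' hx m n h := by simp only [Pi.neg_apply, map_neg, hx m n h]

/-- `Ẑ = lim ℤ/nℤ`.  As a subring of the product of the discrete rings `ℤ/nℤ` it carries the
profinite (subspace) topology; the groups of matrices below carry the topologies induced by it. -/
abbrev ZHat : Type := zHat

/-- Reduction modulo `n` on `Ẑ`. -/
def reduction (n : ℕ+) : ZHat →+* ZMod n :=
  (Pi.evalRingHom (fun n : ℕ+ => ZMod n) n).comp zHat.subtype

/-- Reduction modulo `n` on `GL₂(Ẑ)`. -/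
def redGL (n : ℕ+) : GL (Fin 2) ZHat →* GL (Fin 2) (ZMod n) :=
  Matrix.GeneralLinearGroup.map (reduction n)

/-- Reduction modulo `n` on `SL₂(Ẑ)`. -/
def redSL (n : ℕ+) :
    Matrix.SpecialLinearGroup (Fin 2) ZHat →* Matrix.SpecialLinearGroup (Fin 2) (ZMod n) :=
  Matrix.SpecialLinearGroup.map (reduction n)

/-- The intersection of a subgroup of `GL₂(Ẑ)` with `SL₂(Ẑ)`, as a subgroup of `SL₂(Ẑ)`. -/
def interSL (H : Subgroup (GL (Fin 2) ZHat)) :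
    Subgroup (Matrix.SpecialLinearGroup (Fin 2) ZHat) :=
  H.comap Matrix.SpecialLinearGroup.toGL

/-- The level of an (open) subgroup of `GL₂(Ẑ)`: the smallest positive integer `n` for which it
contains the kernel of reduction modulo `n`. -/
def levelGL (H : Subgroup (GL (Fin 2) ZHat)) : ℕ :=
  sInf {n : ℕ | ∃ h : 0 < n, (redGL ⟨n, h⟩).ker ≤ H}

/-- The level of an (open) subgroup of `SL₂(Ẑ)`. -/
def levelSL (H : Subgroup (Matrix.SpecialLinearGroup (Fin 2) ZHat)) : ℕ :=
  sInf {n : ℕ | ∃ h : 0 < n, (redSL ⟨n, h⟩).ker ≤ H}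

/-! ### Agreeable groups and agreeable closures -/

/-- Agreeable subgroups of `GL₂(Ẑ)`. -/
structure IsAgreeable (H : Subgroup (GL (Fin 2) ZHat)) : Prop where
  isOpen : IsOpen (H : Set (GL (Fin 2) ZHat))
  det_full : H.map Matrix.GeneralLinearGroup.det = ⊤
  scalar_mem : ∀ a : ZHatˣ, Matrix.GeneralLinearGroup.scalar (Fin 2) a ∈ H
  odd_primes : ∀ p : ℕ, p.Prime → p ≠ 2 → (p ∣ levelGL H ↔ p ∣ levelSL (interSL H))

/-- The agreeable closure of `G`: the smallest agreeable group containing `G`, written as the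
intersection of all of them (see `agreeableClosure_eq_of_isLeast`). -/
def agreeableClosure (G : Subgroup (GL (Fin 2) ZHat)) : Subgroup (GL (Fin 2) ZHat) :=
  sInf {H | IsAgreeable H ∧ G ≤ H}

theorem agreeableClosure_eq_of_isLeast {G A : Subgroup (GL (Fin 2) ZHat)}
    (hA : IsLeast {H | IsAgreeable H ∧ G ≤ H} A) : agreeableClosure G = A :=
  hA.isGLB.sInf_eq

/-! ### The absolute Galois group of `ℚ` and the cyclotomic character -/

/-- A fixed algebraic closure of `ℚ`. -/
abbrev QBar : Type := AlgebraicClosure ℚ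

instance : DecidableEq QBar := Classical.decEq _

/-- The absolute Galois group of `ℚ`. -/
abbrev GalQ : Type := QBar ≃ₐ[ℚ] QBar

/-- The mod `n` cyclotomic character. -/
def cycMod (n : ℕ+) : GalQ →* (ZMod n)ˣ :=
  (modularCyclotomicCharacter QBar (n := n)
    (HasEnoughRootsOfUnity.natCard_rootsOfUnity QBar n)).comp
    (MulSemiringAction.toRingAut GalQ QBar)

theorem cycMod_spec (n : ℕ+) (σ : GalQ) {t : QBarˣ} (ht : t ∈ rootsOfUnity n QBar) :
    σ t = (t : QBar) ^ (cycMod n σ : ZMod n).val :=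
  modularCyclotomicCharacter.spec QBar _ (MulSemiringAction.toRingAut GalQ QBar σ) ht

theorem cycMod_compat (σ : GalQ) (m n : ℕ+) (h : (m : ℕ) ∣ n) :
    ZMod.castHom h (ZMod m) (cycMod n σ : ZMod n) = (cycMod m σ : ZMod m) := by
  refine modularCyclotomicCharacter.unique QBar _ (MulSemiringAction.toRingAut GalQ QBar σ) ?_
  intro t ht
  have ht' : t ^ (m : ℕ) = 1 := ht
  have htn : t ∈ rootsOfUnity n QBar := by
    obtain ⟨k, hk⟩ := h
    rw [mem_rootsOfUnity, hk, pow_mul, ht', one_pow]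
  refine (cycMod_spec n σ htn).trans ?_
  rw [← Units.val_pow_eq_pow_val, ← Units.val_pow_eq_pow_val, pow_eq_pow_mod _ ht',
    ZMod.castHom_apply, ZMod.cast_eq_val, ZMod.val_natCast]

/-- The cyclotomic character `Gal_ℚ → Ẑˣ`. -/
def cyc : GalQ →* ZHatˣ :=
  MonoidHom.toHomUnits
    { toFun := fun σ => (⟨fun n => (cycMod n σ : ZMod n), cycMod_compat σ⟩ : ZHat)
      map_one' := Subtype.ext (funext fun n => by simp)
      map_mul' := fun σ τ => Subtype.ext (funext fun n => by simp) }

/-! ### The groups `G_{γ_d}` -/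

/-- The unique subgroup `G` of `GL₂(Ẑ)` of level `2` and index `2`: the preimage of the index `2`
subgroup of `GL₂(ℤ/2ℤ)` (a group isomorphic to the symmetric group on three letters), i.e. of its
commutator subgroup. -/
def levelTwo : Subgroup (GL (Fin 2) ZHat) :=
  (commutator (GL (Fin 2) (ZMod (2 : ℕ+)))).comap (redGL 2)

instance : levelTwo.Normal := by unfold levelTwo; infer_instance

/-- `γ : Ẑˣ → GL₂(Ẑ)/G` is the homomorphism `γ_d`: the map `σ ↦ γ(χ_cyc(σ)⁻¹)` is the composition
of the restriction `Gal_ℚ → Gal(ℚ(√d)/ℚ)` with an injective homomorphism into `GL₂(Ẑ)/G`, that is,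
its kernel is the group of automorphisms that are trivial on `ℚ(√d)`. -/
def IsGamma (d : ℤ) (γ : ZHatˣ →* GL (Fin 2) ZHat ⧸ levelTwo) : Prop :=
  ∀ σ : GalQ, γ (cyc σ)⁻¹ = 1 ↔
    σ ∈ (IntermediateField.adjoin ℚ {x : QBar | x ^ 2 = (d : QBar)}).fixingSubgroup

open Classical in
/-- The (unique) homomorphism `γ_d`. -/
def gamma (d : ℤ) : ZHatˣ →* GL (Fin 2) ZHat ⧸ levelTwo :=
  if h : ∃ γ, IsGamma d γ then h.choose else 1

/-- `G_γ = {g ∈ GL₂(Ẑ) : g ⬝ G = γ(det g)}`. -/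
def groupOf (γ : ZHatˣ →* GL (Fin 2) ZHat ⧸ levelTwo) : Subgroup (GL (Fin 2) ZHat) :=
  (QuotientGroup.mk' levelTwo).eqLocus (γ.comp Matrix.GeneralLinearGroup.det)

/-! ### Elliptic curves over `ℚ`: points over the algebraic closure and complex multiplication -/

/-- The group `E(ℚ̄)`. -/
abbrev Pt (E : WeierstrassCurve ℚ) : Type := (E⁄QBar).Point

/-- Homogeneous coordinates of a point of `E(ℚ̄)` in the projective plane. -/
def coords {E : WeierstrassCurve ℚ} : Pt E → Fin 3 → QBar
  | .zero => ![0, 1, 0]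
  | .some x y _ => ![x, y, 1]

/-- A self-map of `E(ℚ̄)` is a morphism of varieties if around every point it is given by
homogeneous polynomials of the same degree. -/
def IsMorphism {E : WeierstrassCurve ℚ} (φ : Pt E → Pt E) : Prop :=
  ∀ P : Pt E, ∃ (k : ℕ) (F : Fin 3 → MvPolynomial (Fin 3) QBar),
    (∀ i, (F i).IsHomogeneous k) ∧ (∃ i, MvPolynomial.eval (coords P) (F i) ≠ 0) ∧
    ∀ Q : Pt E, (∃ i, MvPolynomial.eval (coords Q) (F i) ≠ 0) →
      ∃ c : QBar, ∀ i, MvPolynomial.eval (coords Q) (F i) = c * coords (φ Q) i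

/-- `E` has complex multiplication: over `ℚ̄` it has an endomorphism that is not multiplication
by an integer. -/
def HasCM (E : WeierstrassCurve ℚ) : Prop :=
  ∃ φ : Pt E →+ Pt E, IsMorphism φ ∧ ∀ m : ℤ, ∃ P : Pt E, φ P ≠ m • P

/-! ### The Galois representation on the torsion points -/

/-- The action of `Gal_ℚ` on `E(ℚ̄)`. -/
def galPt {E : WeierstrassCurve ℚ} (σ : GalQ) : Pt E →+ Pt E :=
  WeierstrassCurve.Affine.Point.map (W' := E) (σ : QBar →ₐ[ℚ] QBar)

theorem galPt_one {E : WeierstrassCurve ℚ} (P : Pt E) : galPt 1 P = P := by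
  cases P <;> rfl

theorem galPt_mul {E : WeierstrassCurve ℚ} (σ τ : GalQ) (P : Pt E) :
    galPt (σ * τ) P = galPt σ (galPt τ P) := by
  cases P <;> rfl

/-- The `n`-torsion subgroup `E[n]` of `E(ℚ̄)`. -/
abbrev Tors (E : WeierstrassCurve ℚ) (n : ℕ+) : AddSubgroup (Pt E) :=
  AddSubgroup.torsionBy (Pt E) ((n : ℕ) : ℤ)

/-- The action of `Gal_ℚ` on `E[n]`. -/
def galTors {E : WeierstrassCurve ℚ} (n : ℕ+) (σ : GalQ) : Tors E n →+ Tors E n :=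
  ((galPt σ).comp (Tors E n).subtype).codRestrict (Tors E n) fun P => by
    rw [AddSubgroup.torsionBy.nsmul_iff]
    change (n : ℕ) • galPt σ (P : Pt E) = 0
    rw [← map_nsmul, AddSubgroup.torsionBy.nsmul_iff.mp P.2, map_zero]

/-- A compatible system of bases of the free `ℤ/nℤ`-modules `E[n]`, `n ≥ 1`: for `m ∣ n`,
multiplication by `n / m` sends the basis of `E[n]` to the basis of `E[m]`. -/
structure TorsionBasis (E : WeierstrassCurve ℚ) where
  iso : ∀ n : ℕ+, (Fin 2 → ZMod n) ≃+ Tors E n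
  compat : ∀ (m n : ℕ+) (h : (m : ℕ) ∣ n) (v : Fin 2 → ZMod n),
    ((n : ℕ) / m) • (iso n v : Pt E) = iso m (fun i => ZMod.castHom h (ZMod m) (v i))

variable {E : WeierstrassCurve ℚ}

/-- The action of `σ` on `E[n]` in the given basis, as an endomorphism of `(ℤ/nℤ)²`. -/
def galLin (b : TorsionBasis E) (n : ℕ+) (σ : GalQ) :
    (Fin 2 → ZMod n) →ₗ[ZMod n] (Fin 2 → ZMod n) :=
  (((b.iso n).symm.toAddMonoidHom.comp (galTors n σ)).comp
    (b.iso n).toAddMonoidHom).toZModLinearMap n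

theorem iso_galLin (b : TorsionBasis E) (n : ℕ+) (σ : GalQ) (v : Fin 2 → ZMod n) :
    (b.iso n (galLin b n σ v) : Pt E) = galPt σ (b.iso n v : Pt E) := by
  simp [galLin, galTors]

theorem iso_ext (b : TorsionBasis E) (n : ℕ+) {v w : Fin 2 → ZMod n}
    (h : (b.iso n v : Pt E) = b.iso n w) : v = w :=
  (b.iso n).injective (Subtype.ext h)

/-- The matrix of `σ` acting on `E[n]` (acting on column vectors). -/
def galMatrixMod (b : TorsionBasis E) (n : ℕ+) (σ : GalQ) : Matrix (Fin 2) (Fin 2) (ZMod n) :=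
  LinearMap.toMatrix' (galLin b n σ)

theorem galMatrixMod_one (b : TorsionBasis E) (n : ℕ+) : galMatrixMod b n 1 = 1 := by
  have : galLin b n 1 = LinearMap.id :=
    LinearMap.ext fun v => iso_ext b n (by rw [iso_galLin, galPt_one]; rfl)
  rw [galMatrixMod, this, LinearMap.toMatrix'_id]

theorem galMatrixMod_mul (b : TorsionBasis E) (n : ℕ+) (σ τ : GalQ) :
    galMatrixMod b n (σ * τ) = galMatrixMod b n σ * galMatrixMod b n τ := by
  have : galLin b n (σ * τ) = (galLin b n σ).comp (galLin b n τ) :=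
    LinearMap.ext fun v => iso_ext b n (by
      rw [iso_galLin, galPt_mul, LinearMap.comp_apply, iso_galLin, iso_galLin])
  rw [galMatrixMod, this, LinearMap.toMatrix'_comp]; rfl

theorem galMatrixMod_compat (b : TorsionBasis E) (σ : GalQ) (i j : Fin 2) (m n : ℕ+)
    (h : (m : ℕ) ∣ n) :
    ZMod.castHom h (ZMod m) (galMatrixMod b n σ i j) = galMatrixMod b m σ i j := by
  have key : (fun i => ZMod.castHom h (ZMod m) (galLin b n σ (Pi.single j 1) i)) =
      galLin b m σ (Pi.single j 1) := by
    apply iso_ext b m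
    rw [← b.compat m n h, iso_galLin, iso_galLin, ← map_nsmul, b.compat m n h]
    congr 4
    funext k
    by_cases hk : k = j
    · subst hk; rw [Pi.single_eq_same, Pi.single_eq_same, map_one]
    · simp [hk]
  have := congrFun key i
  simpa [galMatrixMod, LinearMap.toMatrix'_apply, Pi.single_apply] using! this

/-- The matrix of `σ` in `M₂(Ẑ)`. -/
def galMatrix (b : TorsionBasis E) (σ : GalQ) : Matrix (Fin 2) (Fin 2) ZHat :=
  Matrix.of fun i j => ⟨fun n => galMatrixMod b n σ i j, galMatrixMod_compat b σ i j⟩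

theorem galMatrix_one (b : TorsionBasis E) : galMatrix b 1 = 1 := by
  ext i j n
  simp only [galMatrix, Matrix.of_apply, galMatrixMod_one, Matrix.one_apply]
  split_ifs <;> rfl

theorem galMatrix_mul (b : TorsionBasis E) (σ τ : GalQ) :
    galMatrix b (σ * τ) = galMatrix b σ * galMatrix b τ := by
  ext i j n
  simp only [galMatrix, Matrix.of_apply, galMatrixMod_mul, Matrix.mul_apply, Fin.sum_univ_two]
  rfl

/-- The Galois representation `ρ_E : Gal_ℚ → GL₂(Ẑ)`. -/
def rho (b : TorsionBasis E) : GalQ →* GL (Fin 2) ZHat :=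
  MonoidHom.toHomUnits
    { toFun := galMatrix b, map_one' := galMatrix_one b, map_mul' := galMatrix_mul b }

/-- The dual representation `ρ_E^*`: the transpose of `ρ_E(σ⁻¹)`. -/
def rhoDual (b : TorsionBasis E) : GalQ →* GL (Fin 2) ZHat :=
  MonoidHom.toHomUnits
    { toFun := fun σ => (rho b σ⁻¹ : Matrix (Fin 2) (Fin 2) ZHat).transpose
      map_one' := by simp
      map_mul' := fun σ τ => by
        rw [mul_inv_rev, map_mul, Units.val_mul, Matrix.transpose_mul] }

/-- `G_E = ρ_E^*(Gal_ℚ)`. -/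
def imageGroup (b : TorsionBasis E) : Subgroup (GL (Fin 2) ZHat) := (rhoDual b).range

/-- `E` (with a choice of bases, on which this does not depend) is a Serre curve. -/
def IsSerreCurve (b : TorsionBasis E) : Prop := (imageGroup b).index = 2

end SerreCurve

end

/-!
# Serre curves and agreeable closures

Write `G` for the image of Galois and `S` for the subgroup of level and index two, the kernel of the
sign of the permutations of the nonzero vectors modulo `2`.

*Input from arithmetic.* Three facts on `G` are needed. Its determinant is the inverse of the
cyclotomic character, hence is surjective (`det_rhoDual`, `cyc_surjective`); it is closed
(`mem_imageGroup_of_forall`); and a continuous character of order two of `Gal_ℚ` is trivial on the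
kernel of the cyclotomic character, as quadratic fields are cyclotomic
(`exists_forall_eq_one_of_cycMod`, by Gauss sums). The first fact rests on the Weil pairing, which is
built from scratch in the function field `L` of the curve. With `X` the generic point, chord functions
`lineFun A B X` have divisor `(A) + (B) - (A + B) - (0)`, and products of them give functions `f_Q`
with divisor `n (Q) - n (0)` for `Q` in the `n`-torsion. Reciprocity for chord functions
(`lineFun_reciprocity`) exhibits an `n`-th root `G_Q` of `f_Q ∘ [n]`, and the translation by a torsion
point `S` multiplies `G_Q` by the constant `e(S, Q)`, the function `weil`. If `e(S, Q) = 1` for all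
`S`, then by Galois theory `G_Q` is a function of `n X`, so `f_Q` is an `n`-th power, and this forces
`Q = 0` (`eq_zero_of_weil_eq_one`).

Applied to the sign of the matrices in `G`, the third fact shows that `G` is contained in
`groupOf γ`, a group of index two, for some character `γ` (`exists_imageGroup_le_groupOf`).

*A criterion for Serre curves.* Let the agreeable closure of `G` contain `groupOf γ` for some `γ`
that is nontrivial at `5`, as is the case for the groups in the theorem. Let `U` be an open group
that contains `G`, and let `n` be the level of `U ∩ SL₂`. The group `hull U n` generated by `U`, the
scalars and the kernel of reduction modulo `n` is agreeable (`isAgreeable_hull`), so it contains the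
agreeable closure. Its commutators lie in `U`, since scalars are central. Hence `U` contains the
commutators of `groupOf γ` and, for odd `p`, the factor `SL₂(ℤ_p)`. An explicit computation with
elementary matrices then shows that `U` contains `S ∩ SL₂` (`inf_levelTwo_le`). As `G` is closed, it
contains `S ∩ SL₂`, and so has index two (`isSerreCurve_of_groupOf_le`).

*Closures for Serre curves.* If `G` has index two, then `G = groupOf γ`. When `G` is not agreeable,
only the full group can be an agreeable group that contains it. When `G` is agreeable, no odd prime
divides its level, so `γ` is a character modulo `8`. If it is nontrivial at `5`, then it is `γ₂` or
`γ₋₂` (`eq_gamma_of_apply_five_ne_one`). Otherwise it is a character modulo `4`, and this is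
impossible (`imageGroup_ne_groupOf`): there is a cocycle on `GL₂(ℤ/4ℤ)` with values in `ℤ/4ℤ` twisted
by the determinant, which lifts the sign and extends the character of `SL₂(ℤ/4ℤ)` by which the sixth
power of the Dedekind eta function transforms. On `groupOf γ` it yields a character of order two that
is nontrivial at `upper 2`, a matrix of determinant one, against the third fact above.
-/

noncomputable section

/-! ### Chord functions on a Weierstrass curve -/

namespace SerreCurve

open WeierstrassCurve WeierstrassCurve.Affine

section LineFun

variable {F : Type*} [Field F] [DecidableEq F] {W : Affine F}

/-- The value at `C` of the function on `W` with divisor `(A) + (B) - (A + B) - (0)`, namely the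
equation of the line through `A` and `B` divided by that of the vertical line through `A + B`.
For `A + B = 0` this is the equation of the vertical line through `A`, and it is `1` if one of the
points is `0`. -/
def lineFun : W.Point → W.Point → W.Point → F
  | .some x₁ y₁ _, .some x₂ y₂ _, .some x y _ =>
    if x₁ = x₂ ∧ y₁ = W.negY x₂ y₂ then x - x₁ else
      (y - (W.slope x₁ x₂ y₁ y₂ * (x - x₁) + y₁)) / (x - W.addX x₁ x₂ (W.slope x₁ x₂ y₁ y₂))
  | _, _, _ => 1

@[simp] lemma lineFun_zero_left (B C : W.Point) : lineFun 0 B C = 1 := by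
  cases B <;> cases C <;> rfl

@[simp] lemma lineFun_zero_mid (A C : W.Point) : lineFun A 0 C = 1 := by
  cases A <;> cases C <;> rfl

@[simp] lemma lineFun_zero_right (A B : W.Point) : lineFun A B 0 = 1 := by
  cases A <;> cases B <;> rfl

lemma add_eq_zero_iff_coords {x₁ y₁ x₂ y₂ : F} (h₁ : W.Nonsingular x₁ y₁)
    (h₂ : W.Nonsingular x₂ y₂) :
    Point.some x₁ y₁ h₁ + Point.some x₂ y₂ h₂ = 0 ↔ x₁ = x₂ ∧ y₁ = W.negY x₂ y₂ := by
  refine ⟨fun h => ?_, fun h => Point.add_of_Y_eq h.1 h.2⟩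
  by_contra hxy
  rw [Point.add_some hxy] at h
  exact Point.some_ne_zero _ h

lemma lineFun_of_add_eq_zero {x₁ y₁ x₂ y₂ x y : F} {h₁ : W.Nonsingular x₁ y₁}
    {h₂ : W.Nonsingular x₂ y₂} {h : W.Nonsingular x y}
    (h0 : Point.some x₁ y₁ h₁ + Point.some x₂ y₂ h₂ = 0) :
    lineFun (.some x₁ y₁ h₁) (.some x₂ y₂ h₂) (.some x y h) = x - x₁ := by
  rw [add_eq_zero_iff_coords] at h0
  simp only [lineFun, if_pos h0]

/-- Three collinear points `(x₁, y₁)`, `(x₂, y₂)` and the negative of their sum `(x₃, y₃)`: the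
equation `y = ℓ x + μ` of the line, and the symmetric functions of the abscissae read off from the
cubic equation that they satisfy. -/
structure IsLine (W : Affine F) (x₁ y₁ x₂ y₂ x₃ y₃ ℓ μ : F) : Prop where
  y₁_eq : y₁ = ℓ * x₁ + μ
  y₂_eq : y₂ = ℓ * x₂ + μ
  y₃_eq : W.negY x₃ y₃ = ℓ * x₃ + μ
  e₁_eq : x₁ + x₂ + x₃ = ℓ ^ 2 + W.a₁ * ℓ - W.a₂
  e₂_eq : x₁ * x₂ + x₁ * x₃ + x₂ * x₃ = W.a₄ - 2 * ℓ * μ - W.a₁ * μ - W.a₃ * ℓ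
  e₃_eq : x₁ * x₂ * x₃ = μ ^ 2 + W.a₃ * μ - W.a₆

lemma exists_isLine {x₁ y₁ x₂ y₂ x₃ y₃ : F} {h₁ : W.Nonsingular x₁ y₁}
    {h₂ : W.Nonsingular x₂ y₂} {h₃ : W.Nonsingular x₃ y₃}
    (h : Point.some x₁ y₁ h₁ + Point.some x₂ y₂ h₂ = Point.some x₃ y₃ h₃) :
    ∃ ℓ μ, IsLine W x₁ y₁ x₂ y₂ x₃ y₃ ℓ μ ∧
      (∀ (x y : F) (h : W.Nonsingular x y),
        lineFun (.some x₁ y₁ h₁) (.some x₂ y₂ h₂) (.some x y h) = (y - (ℓ * x + μ)) / (x - x₃)) ∧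
      ℓ = W.slope x₁ x₂ y₁ y₂ := by
  have hxy : ¬(x₁ = x₂ ∧ y₁ = W.negY x₂ y₂) := fun h0 => by
    rw [Point.add_of_Y_eq h0.1 h0.2] at h
    exact Point.some_ne_zero _ h.symm
  rw [Point.add_some hxy] at h
  obtain ⟨hx3, hy3⟩ := Point.some.inj h
  have hp := addPolynomial_slope h₁.1 h₂.1 hxy
  set ℓ := W.slope x₁ x₂ y₁ y₂ with hℓ
  rw [addPolynomial_eq, neg_inj, Cubic.prod_X_sub_C_eq, Cubic.toPoly_injective] at hp
  have e2 := congrArg Cubic.c hp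
  have e3 := congrArg Cubic.d hp
  simp only [hx3] at e2 e3
  have hx3' : x₃ = ℓ ^ 2 + W.a₁ * ℓ - W.a₂ - x₁ - x₂ := hx3.symm
  refine ⟨ℓ, y₁ - ℓ * x₁, ⟨by ring, ?_, ?_, by rw [hx3']; ring, ?_, ?_⟩, ?_, rfl⟩
  · by_cases hx : x₁ = x₂
    · have := Y_eq_of_Y_ne h₁.1 h₂.1 hx (fun h => hxy ⟨hx, h⟩)
      subst hx; rw [this]; ring
    · rw [hℓ, slope_of_X_ne hx]
      field_simp [sub_ne_zero.2 hx]
      ring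
  · rw [← hy3, addY, hx3, negY_negY, negAddY, hx3]; ring
  · linear_combination -e2
  · have := (equation_iff ..).mp h₁.1
    linear_combination e3
  · intro x y h
    simp only [lineFun, if_neg hxy]
    rw [← hℓ, hx3]
    congr 1
    ring

omit [DecidableEq F] in
/-- The resultant of two lines with respect to the curve, computed along either line. -/
lemma IsLine.resultant {x₁ y₁ x₂ y₂ x₃ y₃ ℓ μ u₁ v₁ u₂ v₂ u₃ v₃ ℓ' μ' : F}
    (h : IsLine W x₁ y₁ x₂ y₂ x₃ y₃ ℓ μ) (h' : IsLine W u₁ v₁ u₂ v₂ u₃ v₃ ℓ' μ') :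
    ((ℓ' - ℓ) * x₁ + (μ' - μ)) * ((ℓ' - ℓ) * x₂ + (μ' - μ)) * ((ℓ' - ℓ) * x₃ + (μ' - μ)) =
    ((ℓ' - ℓ) * u₁ + (μ' - μ)) * ((ℓ' - ℓ) * u₂ + (μ' - μ)) * ((ℓ' - ℓ) * u₃ + (μ' - μ)) := by
  linear_combination (ℓ' - ℓ) ^ 3 * (h.e₃_eq - h'.e₃_eq) +
    (ℓ' - ℓ) ^ 2 * (μ' - μ) * (h.e₂_eq - h'.e₂_eq) + (ℓ' - ℓ) * (μ' - μ) ^ 2 * (h.e₁_eq - h'.e₁_eq)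

omit [DecidableEq F] in
/-- The norm of the equation of a line. -/
lemma IsLine.norm {x₁ y₁ x₂ y₂ x₃ y₃ ℓ μ x y : F} (h : IsLine W x₁ y₁ x₂ y₂ x₃ y₃ ℓ μ)
    (hxy : W.Equation x y) :
    (y - (ℓ * x + μ)) * (W.negY x y - (ℓ * x + μ)) = -((x - x₁) * (x - x₂) * (x - x₃)) := by
  rw [equation_iff] at hxy
  rw [negY]
  linear_combination -hxy - x ^ 2 * h.e₁_eq + x * h.e₂_eq - h.e₃_eq

/-- Points with different abscissae. -/
def XNe (P Q : W.Point) : Prop := P ≠ Q ∧ P ≠ -Q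

omit [DecidableEq F] in
lemma XNe.x_ne {x₁ y₁ x₂ y₂ : F} {h₁ : W.Nonsingular x₁ y₁} {h₂ : W.Nonsingular x₂ y₂}
    (h : XNe (Point.some x₁ y₁ h₁) (Point.some x₂ y₂ h₂)) : x₁ ≠ x₂ := fun hx =>
  (Point.X_eq_iff.1 hx).elim h.1 h.2

omit [DecidableEq F] in
lemma XNe.symm {P Q : W.Point} (h : XNe P Q) : XNe Q P :=
  ⟨h.1.symm, fun h' => h.2 (by rw [h', neg_neg])⟩

lemma lineFun_ne_zero {A B C : W.Point} (h₁ : XNe C A) (h₂ : XNe C B)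
    (h₃ : XNe C (A + B)) : lineFun A B C ≠ 0 := by
  rcases A with _ | ⟨x₁, y₁, hA⟩
  · rw [← Point.zero_def, lineFun_zero_left]; exact one_ne_zero
  rcases B with _ | ⟨x₂, y₂, hB⟩
  · rw [← Point.zero_def, lineFun_zero_mid]; exact one_ne_zero
  rcases C with _ | ⟨x, y, hC⟩
  · rw [← Point.zero_def, lineFun_zero_right]; exact one_ne_zero
  rcases hs : Point.some x₁ y₁ hA + Point.some x₂ y₂ hB with _ | ⟨x₃, y₃, h3⟩
  · rw [lineFun_of_add_eq_zero hs]
    exact sub_ne_zero.2 h₁.x_ne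
  · obtain ⟨ℓ, μ, hl, hf, -⟩ := exists_isLine hs
    rw [hs] at h₃
    rw [hf]
    refine div_ne_zero (fun h0 => ?_) (sub_ne_zero.2 h₃.x_ne)
    have := hl.norm hC.1
    rw [h0, zero_mul, eq_comm, neg_eq_zero] at this
    exact mul_ne_zero (mul_ne_zero (sub_ne_zero.2 h₁.x_ne) (sub_ne_zero.2 h₂.x_ne))
      (sub_ne_zero.2 h₃.x_ne) this

omit [DecidableEq F] in
lemma div_identity {p q r p' q' r' xa xb xc xd xr xs : F} (h₁ : xc - xs ≠ 0) (h₂ : xd - xs ≠ 0)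
    (h₃ : xs - xr ≠ 0) (h₄ : xa - xr ≠ 0) (h₅ : xb - xr ≠ 0)
    (h : p * q * r * ((xa - xr) * (xb - xr)) = p' * q' * r' * ((xc - xs) * (xd - xs))) :
    p / (xc - xs) * (q / (xd - xs)) * (r / (xs - xr)) =
      -(p' / (xr - xs) * (q' / (xa - xr)) * (r' / (xb - xr))) := by
  rw [← neg_sub xs xr]
  field_simp
  linear_combination h

/-- Weil reciprocity for two chord functions, up to sign. -/
theorem lineFun_reciprocity {A B C D : W.Point} (hC : C ≠ 0) (hD : D ≠ 0) (hCD : C + D ≠ 0)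
    (hAr : XNe A (C + D)) (hBr : XNe B (C + D))
    (hsC : XNe (A + B) C) (hsD : XNe (A + B) D) (hsr : XNe (A + B) (C + D)) :
    lineFun A B C * lineFun A B D * lineFun C D (A + B) =
        lineFun A B (C + D) * lineFun C D A * lineFun C D B ∨
      lineFun A B C * lineFun A B D * lineFun C D (A + B) =
        -(lineFun A B (C + D) * lineFun C D A * lineFun C D B) := by
  rcases A with _ | ⟨xa, ya, ha⟩
  · left; simp [← Point.zero_def]
  rcases B with _ | ⟨xb, yb, hb⟩
  · left; simp [← Point.zero_def]
  rcases C with _ | ⟨xc, yc, hc⟩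
  · exact absurd rfl hC
  rcases D with _ | ⟨xd, yd, hd⟩
  · exact absurd rfl hD
  rcases hr : Point.some xc yc hc + Point.some xd yd hd with _ | ⟨xr, yr, hr'⟩
  · exact absurd hr hCD
  rw [hr] at hAr hBr hsr
  obtain ⟨ℓ', μ', hl', hf', -⟩ := exists_isLine hr
  have nar := sub_ne_zero.2 hAr.x_ne
  have nbr := sub_ne_zero.2 hBr.x_ne
  rcases hs : Point.some xa ya ha + Point.some xb yb hb with _ | ⟨xs, ys, hs'⟩
  · left
    have h0 := (add_eq_zero_iff_coords ha hb).1 hs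
    rw [← Point.zero_def, lineFun_zero_right, lineFun_of_add_eq_zero hs,
      lineFun_of_add_eq_zero hs, lineFun_of_add_eq_zero hs, hf', hf']
    obtain ⟨rfl, hy⟩ := h0
    have := hl'.norm hb.1
    rw [← hy] at this
    have nra : xr - xa ≠ 0 := sub_ne_zero.2 hAr.x_ne.symm
    field_simp
    linear_combination (xa - xr) * this
  · right
    rw [hs] at hsC hsD hsr
    obtain ⟨ℓ, μ, hl, hf, -⟩ := exists_isLine hs
    have ncs := sub_ne_zero.2 hsC.x_ne.symm
    have nds := sub_ne_zero.2 hsD.x_ne.symm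
    have nsr := sub_ne_zero.2 hsr.x_ne
    have nrs := sub_ne_zero.2 hsr.x_ne.symm
    rw [hf, hf, hf, hf', hf', hf']
    have N1 := hl.norm hr'.1
    have N2 := hl'.norm hs'.1
    have R := hl.resultant hl'
    have nk : W.negY xr yr - (ℓ * xr + μ) ≠ 0 := fun h0 => by
      rw [h0, mul_zero, eq_comm, neg_eq_zero] at N1
      exact mul_ne_zero (mul_ne_zero (sub_ne_zero.2 hAr.x_ne.symm) (sub_ne_zero.2 hBr.x_ne.symm))
        nrs N1
    rw [hl'.y₃_eq] at N1 nk
    rw [hl.y₃_eq] at N2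
    have key : (yc - (ℓ * xc + μ)) * (yd - (ℓ * xd + μ)) * (ys - (ℓ' * xs + μ')) *
          ((xa - xr) * (xb - xr)) =
        (yr - (ℓ * xr + μ)) * (ya - (ℓ' * xa + μ')) * (yb - (ℓ' * xb + μ')) *
          ((xc - xs) * (xd - xs)) := by
      apply mul_right_cancel₀ nk
      rw [hl.y₁_eq, hl.y₂_eq, hl'.y₁_eq, hl'.y₂_eq]
      linear_combination (-(ys - (ℓ' * xs + μ')) * (xa - xr) * (xb - xr)) * R
        - ((ℓ' - ℓ) * xa + (μ' - μ)) * ((ℓ' - ℓ) * xb + (μ' - μ)) * (xa - xr) * (xb - xr) * N2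
        - ((ℓ' - ℓ) * xa + (μ' - μ)) * ((ℓ' - ℓ) * xb + (μ' - μ)) * (xc - xs) * (xd - xs) * N1
    exact div_identity ncs nds nsr nar nbr key

/-- Moving the argument of a chord function into its first slot. -/
theorem lineFun_eq_neg_lineFun {X D Q : W.Point} (hX : X ≠ 0) (hD : D ≠ 0) (hQ : Q ≠ 0)
    (h₁ : XNe X D) (h₂ : XNe Q D) (h₃ : XNe Q (X + D)) (h₄ : XNe X (-D + Q)) :
    lineFun X D Q = -lineFun (-D) Q X := by
  rcases X with _ | ⟨xX, yX, nX⟩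
  · exact absurd rfl hX
  rcases D with _ | ⟨xd, yd, nd⟩
  · exact absurd rfl hD
  rcases Q with _ | ⟨xq, yq, nq⟩
  · exact absurd rfl hQ
  have e₁ := h₁.x_ne
  have e₂ := h₂.x_ne
  have hnd : -Point.some xd yd nd = Point.some xd (W.negY xd yd) ((nonsingular_neg ..).2 nd) := rfl
  rcases hs : Point.some xX yX nX + Point.some xd yd nd with _ | ⟨xs, ys, ns⟩
  · exact absurd ((add_eq_zero_iff_coords ..).1 hs).1 e₁
  rcases ht : -Point.some xd yd nd + Point.some xq yq nq with _ | ⟨xt, yt, nt⟩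
  · rw [hnd] at ht
    exact absurd ((add_eq_zero_iff_coords ..).1 ht).1 e₂.symm
  rw [hs] at h₃
  rw [ht] at h₄
  rw [hnd] at ht ⊢
  obtain ⟨m, μ, hl, hf, hm⟩ := exists_isLine hs
  obtain ⟨k, ν, hl', hf', hk⟩ := exists_isLine ht
  have e₃ := sub_ne_zero.2 h₃.x_ne
  have e₄ := sub_ne_zero.2 h₄.x_ne
  rw [hf, hf', ← neg_div, div_eq_div_iff e₃ e₄]
  -- Each line is cut out by its slope at `D` (resp. `-D`); everything reduces to the equations of
  -- the three residual points.
  have hv : (xs - xd) * (xX - xd) =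
      3 * xd ^ 2 + 2 * W.a₂ * xd + W.a₄ - W.a₁ * yd - m * (2 * yd + W.a₁ * xd + W.a₃) := by
    linear_combination -2 * xd * hl.e₁_eq + hl.e₂_eq + (2 * m + W.a₁) * hl.y₂_eq
  have hw : (xt - xd) * (xq - xd) = 3 * xd ^ 2 + 2 * W.a₂ * xd + W.a₄ - W.a₁ * yd
      + (W.a₁ + k) * (2 * yd + W.a₁ * xd + W.a₃) := by
    have := hl'.y₁_eq
    rw [negY] at this
    linear_combination -2 * xd * hl'.e₁_eq + hl'.e₂_eq + (2 * k + W.a₁) * this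
  have y1 : yX = yd + m * (xX - xd) := by linear_combination hl.y₁_eq - hl.y₂_eq
  have y2 : yq = -yd - W.a₁ * xd - W.a₃ + k * (xq - xd) := by
    have := hl'.y₁_eq
    rw [negY] at this
    linear_combination hl'.y₂_eq - this
  have hμ : μ = yd - m * xd := by linear_combination -hl.y₂_eq
  have hν : ν = -yd - W.a₁ * xd - W.a₃ - k * xd := by
    have := hl'.y₁_eq
    rw [negY] at this
    linear_combination -this
  have hxs : xs = m ^ 2 + W.a₁ * m - W.a₂ - xX - xd := by linear_combination hl.e₁_eq
  have hxt : xt = k ^ 2 + W.a₁ * k - W.a₂ - xd - xq := by linear_combination hl'.e₁_eq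
  have hd2 : (xt + xq) - (xs + xX) = (k - m) * (k + m + W.a₁) := by rw [hxs, hxt]; ring
  rw [y1, y2, hμ, hν]
  linear_combination (2 * yd + W.a₁ * xd + W.a₃) * hd2 - (k - m) * (hw - hv)

end LineFun

section Map

variable {k : Type*} [Field k] {E : WeierstrassCurve k} {M M' : Type*} [Field M] [Field M']
  [Algebra k M] [Algebra k M'] [DecidableEq M] [DecidableEq M']

lemma map_lineFun (f : M →ₐ[k] M') (A B C : (E⁄M).Point) :
    f (lineFun A B C) = lineFun (Point.map (W' := E) f A) (Point.map (W' := E) f B)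
      (Point.map (W' := E) f C) := by
  rcases A with _ | ⟨x₁, y₁, h₁⟩
  · rw [← Point.zero_def]; simp
  rcases B with _ | ⟨x₂, y₂, h₂⟩
  · rw [← Point.zero_def]; simp
  rcases C with _ | ⟨x, y, h⟩
  · rw [← Point.zero_def]; simp
  rcases hs : Point.some x₁ y₁ h₁ + Point.some x₂ y₂ h₂ with _ | ⟨x₃, y₃, h₃⟩
  · have hs' := congrArg (Point.map (W' := E) f) hs
    rw [map_add, ← Point.zero_def, map_zero] at hs'
    rw [lineFun_of_add_eq_zero hs]
    rw [Point.map_some, Point.map_some] at hs' ⊢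
    rw [Point.map_some, lineFun_of_add_eq_zero hs', map_sub]
  · have hs' := congrArg (Point.map (W' := E) f) hs
    rw [map_add, Point.map_some, Point.map_some, Point.map_some] at hs'
    obtain ⟨ℓ, μ, hl, hf, hℓ⟩ := exists_isLine hs
    obtain ⟨ℓ', μ', hl', hf', hℓ'⟩ := exists_isLine hs'
    have e : ℓ' = f ℓ := by rw [hℓ', hℓ, ← baseChange_slope]
    have e' : μ' = f μ := by
      have h1 := hl'.y₁_eq
      have h2 := congrArg f hl.y₁_eq
      rw [map_add, map_mul] at h2
      rw [e] at h1
      linear_combination h2 - h1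
    rw [hf, Point.map_some, Point.map_some, Point.map_some, hf', e, e']
    simp
end Map

section TorsFun

variable {F : Type*} [Field F] [DecidableEq F] {W : Affine F}

/-- For `Q` with `n • Q = 0`, the value at `C` of a function with divisor `n (Q) - n (0)`. -/
def torsFun (n : ℕ) (Q C : W.Point) : F := ∏ i ∈ Finset.range (n - 1), lineFun Q ((i + 1) • Q) C

omit [DecidableEq F] in
lemma eq_or_eq_neg_mul {a b c d : F} (h : a = b ∨ a = -b) (h' : c = d ∨ c = -d) :
    a * c = b * d ∨ a * c = -(b * d) := by
  rcases h with rfl | rfl <;> rcases h' with rfl | rfl <;> simp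

/-- The failure of `torsFun n Q` to be a homomorphism is an `n`-th power. -/
theorem torsFun_mul_torsFun {n : ℕ} (hn : 0 < n) {Q C D : W.Point} (hQ : n • Q = 0)
    (hC : ∀ j : ℕ, XNe (j • Q) C) (hD : ∀ j : ℕ, XNe (j • Q) D)
    (hCD : ∀ j : ℕ, XNe (j • Q) (C + D)) :
    torsFun n Q C * torsFun n Q D = torsFun n Q (C + D) * lineFun C D Q ^ n ∨
      torsFun n Q C * torsFun n Q D = -(torsFun n Q (C + D) * lineFun C D Q ^ n) := by
  obtain ⟨m, rfl⟩ := Nat.exists_eq_succ_of_ne_zero hn.ne'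
  suffices key : ∀ m : ℕ, (∏ i ∈ Finset.range m, lineFun Q ((i + 1) • Q) C) *
      (∏ i ∈ Finset.range m, lineFun Q ((i + 1) • Q) D) * lineFun C D ((m + 1) • Q) =
        (∏ i ∈ Finset.range m, lineFun Q ((i + 1) • Q) (C + D)) * lineFun C D Q ^ (m + 1) ∨
      (∏ i ∈ Finset.range m, lineFun Q ((i + 1) • Q) C) *
      (∏ i ∈ Finset.range m, lineFun Q ((i + 1) • Q) D) * lineFun C D ((m + 1) • Q) =
        -((∏ i ∈ Finset.range m, lineFun Q ((i + 1) • Q) (C + D)) * lineFun C D Q ^ (m + 1)) by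
    have := key m
    rwa [show (m + 1) • Q = 0 from hQ, lineFun_zero_right, mul_one] at this
  clear hQ hn m
  intro m
  induction m with
  | zero => left; simp
  | succ m ih =>
    have ne0 : ∀ {P : W.Point}, (∀ j : ℕ, XNe (j • Q) P) → P ≠ 0 := fun h h0 =>
      (h 0).1 (by rw [zero_smul, h0])
    have h1 : ∀ {P : W.Point}, (∀ j : ℕ, XNe (j • Q) P) → XNe Q P := fun h => by
      simpa using h 1
    have hs : Q + (m + 1) • Q = (m + 1 + 1) • Q := by rw [succ_nsmul' Q (m + 1)]
    have R := lineFun_reciprocity (A := Q) (B := (m + 1) • Q) (C := C) (D := D) (ne0 hC) (ne0 hD)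
      (ne0 hCD) (h1 hCD) (hCD _) (hs ▸ hC _) (hs ▸ hD _) (hs ▸ hCD _)
    rw [hs] at R
    have := eq_or_eq_neg_mul ih R
    simp only [Finset.prod_range_succ]
    by_cases h0 : lineFun C D ((m + 1) • Q) = 0
    · left
      exfalso
      exact lineFun_ne_zero (hC _) (hD _) (hCD _) h0
    · rcases this with h | h
      · left
        apply mul_right_cancel₀ h0
        linear_combination h
      · right
        apply mul_right_cancel₀ h0
        linear_combination h

/-- Up to an `n`-th power, `torsFun n Q` at a multiple of `X` is a power of its value at `X`. -/
theorem torsFun_nsmul_mul {n : ℕ} (hn : 0 < n) {Q X : W.Point} (hQ : n • Q = 0)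
    (hX : ∀ i j : ℕ, XNe (j • Q) ((i + 1) • X)) (m : ℕ) :
    torsFun n Q ((m + 1) • X) * (∏ i ∈ Finset.range m, lineFun X ((i + 1) • X) Q) ^ n =
        torsFun n Q X ^ (m + 1) ∨
      torsFun n Q ((m + 1) • X) * (∏ i ∈ Finset.range m, lineFun X ((i + 1) • X) Q) ^ n =
        -torsFun n Q X ^ (m + 1) := by
  induction m with
  | zero => left; simp
  | succ m ih =>
    have hs : X + (m + 1) • X = (m + 1 + 1) • X := by rw [succ_nsmul' X (m + 1)]
    have h := torsFun_mul_torsFun hn hQ (C := X) (D := (m + 1) • X)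
      (fun j => by simpa using hX 0 j) (hX m) (fun j => hs ▸ hX (m + 1) j)
    rw [hs] at h
    rw [Finset.prod_range_succ, mul_pow, pow_succ (torsFun n Q X) (m + 1)]
    rcases h with h | h <;> rcases ih with ih | ih
    · left; rw [← ih]; linear_combination -(∏ i ∈ Finset.range m, lineFun X ((i + 1) • X) Q) ^ n * h
    · right; rw [← neg_mul, ← ih]
      linear_combination -(∏ i ∈ Finset.range m, lineFun X ((i + 1) • X) Q) ^ n * h
    · right; rw [← ih]
      linear_combination (∏ i ∈ Finset.range m, lineFun X ((i + 1) • X) Q) ^ n * h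
    · left; rw [← neg_neg (torsFun n Q X ^ (m + 1)), ← ih]
      linear_combination (∏ i ∈ Finset.range m, lineFun X ((i + 1) • X) Q) ^ n * h

end TorsFun

end SerreCurve

/-! ### The generic point of an elliptic curve -/

namespace SerreCurve

open WeierstrassCurve WeierstrassCurve.Affine Polynomial
open scoped Polynomial.Bivariate

section Generic

variable {k K : Type*} [Field k] [Field K] [Algebra k K] {E : WeierstrassCurve k}

section Lift

variable {M : Type*} [Field M] [Algebra k M]

/-- Evaluation of regular functions on `E` at a point over an extension of the base field. -/
def evalHom (ψ : K →ₐ[k] M) {x y : M} (h : (E⁄M).Equation x y) :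
    (E⁄K).CoordinateRing →+* M :=
  AdjoinRoot.lift (eval₂RingHom (ψ : K →+* M) x) y (by
    rw [equation_iff] at h
    have e1 : (E⁄M).a₁ = ψ (E⁄K).a₁ := (ψ.commutes _).symm
    have e2 : (E⁄M).a₂ = ψ (E⁄K).a₂ := (ψ.commutes _).symm
    have e3 : (E⁄M).a₃ = ψ (E⁄K).a₃ := (ψ.commutes _).symm
    have e4 : (E⁄M).a₄ = ψ (E⁄K).a₄ := (ψ.commutes _).symm
    have e6 : (E⁄M).a₆ = ψ (E⁄K).a₆ := (ψ.commutes _).symm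
    rw [e1, e2, e3, e4, e6] at h
    rw [WeierstrassCurve.Affine.polynomial]
    simp only [eval₂_add, eval₂_sub, eval₂_mul, eval₂_pow, eval₂_X, eval₂_C, coe_eval₂RingHom,
      RingHom.coe_coe]
    linear_combination h)

lemma evalHom_smul_add (ψ : K →ₐ[k] M) {x y : M} (h : (E⁄M).Equation x y) (p q : K[X]) :
    evalHom ψ h (p • (1 : (E⁄K).CoordinateRing) + q • CoordinateRing.mk (E⁄K) Y) =
      p.eval₂ (ψ : K →+* M) x + q.eval₂ (ψ : K →+* M) x * y := by
  rw [CoordinateRing.smul, CoordinateRing.smul, mul_one, map_add, map_mul, evalHom,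
    AdjoinRoot.lift_mk, AdjoinRoot.lift_mk, AdjoinRoot.lift_mk]
  simp

/-- `x` is transcendental over the image of `ψ`. -/
def IsGeneric (ψ : K →ₐ[k] M) (x : M) : Prop := ∀ p : K[X], p.eval₂ (ψ : K →+* M) x = 0 → p = 0

lemma evalHom_injective (ψ : K →ₐ[k] M) {x y : M} (h : (E⁄M).Equation x y) (hx : IsGeneric ψ x) :
    Function.Injective (evalHom ψ h) := by
  rw [injective_iff_map_eq_zero]
  intro f hf
  obtain ⟨p, q, rfl⟩ := CoordinateRing.exists_smul_basis_eq f
  -- The norm of `f` is a multiple of `f`, and it is a polynomial in `x` alone.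
  have hN := CoordinateRing.coe_norm_smul_basis (W' := (E⁄K)) p q
  have e0 : CoordinateRing.mk (E⁄K) (C p + C q * Y) =
      p • (1 : (E⁄K).CoordinateRing) + q • CoordinateRing.mk (E⁄K) Y := by
    rw [CoordinateRing.smul, CoordinateRing.smul, mul_one, map_add, map_mul]
  rw [map_mul (CoordinateRing.mk (E⁄K)), e0] at hN
  have hN' := congrArg (evalHom ψ h) hN
  rw [map_mul, hf, zero_mul] at hN'
  have e1 := evalHom_smul_add ψ h
    (Algebra.norm K[X] (p • (1 : (E⁄K).CoordinateRing) + q • CoordinateRing.mk (E⁄K) Y)) 0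
  rw [zero_smul, add_zero, eval₂_zero, zero_mul, add_zero, Algebra.smul_def, mul_one] at e1
  have h0 := hx _ (e1.symm.trans hN')
  have := Module.Finite.of_basis (CoordinateRing.basis (E⁄K))
  exact Algebra.norm_eq_zero_iff.1 h0

end Lift

variable (E K)

/-- A field of fractions of the coordinate ring of `E` over `K`, seen as an extension of `K`. -/
class IsFunctionField (L : Type*) [Field L] [Algebra k L] [Algebra K L]
    [Algebra (E⁄K).CoordinateRing L] : Prop where
  tower : IsScalarTower k K L
  tower' : IsScalarTower K (E⁄K).CoordinateRing L
  frac : IsFractionRing (E⁄K).CoordinateRing L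

attribute [instance] IsFunctionField.tower IsFunctionField.tower' IsFunctionField.frac

variable {E K}
variable {L : Type*} [Field L] [Algebra k L] [Algebra K L]
  [Algebra (E⁄K).CoordinateRing L] [IsFunctionField K E L]

variable (E K L) in
/-- The abscissa of the generic point. -/
def genX : L := algebraMap (E⁄K).CoordinateRing L (CoordinateRing.mk (E⁄K) (C X))

variable (E K L) in
/-- The ordinate of the generic point. -/
def genY : L := algebraMap (E⁄K).CoordinateRing L (CoordinateRing.mk (E⁄K) Y)

variable (E K L) in
/-- The inclusion of the constants in the function field. -/
def constHom : K →ₐ[k] L := IsScalarTower.toAlgHom k K L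

lemma algebraMap_smul_add (p q : K[X]) : algebraMap (E⁄K).CoordinateRing L
      (p • (1 : (E⁄K).CoordinateRing) + q • CoordinateRing.mk (E⁄K) Y) =
    p.eval₂ (algebraMap K L) (genX K E L) + q.eval₂ (algebraMap K L) (genX K E L) * genY K E L := by
  have key : ∀ p : K[X], algebraMap (E⁄K).CoordinateRing L (CoordinateRing.mk (E⁄K) (C p)) =
      p.eval₂ (algebraMap K L) (genX K E L) := by
    intro p
    induction p using Polynomial.induction_on' with
    | add p q hp hq => rw [C_add, map_add, map_add, hp, hq, eval₂_add]
    | monomial n a =>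
      rw [eval₂_monomial, ← C_mul_X_pow_eq_monomial, C_mul, C_pow, map_mul, map_mul, map_pow,
        map_pow, genX]
      congr 1
      exact (IsScalarTower.algebraMap_apply K (E⁄K).CoordinateRing L a).symm
  rw [CoordinateRing.smul, CoordinateRing.smul, mul_one, map_add, map_mul, key, key, genY]

lemma isGeneric_genX : IsGeneric (constHom K E L) (genX K E L) := by
  intro p hp
  have h := algebraMap_smul_add (E := E) (L := L) p 0
  rw [zero_smul, add_zero, eval₂_zero, zero_mul, add_zero] at h
  have : algebraMap (E⁄K).CoordinateRing L (p • 1) = 0 := h.trans hp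
  rw [IsFractionRing.to_map_eq_zero_iff] at this
  exact (CoordinateRing.smul_basis_eq_zero (p := p) (q := 0) (by rw [this, zero_smul, add_zero])).1

lemma equation_gen : (E⁄L).Equation (genX K E L) (genY K E L) := by
  have hY : CoordinateRing.mk (E⁄K) (Y ^ 2 + C (C (algebraMap k K E.a₁) * X + C (algebraMap k K E.a₃)) * Y -
      C (X ^ 3 + C (algebraMap k K E.a₂) * X ^ 2 + C (algebraMap k K E.a₄) * X + C (algebraMap k K E.a₆))) = 0 := AdjoinRoot.mk_self
  have h := congrArg (algebraMap (E⁄K).CoordinateRing L) hY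
  have c : ∀ a : k, algebraMap (E⁄K).CoordinateRing L
      (CoordinateRing.mk (E⁄K) (C (C (algebraMap k K a)))) = algebraMap k L a := fun a => by
    rw [IsScalarTower.algebraMap_apply k K L,
      IsScalarTower.algebraMap_apply K (E⁄K).CoordinateRing L]
    rfl
  simp only [map_add, map_sub, map_mul, map_pow, map_zero] at h
  rw [equation_iff]
  change _ ^ 2 + algebraMap k L _ * _ * _ + algebraMap k L _ * _ =
    _ ^ 3 + algebraMap k L _ * _ ^ 2 + algebraMap k L _ * _ + algebraMap k L _
  rw [← c, ← c, ← c, ← c, ← c, genX, genY]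
  linear_combination h

section Lift'

variable {M : Type*} [Field M] [Algebra k M]

/-- The embedding of the function field given by a generic point `(x, y)` over an extension of the
base field: it sends the coordinates of the generic point to `x` and `y`. -/
def liftPt (ψ : K →ₐ[k] M) {x y : M} (h : (E⁄M).Equation x y) (hx : IsGeneric ψ x) : L →ₐ[k] M :=
  { IsFractionRing.lift (K := L) (evalHom_injective ψ h hx) with
    commutes' := fun a => by
      simp only [RingHom.toMonoidHom_eq_coe, OneHom.toFun_eq_coe, MonoidHom.toOneHom_coe,
        MonoidHom.coe_coe]
      rw [IsScalarTower.algebraMap_apply k K L,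
        IsScalarTower.algebraMap_apply K (E⁄K).CoordinateRing L, IsFractionRing.lift_algebraMap]
      have := evalHom_smul_add ψ h (C (algebraMap k K a)) 0
      rw [zero_smul, add_zero, eval₂_zero, zero_mul, add_zero, eval₂_C] at this
      rw [← ψ.commutes]
      refine Eq.trans ?_ this
      rw [Algebra.smul_def, mul_one]
      rfl }

lemma liftPt_algebraMap (ψ : K →ₐ[k] M) {x y : M} (h : (E⁄M).Equation x y) (hx : IsGeneric ψ x)
    (f : (E⁄K).CoordinateRing) :
    liftPt (L := L) ψ h hx (algebraMap _ L f) = evalHom ψ h f :=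
  IsFractionRing.lift_algebraMap (evalHom_injective ψ h hx) f

lemma liftPt_const (ψ : K →ₐ[k] M) {x y : M} (h : (E⁄M).Equation x y) (hx : IsGeneric ψ x) (a : K) :
    liftPt (L := L) ψ h hx (algebraMap K L a) = ψ a := by
  rw [IsScalarTower.algebraMap_apply K (E⁄K).CoordinateRing L, liftPt_algebraMap]
  have := evalHom_smul_add ψ h (C a) 0
  rw [zero_smul, add_zero, eval₂_zero, zero_mul, add_zero, eval₂_C] at this
  refine Eq.trans ?_ this
  rw [Algebra.smul_def, mul_one]
  rfl

@[simp] lemma liftPt_comp_const (ψ : K →ₐ[k] M) {x y : M} (h : (E⁄M).Equation x y)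
    (hx : IsGeneric ψ x) : (liftPt (L := L) ψ h hx).comp (constHom K E L) = ψ :=
  AlgHom.ext fun a => liftPt_const ψ h hx a

lemma liftPt_genX (ψ : K →ₐ[k] M) {x y : M} (h : (E⁄M).Equation x y) (hx : IsGeneric ψ x) :
    liftPt (L := L) ψ h hx (genX K E L) = x := by
  rw [genX, liftPt_algebraMap, evalHom, AdjoinRoot.lift_mk]
  simp

lemma liftPt_genY (ψ : K →ₐ[k] M) {x y : M} (h : (E⁄M).Equation x y) (hx : IsGeneric ψ x) :
    liftPt (L := L) ψ h hx (genY K E L) = y := by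
  rw [genY, liftPt_algebraMap, evalHom, AdjoinRoot.lift_mk]
  simp

/-- Embeddings of the function field are determined by the images of the constants and of the
generic point. -/
lemma functionField_hom_ext {f g : L →ₐ[k] M}
    (hc : f.comp (constHom K E L) = g.comp (constHom K E L))
    (hx : f (genX K E L) = g (genX K E L)) (hy : f (genY K E L) = g (genY K E L)) : f = g := by
  have key : ∀ r : (E⁄K).CoordinateRing, f (algebraMap _ L r) = g (algebraMap _ L r) := by
    intro r
    obtain ⟨p, q, rfl⟩ := CoordinateRing.exists_smul_basis_eq r
    have e : (f : L →+* M).comp (algebraMap K L) = (g : L →+* M).comp (algebraMap K L) :=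
      RingHom.ext fun a => DFunLike.congr_fun hc a
    have hp : ∀ p : K[X], f (p.eval₂ (algebraMap K L) (genX K E L)) =
        g (p.eval₂ (algebraMap K L) (genX K E L)) := fun p => by
      have h1 := hom_eval₂ p (algebraMap K L) (f : L →+* M) (genX K E L)
      have h2 := hom_eval₂ p (algebraMap K L) (g : L →+* M) (genX K E L)
      rw [RingHom.coe_coe] at h1 h2
      rw [h1, h2, e, hx]
    rw [algebraMap_smul_add, map_add, map_add, map_mul, map_mul, hp, hp, hy]
  refine AlgHom.ext fun z => ?_
  obtain ⟨a, b, hb, rfl⟩ := IsFractionRing.div_surjective (A := (E⁄K).CoordinateRing) z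
  rw [map_div₀, map_div₀, key, key]

end Lift'

end Generic
end SerreCurve

namespace SerreCurve

open WeierstrassCurve WeierstrassCurve.Affine Polynomial
open scoped Polynomial.Bivariate

section GenericPoint

variable {k K : Type*} [Field k] [Field K] [Algebra k K] {E : WeierstrassCurve k} [E.IsElliptic]
  [DecidableEq K]

instance isElliptic_baseChange {M : Type*} [Field M] [Algebra k M] : (E⁄M).IsElliptic :=
  inferInstanceAs (E.map (algebraMap k M)).IsElliptic

variable {L : Type*} [Field L] [Algebra k L] [Algebra K L] [DecidableEq L]
  [Algebra (E⁄K).CoordinateRing L] [IsFunctionField K E L]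
  {M : Type*} [Field M] [Algebra k M] [DecidableEq M]

variable (K E L) in
/-- The generic point of `E`. -/
def genPt : (E⁄L).Point := Point.mk (equation_gen (K := K))

/-- A point of `E` over `K`, seen as a point over the function field. -/
abbrev cPt : (E⁄K).Point →+ (E⁄L).Point := Point.map (W' := E) (constHom K E L)

omit [DecidableEq K] in
lemma functionField_hom_ext' {f g : L →ₐ[k] M}
    (hc : f.comp (constHom K E L) = g.comp (constHom K E L))
    (h : Point.map (W' := E) f (genPt K E L) = Point.map (W' := E) g (genPt K E L)) : f = g := by
  obtain ⟨hx, hy⟩ := Point.some.inj h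
  exact functionField_hom_ext hc hx hy

omit [E.IsElliptic] in
lemma map_cPt (f : L →ₐ[k] M) (S : (E⁄K).Point) :
    Point.map (W' := E) f (cPt (L := L) S) = Point.map (W' := E) (f.comp (constHom K E L)) S :=
  Point.map_map ..

section AlgClosed

variable [IsAlgClosed K]

omit [E.IsElliptic] in
/-- Over an extension of an algebraically closed field, a point is either constant or generic. -/
lemma const_or_isGeneric (ψ : K →ₐ[k] M) (P : (E⁄M).Point) :
    (∃ S : (E⁄K).Point, P = Point.map (W' := E) ψ S) ∨
      ∃ (x y : M) (h : (E⁄M).Nonsingular x y), P = .some x y h ∧ IsGeneric ψ x := by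
  rcases P with _ | ⟨x, y, h⟩
  · exact .inl ⟨0, rfl⟩
  by_cases hx : IsGeneric ψ x
  · exact .inr ⟨x, y, h, rfl, hx⟩
  left
  -- an element algebraic over the image of `ψ` lies in this image
  have alg : ∀ (p : K[X]) (z : M), p ≠ 0 → p.eval₂ (ψ : K →+* M) z = 0 → ∃ a : K, ψ a = z := by
    intro p z hp hz
    have h1 := congrArg (eval₂ (ψ : K →+* M) z) (Splits.eq_prod_roots (IsAlgClosed.splits p))
    rw [hz, eval₂_mul, eval₂_C, eval₂_multiset_prod, eq_comm, mul_eq_zero,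
      Multiset.prod_eq_zero_iff, Multiset.map_map] at h1
    rcases h1 with h1 | h1
    · exact absurd ((map_eq_zero _).1 h1) (leadingCoeff_ne_zero.2 hp)
    · obtain ⟨a, -, ha⟩ := Multiset.mem_map.1 h1
      rw [Function.comp_apply, eval₂_sub, eval₂_X, eval₂_C] at ha
      exact ⟨a, (sub_eq_zero.1 ha).symm⟩
  simp only [IsGeneric, not_forall] at hx
  obtain ⟨p, hp, hp0⟩ := hx
  obtain ⟨a, rfl⟩ := alg p x hp0 hp
  have hy : (X ^ 2 + C ((E⁄K).a₁ * a + (E⁄K).a₃) * X -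
      C (a ^ 3 + (E⁄K).a₂ * a ^ 2 + (E⁄K).a₄ * a + (E⁄K).a₆)).eval₂ (ψ : K →+* M) y = 0 := by
    have := (equation_iff ..).1 h.1
    simp only [eval₂_add, eval₂_sub, eval₂_mul, eval₂_pow, eval₂_X, eval₂_C, map_add, map_mul,
      map_pow, RingHom.coe_coe]
    have e1 : (E⁄M).a₁ = ψ (E⁄K).a₁ := (ψ.commutes _).symm
    have e2 : (E⁄M).a₂ = ψ (E⁄K).a₂ := (ψ.commutes _).symm
    have e3 : (E⁄M).a₃ = ψ (E⁄K).a₃ := (ψ.commutes _).symm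
    have e4 : (E⁄M).a₄ = ψ (E⁄K).a₄ := (ψ.commutes _).symm
    have e6 : (E⁄M).a₆ = ψ (E⁄K).a₆ := (ψ.commutes _).symm
    rw [e1, e2, e3, e4, e6] at this
    linear_combination this
  have ne : ∀ u v : K, X ^ 2 + C u * X - C v ≠ 0 := fun u v h0 => by
    have := congrArg (coeff · 2) h0
    simp at this
  obtain ⟨b, rfl⟩ := alg _ y (ne _ _) hy
  exact ⟨.some a b ((WeierstrassCurve.Affine.baseChange_nonsingular (W := E) ψ.injective ..).1 h), rfl⟩

/-- A non-constant point defines an embedding of the function field. -/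
lemma exists_hom (ψ : K →ₐ[k] M) {P : (E⁄M).Point}
    (hP : ∀ S : (E⁄K).Point, P ≠ Point.map (W' := E) ψ S) :
    ∃ φ : L →ₐ[k] M, φ.comp (constHom K E L) = ψ ∧ Point.map (W' := E) φ (genPt K E L) = P := by
  rcases const_or_isGeneric ψ P with ⟨S, hS⟩ | ⟨x, y, h, rfl, hx⟩
  · exact absurd hS (hP S)
  · refine ⟨liftPt ψ h.1 hx, liftPt_comp_const .., ?_⟩
    rw [genPt, Point.mk, Point.map_some]
    simp only [liftPt_genX, liftPt_genY]

omit [IsAlgClosed K] in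
lemma genPt_ne_cPt (S : (E⁄K).Point) : genPt K E L ≠ cPt S := by
  rcases S with _ | ⟨a, b, h⟩
  · exact Point.some_ne_zero _
  · intro h0
    obtain ⟨hx, -⟩ := Point.some.inj h0
    refine X_sub_C_ne_zero a (isGeneric_genX (E := E) (L := L) _ ?_)
    rw [eval₂_sub, eval₂_X, eval₂_C, hx]
    exact sub_self _

omit [IsAlgClosed K] in
lemma genPt_add_ne_cPt (S T : (E⁄K).Point) : genPt K E L + cPt S ≠ cPt T := fun h =>
  genPt_ne_cPt (T - S) (by rw [eq_sub_of_add_eq h, ← map_sub])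

lemma exists_transl (S : (E⁄K).Point) :
    ∃ φ : L →ₐ[k] L, φ.comp (constHom K E L) = constHom K E L ∧
      Point.map (W' := E) φ (genPt K E L) = genPt K E L + cPt S :=
  exists_hom _ (genPt_add_ne_cPt S)

variable (L) in
/-- The endomorphism of the function field induced by translation by `S`. -/
def transl (S : (E⁄K).Point) : L →ₐ[k] L := (exists_transl S).choose

@[simp] lemma transl_comp_const (S : (E⁄K).Point) :
    (transl L S).comp (constHom K E L) = constHom K E L := (exists_transl S).choose_spec.1

@[simp] lemma transl_algebraMap (S : (E⁄K).Point) (a : K) :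
    transl L S (algebraMap K L a) = algebraMap K L a :=
  DFunLike.congr_fun (transl_comp_const (L := L) S) a

lemma map_transl_genPt (S : (E⁄K).Point) :
    Point.map (W' := E) (transl L S) (genPt K E L) = genPt K E L + cPt S :=
  (exists_transl S).choose_spec.2

lemma map_transl_cPt (S T : (E⁄K).Point) :
    Point.map (W' := E) (transl L S) (cPt T) = cPt T := by
  rw [map_cPt, transl_comp_const]

lemma transl_transl (S T : (E⁄K).Point) (f : L) :
    transl L S (transl L T f) = transl L (S + T) f := by
  have : (transl L S).comp (transl L T) = transl L (S + T) := by
    refine functionField_hom_ext' (K := K) (E := E) ?_ ?_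
    · rw [AlgHom.comp_assoc, transl_comp_const, transl_comp_const, transl_comp_const]
    · rw [← Point.map_map, map_transl_genPt, map_add, map_transl_genPt, map_transl_cPt,
        map_transl_genPt, map_add, add_assoc]
  exact DFunLike.congr_fun this f

lemma transl_zero (f : L) : transl L (0 : (E⁄K).Point) f = f := by
  have : transl L (0 : (E⁄K).Point) = AlgHom.id k L := by
    refine functionField_hom_ext' (K := K) (E := E) ?_ ?_
    · rw [transl_comp_const]; rfl
    · rw [map_transl_genPt, map_zero, add_zero]
      rfl
  exact DFunLike.congr_fun this f

/-- Multiples of the generic point are not constant, since there are points of `E` that are not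
killed by `j`. -/
lemma nsmul_genPt_ne_cPt {j : ℕ} (hj : ∃ S : (E⁄K).Point, j • S ≠ 0) (T : (E⁄K).Point) :
    j • genPt K E L ≠ cPt T := by
  obtain ⟨S, hS⟩ := hj
  intro h
  have h1 := congrArg (Point.map (W' := E) (transl L S)) h
  rw [map_nsmul, map_transl_genPt, map_transl_cPt, nsmul_add, h, add_eq_left, ← map_nsmul,
    map_eq_zero_iff _ (Point.map_injective _)] at h1
  exact hS h1

lemma exists_mulHom {j : ℕ} (hj : ∃ S : (E⁄K).Point, j • S ≠ 0) :
    ∃ φ : L →ₐ[k] L, φ.comp (constHom K E L) = constHom K E L ∧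
      Point.map (W' := E) φ (genPt K E L) = j • genPt K E L :=
  exists_hom _ (nsmul_genPt_ne_cPt hj)

variable (L) in
/-- The endomorphism of the function field induced by multiplication by `j`. -/
def mulHom {j : ℕ} (hj : ∃ S : (E⁄K).Point, j • S ≠ 0) : L →ₐ[k] L := (exists_mulHom hj).choose

@[simp] lemma mulHom_comp_const {j : ℕ} (hj : ∃ S : (E⁄K).Point, j • S ≠ 0) :
    (mulHom L hj).comp (constHom K E L) = constHom K E L := (exists_mulHom hj).choose_spec.1

@[simp] lemma mulHom_algebraMap {j : ℕ} (hj : ∃ S : (E⁄K).Point, j • S ≠ 0) (a : K) :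
    mulHom L hj (algebraMap K L a) = algebraMap K L a :=
  DFunLike.congr_fun (mulHom_comp_const (L := L) hj) a

lemma map_mulHom_genPt {j : ℕ} (hj : ∃ S : (E⁄K).Point, j • S ≠ 0) :
    Point.map (W' := E) (mulHom L hj) (genPt K E L) = j • genPt K E L :=
  (exists_mulHom hj).choose_spec.2

lemma map_mulHom_cPt {j : ℕ} (hj : ∃ S : (E⁄K).Point, j • S ≠ 0) (T : (E⁄K).Point) :
    Point.map (W' := E) (mulHom L hj) (cPt T) = cPt T := by
  rw [map_cPt, mulHom_comp_const]

/-- Translation by `S` before multiplication by `j` is translation by `j • S` after it. -/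
lemma transl_mulHom {j : ℕ} (hj : ∃ S : (E⁄K).Point, j • S ≠ 0) (S : (E⁄K).Point) (f : L) :
    transl L S (mulHom L hj f) = mulHom L hj (transl L (j • S) f) := by
  have : (transl L S).comp (mulHom L hj) = (mulHom L hj).comp (transl L (j • S)) := by
    refine functionField_hom_ext' (K := K) (E := E) ?_ ?_
    · rw [AlgHom.comp_assoc, AlgHom.comp_assoc, mulHom_comp_const, transl_comp_const,
        transl_comp_const, mulHom_comp_const]
    · rw [← Point.map_map, ← Point.map_map, map_mulHom_genPt, map_transl_genPt, map_nsmul,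
        map_transl_genPt, map_add, map_mulHom_genPt, map_mulHom_cPt, nsmul_add, map_nsmul]
  exact DFunLike.congr_fun this f

omit [DecidableEq K] [IsAlgClosed K] in
/-- The action on the function field of an automorphism of the field of constants. -/
lemma exists_galHom (σ : K →ₐ[k] K) : ∃ φ : L →ₐ[k] L,
    (∀ a : K, φ (algebraMap K L a) = algebraMap K L (σ a)) ∧
      Point.map (W' := E) φ (genPt K E L) = genPt K E L := by
  have hg : IsGeneric ((constHom K E L).comp σ) (genX K E L) := fun p hp => by
    have h := isGeneric_genX (E := E) (L := L) (p.map (σ : K →+* K)) (by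
      rw [eval₂_map]; exact hp)
    rwa [Polynomial.map_eq_zero_iff (RingHom.injective _)] at h
  refine ⟨liftPt _ equation_gen hg, liftPt_const _ _ hg, ?_⟩
  rw [genPt, Point.mk, Point.map_some]
  simp only [liftPt_genX, liftPt_genY]

end AlgClosed

end GenericPoint

end SerreCurve

/-! ### Divisors of functions, as fractional ideals of the coordinate ring -/

namespace SerreCurve

open WeierstrassCurve WeierstrassCurve.Affine Polynomial
open scoped Polynomial.Bivariate nonZeroDivisors

section Ideals

variable {k K : Type*} [Field k] [Field K] [Algebra k K] {E : WeierstrassCurve k}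
  {L : Type*} [Field L] [Algebra k L] [Algebra K L]
  [Algebra (E⁄K).CoordinateRing L] [IsFunctionField K E L]

/-- The fractional ideal of the coordinate ring attached to a point; it is trivial for the point
at infinity. -/
def ptIdeal (L : Type*) [Field L] [Algebra k L] [Algebra K L]
    [Algebra (E⁄K).CoordinateRing L] [IsFunctionField K E L] :
    (E⁄K).Point → FractionalIdeal (E⁄K).CoordinateRing⁰ L
  | .zero => 1
  | .some x y _ => (CoordinateRing.XYIdeal (E⁄K) x (C y) : Ideal (E⁄K).CoordinateRing)

@[simp] lemma ptIdeal_zero : ptIdeal L (0 : (E⁄K).Point) = 1 := rfl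

lemma algebraMap_mk_C (p : K[X]) :
    algebraMap (E⁄K).CoordinateRing L (CoordinateRing.mk (E⁄K) (C p)) =
      p.eval₂ (algebraMap K L) (genX K E L) := by
  have h := algebraMap_smul_add (E := E) (L := L) p 0
  rw [zero_smul, add_zero, eval₂_zero, zero_mul, add_zero, CoordinateRing.smul, mul_one] at h
  exact h

lemma algebraMap_XClass (a : K) :
    algebraMap (E⁄K).CoordinateRing L (CoordinateRing.XClass (E⁄K) a) =
      genX K E L - algebraMap K L a := by
  rw [CoordinateRing.XClass, algebraMap_mk_C]
  simp

lemma algebraMap_YClass (p : K[X]) :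
    algebraMap (E⁄K).CoordinateRing L (CoordinateRing.YClass (E⁄K) p) =
      genY K E L - p.eval₂ (algebraMap K L) (genX K E L) := by
  rw [CoordinateRing.YClass, map_sub, map_sub, algebraMap_mk_C, genY]

lemma ptIdeal_neg_mul {x y : K} (h : (E⁄K).Nonsingular x y) :
    ptIdeal L (-Point.some x y h) * ptIdeal L (.some x y h) =
      FractionalIdeal.spanSingleton _ (genX K E L - algebraMap K L x) := by
  have := congrArg (fun I : Ideal _ => (I : FractionalIdeal (E⁄K).CoordinateRing⁰ L))
    (CoordinateRing.XYIdeal_neg_mul h)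
  simp only [FractionalIdeal.coeIdeal_mul] at this
  refine this.trans ?_
  rw [CoordinateRing.XIdeal, FractionalIdeal.coeIdeal_span_singleton, algebraMap_XClass]

variable [E.IsElliptic] [DecidableEq K] [DecidableEq L]

omit [E.IsElliptic] [DecidableEq K] [DecidableEq L] in
lemma genX_sub_ne_zero (a : K) : genX K E L - algebraMap K L a ≠ 0 := by
  rw [← algebraMap_XClass, Ne, IsFractionRing.to_map_eq_zero_iff]
  exact CoordinateRing.XClass_ne_zero a

/-- The divisor of a chord function. -/
lemma ptIdeal_mul_ptIdeal (A B : (E⁄K).Point) :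
    ptIdeal L A * ptIdeal L B =
      FractionalIdeal.spanSingleton _ (lineFun (cPt A) (cPt B) (genPt K E L)) *
        ptIdeal L (A + B) := by
  rcases A with _ | ⟨x₁, y₁, h₁⟩
  · rw [← Point.zero_def, map_zero, lineFun_zero_left, zero_add]
    simp
  rcases B with _ | ⟨x₂, y₂, h₂⟩
  · rw [← Point.zero_def, map_zero, lineFun_zero_mid, add_zero]
    simp
  by_cases hxy : x₁ = x₂ ∧ y₁ = (E⁄K).negY x₂ y₂
  · have h0 := (add_eq_zero_iff_coords h₁ h₂).2 hxy
    have h0' := congrArg (cPt (L := L)) h0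
    rw [map_add, map_zero, Point.map_some, Point.map_some] at h0'
    rw [h0, ptIdeal_zero, mul_one, Point.map_some, Point.map_some, genPt, Point.mk,
      lineFun_of_add_eq_zero h0']
    obtain ⟨rfl, rfl⟩ := hxy
    exact ptIdeal_neg_mul h₂
  · rw [Point.add_some hxy, Point.map_some, Point.map_some, genPt, Point.mk]
    have hxy' : ¬ (constHom K E L x₁ = constHom K E L x₂ ∧
        constHom K E L y₁ = (E⁄L).negY (constHom K E L x₂) (constHom K E L y₂)) := fun h =>
      hxy ⟨(constHom K E L).injective h.1,
        (constHom K E L).injective (h.2.trans (baseChange_negY ..))⟩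
    simp only [lineFun, if_neg hxy']
    have I := congrArg (fun I : Ideal _ => (I : FractionalIdeal (E⁄K).CoordinateRing⁰ L))
      (CoordinateRing.XYIdeal_mul_XYIdeal h₁.1 h₂.1 hxy)
    simp only [FractionalIdeal.coeIdeal_mul, CoordinateRing.XIdeal, CoordinateRing.YIdeal,
      FractionalIdeal.coeIdeal_span_singleton, algebraMap_XClass, algebraMap_YClass] at I
    rw [baseChange_slope, baseChange_addX]
    have hx := genX_sub_ne_zero (E := E) (L := L)
      ((E⁄K).addX x₁ x₂ ((E⁄K).slope x₁ x₂ y₁ y₂))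
    have e : (linePolynomial x₁ y₁ ((E⁄K).slope x₁ x₂ y₁ y₂)).eval₂ (algebraMap K L)
        (genX K E L) = constHom K E L ((E⁄K).slope x₁ x₂ y₁ y₂) *
          (genX K E L - constHom K E L x₁) + constHom K E L y₁ := by
      rw [linePolynomial]
      simp only [eval₂_add, eval₂_mul, eval₂_sub, eval₂_X, eval₂_C]
      rfl
    rw [e] at I
    rw [div_eq_inv_mul, ← FractionalIdeal.spanSingleton_mul_spanSingleton, mul_assoc]
    refine Eq.trans ?_ (congrArg (FractionalIdeal.spanSingleton _
      (genX K E L - constHom K E L ((E⁄K).addX x₁ x₂ ((E⁄K).slope x₁ x₂ y₁ y₂)))⁻¹ * ·) I)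
    rw [← mul_assoc, FractionalIdeal.spanSingleton_mul_spanSingleton]
    change _ = FractionalIdeal.spanSingleton _ ((genX K E L - algebraMap K L _)⁻¹ * _) * _
    rw [inv_mul_cancel₀ hx, FractionalIdeal.spanSingleton_one, one_mul]
    rfl

omit [E.IsElliptic] [DecidableEq K] [DecidableEq L] in
/-- A function without zeros and poles away from infinity is constant. -/
lemma exists_const_of_spanSingleton_eq_one {u : L}
    (hu : FractionalIdeal.spanSingleton (E⁄K).CoordinateRing⁰ u = 1) :
    ∃ a : K, a ≠ 0 ∧ u = algebraMap K L a := by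
  obtain ⟨r, hr⟩ : ∃ r : (E⁄K).CoordinateRing, algebraMap _ L r = u := by
    have : u ∈ (1 : FractionalIdeal (E⁄K).CoordinateRing⁰ L) :=
      hu ▸ FractionalIdeal.mem_spanSingleton_self _ u
    exact FractionalIdeal.mem_one_iff _ |>.1 this
  obtain ⟨s, hs⟩ : ∃ s : (E⁄K).CoordinateRing, s • u = 1 := by
    have : (1 : L) ∈ FractionalIdeal.spanSingleton (E⁄K).CoordinateRing⁰ u :=
      hu ▸ FractionalIdeal.one_mem_one _
    exact FractionalIdeal.mem_spanSingleton _ |>.1 this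
  have hrs : s * r = 1 := by
    apply IsFractionRing.injective (E⁄K).CoordinateRing L
    rw [map_mul, map_one, hr, ← Algebra.smul_def, hs]
  have hunit : IsUnit (Algebra.norm K[X] r) := by
    rw [isUnit_iff_exists_inv']
    exact ⟨Algebra.norm K[X] s, by rw [← map_mul, hrs, map_one]⟩
  have hdeg := degree_eq_zero_of_isUnit hunit
  obtain ⟨p, q, rfl⟩ := CoordinateRing.exists_smul_basis_eq r
  rw [CoordinateRing.degree_norm_smul_basis] at hdeg
  have hq : q = 0 := by
    by_contra hq
    have h1 := le_max_right (2 • p.degree) (2 • q.degree + 3)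
    rw [hdeg, degree_eq_natDegree hq] at h1
    have : ((2 * q.natDegree + 3 : ℕ) : WithBot ℕ) ≤ ((0 : ℕ) : WithBot ℕ) := by
      push_cast
      simpa [two_smul, two_mul] using h1
    have h2 : 2 * q.natDegree + 3 ≤ 0 := by exact_mod_cast this
    omega
  subst hq
  have hp : p.degree ≤ 0 := by
    by_contra hp
    have h1 := le_max_left (2 • p.degree) (2 • (0 : K[X]).degree + 3)
    rw [hdeg] at h1
    push Not at hp
    have h2 : p ≠ 0 := by rintro rfl; simp at hp
    rw [degree_eq_natDegree h2] at hp h1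
    have h3 : ((2 * p.natDegree : ℕ) : WithBot ℕ) ≤ ((0 : ℕ) : WithBot ℕ) := by
      push_cast
      simpa [two_smul, two_mul] using h1
    have h4 : 2 * p.natDegree ≤ 0 := by exact_mod_cast h3
    have h5 : 0 < p.natDegree := by exact_mod_cast hp
    omega
  rw [eq_C_of_degree_le_zero hp, algebraMap_smul_add, eval₂_C, eval₂_zero, zero_mul,
    add_zero] at hr
  refine ⟨p.coeff 0, fun h0 => ?_, hr.symm⟩
  rw [h0, map_zero] at hr
  rw [← hr, smul_zero] at hs
  exact zero_ne_one hs

/-- Equality up to a non-zero constant factor. -/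
def ConstRel (K : Type*) [Field K] {L : Type*} [Field L] [Algebra K L] (f g : L) : Prop :=
  ∃ a : K, a ≠ 0 ∧ f = algebraMap K L a * g

omit [E.IsElliptic] [DecidableEq K] [DecidableEq L] in
lemma constRel_of_spanSingleton_eq {f g : L} (hg : g ≠ 0)
    (h : FractionalIdeal.spanSingleton (E⁄K).CoordinateRing⁰ f =
      FractionalIdeal.spanSingleton (E⁄K).CoordinateRing⁰ g) : ConstRel K f g := by
  obtain ⟨a, ha, e⟩ := exists_const_of_spanSingleton_eq_one (E := E) (K := K) (u := f * g⁻¹) (by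
    rw [← FractionalIdeal.spanSingleton_mul_spanSingleton, h,
      FractionalIdeal.spanSingleton_mul_spanSingleton, mul_inv_cancel₀ hg,
      FractionalIdeal.spanSingleton_one])
  exact ⟨a, ha, by rw [← e, inv_mul_cancel_right₀ hg]⟩

omit [E.IsElliptic] [DecidableEq K] [DecidableEq L] in
lemma isUnit_ptIdeal (A : (E⁄K).Point) : IsUnit (ptIdeal L A) := by
  rcases A with _ | ⟨x, y, h⟩
  · exact isUnit_one
  · refine .of_mul_eq_one (ptIdeal L (-Point.some x y h) *
      FractionalIdeal.spanSingleton _ (genX K E L - algebraMap K L x)⁻¹) ?_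
    rw [← mul_assoc, mul_comm (ptIdeal L (Point.some x y h)), ptIdeal_neg_mul,
      FractionalIdeal.spanSingleton_mul_spanSingleton, mul_inv_cancel₀ (genX_sub_ne_zero x),
      FractionalIdeal.spanSingleton_one]

/-- The divisor of `torsFun`. -/
lemma ptIdeal_pow {n : ℕ} (hn : 0 < n) {Q : (E⁄K).Point} (hQ : n • Q = 0) :
    ptIdeal L Q ^ n =
      FractionalIdeal.spanSingleton _ (torsFun n (cPt Q) (genPt K E L)) := by
  have key : ∀ m : ℕ, ptIdeal L Q ^ (m + 1) = FractionalIdeal.spanSingleton _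
      (∏ i ∈ Finset.range m, lineFun (cPt Q) ((i + 1) • cPt Q) (genPt K E L)) *
        ptIdeal L ((m + 1) • Q) := by
    intro m
    induction m with
    | zero => simp
    | succ m ih =>
      rw [pow_succ, ih, Finset.prod_range_succ, mul_assoc, mul_comm (ptIdeal L _),
        ptIdeal_mul_ptIdeal, ← mul_assoc, FractionalIdeal.spanSingleton_mul_spanSingleton,
        map_nsmul, ← succ_nsmul' Q (m + 1)]
  obtain ⟨m, rfl⟩ := Nat.exists_eq_succ_of_ne_zero hn.ne'
  have := key m
  rwa [show (m + 1) • Q = 0 from hQ, ptIdeal_zero, mul_one] at this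

end Ideals

end SerreCurve

/-! ### The coordinate ring is closed under taking roots -/

namespace SerreCurve

open WeierstrassCurve WeierstrassCurve.Affine Polynomial
open scoped Polynomial.Bivariate nonZeroDivisors

lemma exists_eq_of_isIntegralElem {S L : Type*} [CommRing S] [IsDomain S] [IsIntegrallyClosed S]
    [Field L] {f : S →+* L} (hf : Function.Injective f) {A N : S} (hN : N ≠ 0) {t : L}
    (ht : f N * t = f A) (h : f.IsIntegralElem t) : ∃ c, f c = t := by
  let := f.toAlgebra
  let g : FractionRing S →+* L := IsFractionRing.lift hf
  let := g.toAlgebra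
  have : IsScalarTower S (FractionRing S) L := .of_algebraMap_eq fun x =>
    (IsFractionRing.lift_algebraMap hf x).symm
  set u : FractionRing S := algebraMap S _ A / algebraMap S _ N with hu
  have hfN : f N ≠ 0 := (map_ne_zero_iff f hf).2 hN
  have e : algebraMap (FractionRing S) L u = t := by
    rw [hu, map_div₀, ← IsScalarTower.algebraMap_apply, ← IsScalarTower.algebraMap_apply]
    change f A / f N = t
    rw [← ht, mul_div_cancel_left₀ _ hfN]
  have hi : IsIntegral S u :=
    (isIntegral_algebraMap_iff (algebraMap (FractionRing S) L).injective).1 (e.symm ▸ h)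
  obtain ⟨c, hc⟩ := IsIntegrallyClosed.isIntegral_iff.1 hi
  exact ⟨c, by rw [← e, ← hc, ← IsScalarTower.algebraMap_apply]; rfl⟩

lemma dvd_of_sq_dvd_sq_mul {S : Type*} [CommRing S] [IsDomain S] [UniqueFactorizationMonoid S]
    {N q D : S} (hN : N ≠ 0) (hD : Squarefree D) (h : N ^ 2 ∣ q ^ 2 * D) : N ∣ q := by
  obtain ⟨N', q', c, hc, rfl, rfl⟩ := UniqueFactorizationMonoid.exists_reduced_factors N hN q
  have hc0 : c ≠ 0 := left_ne_zero_of_mul hN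
  rw [mul_pow, mul_pow, mul_assoc, mul_dvd_mul_iff_left (pow_ne_zero 2 hc0)] at h
  have := IsRelPrime.dvd_of_dvd_mul_left (IsRelPrime.pow hc) h
  exact mul_dvd_mul_left c (hD N' (by rwa [← pow_two])).dvd

section

variable {k K : Type*} [Field k] [Field K] [Algebra k K] {E : WeierstrassCurve k}
  {L : Type*} [Field L] [Algebra k L] [Algebra K L]
  [Algebra (E⁄K).CoordinateRing L] [IsFunctionField K E L]

variable (K E L) in
/-- The inclusion of the ring of polynomials in the abscissa in the function field. -/
def polyHom : K[X] →+* L := eval₂RingHom (algebraMap K L) (genX K E L)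

lemma polyHom_injective : Function.Injective (polyHom K E L) :=
  (injective_iff_map_eq_zero _).2 fun p hp => isGeneric_genX p hp

lemma algebraMap_smul_add' (p q : K[X]) : algebraMap (E⁄K).CoordinateRing L
      (p • (1 : (E⁄K).CoordinateRing) + q • CoordinateRing.mk (E⁄K) Y) =
    polyHom K E L p + polyHom K E L q * genY K E L := algebraMap_smul_add p q

lemma polyHom_eq (p : K[X]) : polyHom K E L p =
    algebraMap (E⁄K).CoordinateRing L (algebraMap K[X] _ p) := by
  have := algebraMap_smul_add' (E := E) (L := L) p 0
  rw [zero_smul, add_zero, map_zero, zero_mul, add_zero, Algebra.smul_def, mul_one] at this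
  exact this.symm

lemma isIntegralElem_algebraMap (r : (E⁄K).CoordinateRing) :
    (polyHom K E L).IsIntegralElem (algebraMap _ L r) := by
  have := Module.Finite.of_basis (CoordinateRing.basis (E⁄K))
  obtain ⟨P, hP, h⟩ := Algebra.IsIntegral.isIntegral (R := K[X]) r
  refine ⟨P, hP, ?_⟩
  have := congrArg (algebraMap (E⁄K).CoordinateRing L) h
  rw [hom_eval₂, map_zero] at this
  rw [← this]
  congr 1
  exact RingHom.ext polyHom_eq

/-- Every function is a quotient of a regular function by a polynomial in the abscissa. -/
lemma exists_polyHom_mul_eq (z : L) : ∃ N p q : K[X], N ≠ 0 ∧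
    polyHom K E L N * z = polyHom K E L p + polyHom K E L q * genY K E L := by
  obtain ⟨a, b, hb, rfl⟩ := IsFractionRing.div_surjective (A := (E⁄K).CoordinateRing) z
  have := Module.Finite.of_basis (CoordinateRing.basis (E⁄K))
  have hb0 : b ≠ 0 := nonZeroDivisors.ne_zero hb
  obtain ⟨b', hb'⟩ : b ∣ algebraMap K[X] _ (Algebra.norm K[X] b) := by
    obtain ⟨p, q, rfl⟩ := CoordinateRing.exists_smul_basis_eq b
    have hN := CoordinateRing.coe_norm_smul_basis (W' := (E⁄K)) p q
    have e0 : CoordinateRing.mk (E⁄K) (C p + C q * Y) =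
        p • (1 : (E⁄K).CoordinateRing) + q • CoordinateRing.mk (E⁄K) Y := by
      rw [CoordinateRing.smul, CoordinateRing.smul, mul_one, map_add, map_mul]
    rw [map_mul (CoordinateRing.mk (E⁄K)), e0] at hN
    exact ⟨_, hN⟩
  obtain ⟨p, q, hpq⟩ := CoordinateRing.exists_smul_basis_eq (a * b')
  refine ⟨Algebra.norm K[X] b, p, q, fun h => hb0 (Algebra.norm_eq_zero_iff.1 h), ?_⟩
  rw [← algebraMap_smul_add', hpq, polyHom_eq, hb', map_mul, map_mul]
  have : algebraMap (E⁄K).CoordinateRing L b ≠ 0 := by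
    rwa [Ne, IsFractionRing.to_map_eq_zero_iff]
  field_simp

variable [E.IsElliptic]

lemma squarefree_twoTorsionPolynomial [IsAlgClosed K] [CharZero K] :
    Squarefree (E⁄K).twoTorsionPolynomial.toPoly := by
  have h2 : IsUnit (2 : K) := (two_ne_zero (α := K)).isUnit
  have ha : (E⁄K).twoTorsionPolynomial.a ≠ 0 := by
    simp [twoTorsionPolynomial]
  have hs : ((E⁄K).twoTorsionPolynomial.toPoly.map (RingHom.id K)).Splits := IsAlgClosed.splits _
  have hd := (E⁄K).twoTorsionPolynomial_discr_ne_zero_of_isElliptic h2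
  have := (Cubic.discr_ne_zero_iff_roots_nodup ha hs).1 hd
  rw [Cubic.map_roots, Polynomial.map_id] at this
  rw [Polynomial.map_id] at hs
  exact ((nodup_roots_iff_of_splits (Cubic.ne_zero_of_a_ne_zero ha) hs).1 this).squarefree

variable [DecidableEq K] [DecidableEq L] [IsAlgClosed K] [CharZero K]

/-- A function with a regular power is regular. Indeed its trace and its norm to the field of
rational functions in the abscissa are polynomials, and the discriminant of the coordinate ring
over the ring of polynomials is squarefree. -/
lemma exists_algebraMap_eq_of_pow {n : ℕ} (hn : n ≠ 0) {z : L} {r : (E⁄K).CoordinateRing}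
    (h : z ^ n = algebraMap _ L r) : ∃ s : (E⁄K).CoordinateRing, algebraMap _ L s = z := by
  obtain ⟨σ, hσ, hσP⟩ := exists_hom (L := L) (constHom K E L) (P := -genPt K E L)
    (fun S hS => genPt_ne_cPt (L := L) (-S) (by rw [map_neg, ← hS, neg_neg]))
  rw [genPt, Point.mk, Point.map_some, Point.neg_some] at hσP
  obtain ⟨hσX, hσY⟩ := Point.some.inj hσP
  have hσp : ∀ p : K[X], σ (polyHom K E L p) = polyHom K E L p := fun p => by
    have h1 := hom_eval₂ p (algebraMap K L) (σ : L →+* L) (genX K E L)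
    rw [RingHom.coe_coe, hσX] at h1
    refine h1.trans ?_
    change _ = eval₂ _ _ _
    congr 1
    exact RingHom.ext fun a => DFunLike.congr_fun hσ a
  have hmap : ∀ t : L, (polyHom K E L).IsIntegralElem t → (polyHom K E L).IsIntegralElem (σ t) := by
    rintro t ⟨P, hP, h0⟩
    refine ⟨P, hP, ?_⟩
    have h1 := hom_eval₂ P (polyHom K E L) (σ : L →+* L) t
    rw [h0, map_zero, RingHom.coe_coe] at h1
    rw [h1]
    congr 1
    exact RingHom.ext fun p => (hσp p).symm
  have hz : (polyHom K E L).IsIntegralElem z :=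
    by
    let := (polyHom K E L).toAlgebra
    exact IsIntegral.of_pow (R := K[X]) (Nat.pos_of_ne_zero hn) (h ▸ isIntegralElem_algebraMap r)
  obtain ⟨N, p, q, hN, hpq⟩ := exists_polyHom_mul_eq (E := E) (K := K) z
  have hN' : polyHom K E L N ≠ 0 := (map_ne_zero_iff _ polyHom_injective).2 hN
  have hpq' := congrArg σ hpq
  rw [map_mul, map_add, map_mul, hσp, hσp, hσp, hσY] at hpq'
  set w : K[X] := -(C (E⁄K).a₁ * X + C (E⁄K).a₃) with hw
  have hneg : (E⁄L).negY (genX K E L) (genY K E L) = -genY K E L + polyHom K E L w := by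
    have e1 : polyHom K E L (C (E⁄K).a₁) = (E⁄L).a₁ := by
      rw [polyHom, coe_eval₂RingHom, eval₂_C]
      exact (constHom K E L).commutes _
    have e3 : polyHom K E L (C (E⁄K).a₃) = (E⁄L).a₃ := by
      rw [polyHom, coe_eval₂RingHom, eval₂_C]
      exact (constHom K E L).commutes _
    have eX : polyHom K E L X = genX K E L := by rw [polyHom, coe_eval₂RingHom, eval₂_X]
    rw [negY, hw, map_neg, map_add, map_mul, e1, e3, eX]
    ring
  rw [hneg] at hpq'
  obtain ⟨t, ht⟩ := exists_eq_of_isIntegralElem (t := z + σ z) polyHom_injective hN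
    (A := 2 * p + q * w) (by
      rw [mul_add, hpq, hpq']
      simp only [map_add, map_mul, map_ofNat]
      ring) (hz.add _ (hmap z hz))
  have hE : (2 * genY K E L - polyHom K E L w) ^ 2 =
      polyHom K E L (E⁄K).twoTorsionPolynomial.toPoly := by
    have ea : ∀ a : k, polyHom K E L (C (algebraMap k K a)) = algebraMap k L a := fun a => by
      rw [polyHom, coe_eval₂RingHom, eval₂_C]
      exact (constHom K E L).commutes _
    have eX : polyHom K E L X = genX K E L := by rw [polyHom, coe_eval₂RingHom, eval₂_X]
    have h0 := (equation_iff ..).1 (equation_gen (E := E) (K := K) (L := L))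
    change _ ^ 2 + algebraMap k L _ * _ * _ + algebraMap k L _ * _ =
      _ ^ 3 + algebraMap k L _ * _ ^ 2 + algebraMap k L _ * _ + algebraMap k L _ at h0
    have e4 : polyHom K E L (C 4) = 4 := by rw [← map_ofNat (polyHom K E L) 4]; rfl
    rw [twoTorsionPolynomial, Cubic.toPoly, hw, b₂, b₄, b₆]
    change _ = polyHom K E L (C 4 * X ^ 3 +
      C (algebraMap k K E.a₁ ^ 2 + 4 * algebraMap k K E.a₂) * X ^ 2 +
      C (2 * (2 * algebraMap k K E.a₄ + algebraMap k K E.a₁ * algebraMap k K E.a₃)) * X +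
      C (algebraMap k K E.a₃ ^ 2 + 4 * algebraMap k K E.a₆))
    change (2 * genY K E L - polyHom K E L (-(C (algebraMap k K E.a₁) * X +
      C (algebraMap k K E.a₃)))) ^ 2 = _
    simp only [map_add, map_mul, map_pow, map_neg, map_ofNat, ea, eX]
    linear_combination 4 * h0
  have hd : polyHom K E L N * (z - σ z) =
      polyHom K E L q * (2 * genY K E L - polyHom K E L w) := by
    rw [mul_sub, hpq, hpq']
    ring
  obtain ⟨m, hm⟩ := exists_eq_of_isIntegralElem (t := (z - σ z) ^ 2) polyHom_injective
    (pow_ne_zero 2 hN)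
    (A := q ^ 2 * (E⁄K).twoTorsionPolynomial.toPoly) (by
      rw [map_mul, ← hE, map_pow, map_pow, ← mul_pow, ← mul_pow, hd]) (by rw [pow_two]; exact (hz.sub _ (hmap z hz)).mul _ (hz.sub _ (hmap z hz)))
  have hdvd : N ^ 2 ∣ q ^ 2 * (E⁄K).twoTorsionPolynomial.toPoly := by
    refine ⟨m, polyHom_injective (E := E) (L := L) ?_⟩
    rw [map_mul (polyHom K E L) (N ^ 2), hm, map_mul, ← hE, map_pow, map_pow, ← mul_pow, ← mul_pow, hd]
  obtain ⟨q₁, rfl⟩ := dvd_of_sq_dvd_sq_mul hN squarefree_twoTorsionPolynomial hdvd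
  have hp : 2 * p = N * (t - q₁ * w) := by
    apply polyHom_injective (E := E) (L := L)
    simp only [map_mul, map_sub, map_ofNat] at hpq hpq' ⊢
    rw [ht]
    linear_combination (-1 : L) * hpq - hpq'
  refine ⟨(C (1 / 2) * (t - q₁ * w)) • (1 : (E⁄K).CoordinateRing) +
    q₁ • CoordinateRing.mk (E⁄K) Y, ?_⟩
  rw [algebraMap_smul_add']
  apply mul_left_cancel₀ hN'
  rw [hpq]
  have hp' : p = N * (C (1 / 2) * (t - q₁ * w)) := by
    rw [mul_left_comm, ← hp, ← mul_assoc, show (2 : K[X]) = C 2 from rfl, ← C_mul]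
    norm_num
  conv_rhs => rw [hp']
  simp only [map_mul]
  ring

/-- If the function with divisor `n • Q - n • 0` is an `n`-th power, then `Q` is zero. -/
lemma eq_zero_of_torsFun_eq_pow {n : ℕ} (hn : 0 < n) {Q : (E⁄K).Point} (hQ : n • Q = 0) {g : L}
    {a : K} (ha : a ≠ 0)
    (h : torsFun n (cPt Q) (genPt K E L) = algebraMap K L a * g ^ n) : Q = 0 := by
  have hI := ptIdeal_pow (L := L) hn hQ
  have hIu := isUnit_ptIdeal (L := L) Q
  have hg : g ≠ 0 := by
    rintro rfl
    rw [h, zero_pow hn.ne', mul_zero, FractionalIdeal.spanSingleton_zero] at hI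
    exact (hIu.pow n).ne_zero hI
  set J : FractionalIdeal (E⁄K).CoordinateRing⁰ L :=
    ptIdeal L Q * FractionalIdeal.spanSingleton _ g⁻¹ with hJ
  have hJn : J ^ n = 1 := by
    rw [hJ, mul_pow, hI, FractionalIdeal.spanSingleton_pow,
      FractionalIdeal.spanSingleton_mul_spanSingleton, h, inv_pow,
      mul_inv_cancel_right₀ (pow_ne_zero n hg)]
    refine le_antisymm ?_ ?_
    · rw [FractionalIdeal.spanSingleton_le_iff_mem]
      exact (FractionalIdeal.mem_one_iff _).2 ⟨algebraMap K (E⁄K).CoordinateRing a, (IsScalarTower.algebraMap_apply K (E⁄K).CoordinateRing L a).symm⟩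
    · rw [FractionalIdeal.one_le]
      refine (FractionalIdeal.mem_spanSingleton _).2 ⟨algebraMap K (E⁄K).CoordinateRing a⁻¹, ?_⟩
      rw [Algebra.smul_def, ← IsScalarTower.algebraMap_apply K (E⁄K).CoordinateRing L, ← map_mul,
        inv_mul_cancel₀ ha,
        map_one]
  have hJ1 : J ≤ 1 := by
    intro z hz
    have hzn : z ^ n ∈ (1 : FractionalIdeal (E⁄K).CoordinateRing⁰ L) := by
      rw [← hJn]
      have : ∀ m : ℕ, z ^ m ∈ J ^ m := by
        intro m
        induction m with
        | zero =>
          rw [pow_zero, pow_zero]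
          exact FractionalIdeal.one_mem_one _
        | succ m ih => rw [pow_succ, pow_succ]; exact FractionalIdeal.mul_mem_mul ih hz
      exact this n
    obtain ⟨r, hr⟩ := (FractionalIdeal.mem_one_iff _).1 hzn
    exact (FractionalIdeal.mem_one_iff _).2 (exists_algebraMap_eq_of_pow hn.ne' hr.symm)
  have hJe : J = 1 := by
    refine le_antisymm hJ1 ?_
    obtain ⟨m, rfl⟩ := Nat.exists_eq_succ_of_ne_zero hn.ne'
    have hm : J ^ m ≤ 1 := pow_le_one₀ bot_le hJ1
    calc (1 : FractionalIdeal (E⁄K).CoordinateRing⁰ L) = J ^ m * J := by rw [← hJn, ← pow_succ]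
      _ ≤ 1 * J := mul_le_mul_left hm J
      _ = J := one_mul J
  have hIg : ptIdeal L Q = FractionalIdeal.spanSingleton _ g := by
    rw [← mul_one (ptIdeal L Q), ← FractionalIdeal.spanSingleton_one,
      ← inv_mul_cancel₀ hg, ← FractionalIdeal.spanSingleton_mul_spanSingleton, ← mul_assoc,
      ← hJ, hJe, one_mul]
  rcases Q with _ | ⟨x, y, hxy⟩
  · rfl
  -- The quotient by the ideal of a point has dimension one, which is not the degree of a function.
  change ((CoordinateRing.XYIdeal (E⁄K) x (C y) : Ideal (E⁄K).CoordinateRing) :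
    FractionalIdeal (E⁄K).CoordinateRing⁰ L) = _ at hIg
  obtain ⟨p, hp, rfl⟩ : ∃ p ∈ CoordinateRing.XYIdeal (E⁄K) x (C y), algebraMap _ L p = g := by
    have := FractionalIdeal.mem_spanSingleton_self (E⁄K).CoordinateRing⁰ g
    rwa [← hIg, FractionalIdeal.mem_coeIdeal] at this
  rw [← FractionalIdeal.coeIdeal_span_singleton, FractionalIdeal.coeIdeal_inj] at hIg
  have h0 : p ≠ 0 := by rintro rfl; exact hg (map_zero _)
  refine absurd ?_ (CoordinateRing.natDegree_norm_ne_one p)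
  rw [← finrank_quotient_span_eq_natDegree_norm (CoordinateRing.basis (E⁄K)) h0,
    ← (Ideal.quotientEquivAlgOfEq K hIg).toLinearEquiv.finrank_eq,
    (CoordinateRing.quotientXYIdealEquiv hxy.1).toLinearEquiv.finrank_eq, Module.finrank_self]

end

end SerreCurve

/-! ### The Weil pairing -/

namespace SerreCurve

open WeierstrassCurve WeierstrassCurve.Affine Polynomial
open scoped Polynomial.Bivariate nonZeroDivisors

namespace ConstRel

variable {K L : Type*} [Field K] [Field L] [Algebra K L] {f g h : L}

lemma refl (g : L) : ConstRel K g g := ⟨1, one_ne_zero, by rw [map_one, one_mul]⟩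

lemma symm (H : ConstRel K f g) : ConstRel K g f := by
  obtain ⟨a, ha, rfl⟩ := H
  refine ⟨a⁻¹, inv_ne_zero ha, ?_⟩
  rw [← mul_assoc, ← map_mul, inv_mul_cancel₀ ha, map_one, one_mul]

lemma trans (H : ConstRel K f g) (H' : ConstRel K g h) : ConstRel K f h := by
  obtain ⟨a, ha, rfl⟩ := H
  obtain ⟨b, hb, rfl⟩ := H'
  exact ⟨a * b, mul_ne_zero ha hb, by rw [map_mul, mul_assoc]⟩

lemma mul {f' g' : L} (H : ConstRel K f g) (H' : ConstRel K f' g') :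
    ConstRel K (f * f') (g * g') := by
  obtain ⟨a, ha, rfl⟩ := H
  obtain ⟨b, hb, rfl⟩ := H'
  exact ⟨a * b, mul_ne_zero ha hb, by rw [map_mul, mul_mul_mul_comm]⟩

lemma prod {ι : Type*} {s : Finset ι} {f g : ι → L} (H : ∀ i ∈ s, ConstRel K (f i) (g i)) :
    ConstRel K (∏ i ∈ s, f i) (∏ i ∈ s, g i) := by
  classical
  induction s using Finset.induction_on with
  | empty => exact .refl _
  | insert i s hi ih =>
    rw [Finset.prod_insert hi, Finset.prod_insert hi]
    exact (H i (s.mem_insert_self i)).mul (ih fun j hj => H j (Finset.mem_insert_of_mem hj))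

lemma pow (H : ConstRel K f g) (n : ℕ) : ConstRel K (f ^ n) (g ^ n) := by
  obtain ⟨a, ha, rfl⟩ := H
  exact ⟨a ^ n, pow_ne_zero n ha, by rw [map_pow, mul_pow]⟩

lemma of_mul_right (hh : h ≠ 0) (H : ConstRel K (f * h) (g * h)) : ConstRel K f g := by
  obtain ⟨a, ha, e⟩ := H
  exact ⟨a, ha, mul_right_cancel₀ hh (by rw [e, mul_assoc])⟩

end ConstRel

section

variable {k K : Type*} [Field k] [Field K] [Algebra k K] {E : WeierstrassCurve k}
  {L : Type*} [Field L] [Algebra k L] [Algebra K L]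
  [Algebra (E⁄K).CoordinateRing L] [IsFunctionField K E L]

lemma exists_const_of_pow_eq [IsAlgClosed K] {n : ℕ} (hn : 0 < n) {u : L} {a : K}
    (h : u ^ n = algebraMap K L a) : ∃ b : K, b ^ n = a ∧ u = algebraMap K L b := by
  have h1 := congrArg (Polynomial.map (algebraMap K L))
    (Splits.eq_prod_roots (IsAlgClosed.splits (X ^ n - C a)))
  have h2 := congrArg (eval u) h1
  rw [Polynomial.map_sub, Polynomial.map_pow, map_X, map_C, eval_sub, eval_pow, eval_X, eval_C, h,
    sub_self, (monic_X_pow_sub_C a hn.ne').leadingCoeff, C_1, one_mul,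
    Polynomial.map_multiset_prod, eval_multiset_prod, Multiset.map_map, Multiset.map_map, eq_comm,
    Multiset.prod_eq_zero_iff] at h2
  obtain ⟨b, -, hb⟩ := Multiset.mem_map.1 h2
  have hb' : u = algebraMap K L b := by
    simpa [sub_eq_zero] using hb
  refine ⟨b, (algebraMap K L).injective ?_, hb'⟩
  rw [map_pow, ← hb', h]

lemma ConstRel.of_pow [IsAlgClosed K] {n : ℕ} (hn : 0 < n) {f g : L} (hg : g ≠ 0)
    (h : ConstRel K (f ^ n) (g ^ n)) : ConstRel K f g := by
  obtain ⟨a, ha, h⟩ := h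
  obtain ⟨b, hb, h'⟩ := exists_const_of_pow_eq (K := K) (L := L) (u := f / g) (a := a) hn (by
    rw [div_pow, h, mul_div_cancel_right₀ _ (pow_ne_zero n hg)])
  refine ⟨b, fun h0 => ha ?_, (div_eq_iff hg).1 h'⟩
  rw [← hb, h0, zero_pow hn.ne']

variable [E.IsElliptic] [DecidableEq K] [DecidableEq L] [IsAlgClosed K]

variable (hE : ∀ j : ℕ, 0 < j → ∃ S : (E⁄K).Point, j • S ≠ 0)

include hE in
lemma xNe_nsmul_genPt {j : ℕ} (hj : 0 < j) (S : (E⁄K).Point) :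
    XNe (cPt S) (j • genPt K E L) :=
  ⟨fun h => nsmul_genPt_ne_cPt (hE j hj) S h.symm, fun h =>
    nsmul_genPt_ne_cPt (L := L) (hE j hj) (-S) (by rw [map_neg, h, neg_neg])⟩

omit [IsAlgClosed K] in
lemma xNe_genPt (S : (E⁄K).Point) : XNe (cPt S) (genPt K E L) :=
  ⟨fun h => genPt_ne_cPt S h.symm, fun h =>
    genPt_ne_cPt (L := L) (-S) (by rw [map_neg, h, neg_neg])⟩

omit [IsAlgClosed K] in
lemma lineFun_genPt_ne_zero (A B : (E⁄K).Point) :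
    lineFun (cPt A) (cPt B) (genPt K E L) ≠ 0 :=
  lineFun_ne_zero (xNe_genPt A).symm (xNe_genPt B).symm (by rw [← map_add]; exact (xNe_genPt _).symm)

omit [IsAlgClosed K] in
lemma torsFun_genPt_ne_zero (n : ℕ) (Q : (E⁄K).Point) :
    torsFun n (cPt Q) (genPt K E L) ≠ 0 :=
  Finset.prod_ne_zero_iff.2 fun i _ => by
    rw [← map_nsmul]
    exact lineFun_genPt_ne_zero _ _

include hE in
lemma prod_lineFun_ne_zero (m : ℕ) (Q : (E⁄K).Point) :
    ∏ j ∈ Finset.range m, lineFun (genPt K E L) ((j + 1) • genPt K E L) (cPt Q) ≠ 0 :=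
  Finset.prod_ne_zero_iff.2 fun i _ => lineFun_ne_zero (xNe_genPt Q)
    (xNe_nsmul_genPt hE i.succ_pos Q) (by
      rw [← succ_nsmul']; exact xNe_nsmul_genPt hE (i + 1).succ_pos Q)

variable (L) in
/-- For `Q` with `n • Q = 0`, an `n`-th root of the function `X ↦ f (n • X)`, where `f` has divisor
`n (Q) - n (0)`; see `rootFun_pow`. -/
def rootFun (n : ℕ) (Q : (E⁄K).Point) : L :=
  torsFun n (cPt Q) (genPt K E L) /
    ∏ j ∈ Finset.range (n - 1), lineFun (genPt K E L) ((j + 1) • genPt K E L) (cPt Q)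

include hE in
lemma rootFun_ne_zero (n : ℕ) (Q : (E⁄K).Point) : rootFun L n Q ≠ 0 :=
  div_ne_zero (torsFun_genPt_ne_zero n Q) (prod_lineFun_ne_zero hE _ Q)

lemma mulHom_torsFun {j : ℕ} (hj : ∃ S : (E⁄K).Point, j • S ≠ 0) (n : ℕ) (Q : (E⁄K).Point) :
    mulHom L hj (torsFun n (cPt Q) (genPt K E L)) = torsFun n (cPt Q) (j • genPt K E L) := by
  rw [torsFun, torsFun, map_prod]
  refine Finset.prod_congr rfl fun i _ => ?_
  rw [map_lineFun, map_nsmul, map_mulHom_genPt, map_mulHom_cPt]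

lemma transl_torsFun (S : (E⁄K).Point) (n : ℕ) (Q : (E⁄K).Point) :
    transl L S (torsFun n (cPt Q) (genPt K E L)) = torsFun n (cPt Q) (genPt K E L + cPt S) := by
  rw [torsFun, torsFun, map_prod]
  refine Finset.prod_congr rfl fun i _ => ?_
  rw [map_lineFun, map_nsmul, map_transl_genPt, map_transl_cPt]

lemma rootFun_pow {n : ℕ} (hn : 0 < n) {Q : (E⁄K).Point} (hQ : n • Q = 0) :
    ∃ ε : K, ε ^ 2 = 1 ∧ rootFun L n Q ^ n =
      algebraMap K L ε * mulHom L (hE n hn) (torsFun n (cPt Q) (genPt K E L)) := by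
  obtain ⟨m, rfl⟩ := Nat.exists_eq_add_one_of_ne_zero hn.ne'
  have h := torsFun_nsmul_mul hn (Q := cPt Q) (X := genPt K E L)
    (by rw [← map_nsmul, hQ, map_zero])
    (fun i j => by rw [← map_nsmul]; exact xNe_nsmul_genPt hE i.succ_pos _) m
  have hP := pow_ne_zero (m + 1) (prod_lineFun_ne_zero (L := L) hE m Q)
  rw [mulHom_torsFun, rootFun, div_pow]
  change ∃ ε : K, ε ^ 2 = 1 ∧ _ / (∏ j ∈ Finset.range m, _) ^ _ = _
  rcases h with h | h
  · exact ⟨1, one_pow 2, by rw [div_eq_iff hP, map_one, one_mul, h]⟩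
  · exact ⟨-1, by ring, by rw [div_eq_iff hP, mul_assoc, h, map_neg, map_one]; ring⟩

include hE in
lemma exists_transl_rootFun {n : ℕ} (hn : 0 < n) {S Q : (E⁄K).Point} (hS : n • S = 0)
    (hQ : n • Q = 0) :
    ∃ a : K, a ^ n = 1 ∧ transl L S (rootFun L n Q) = algebraMap K L a * rootFun L n Q := by
  obtain ⟨ε, -, h⟩ := rootFun_pow (L := L) hE hn hQ
  have h1 := congrArg (transl L S) h
  rw [map_pow, map_mul, transl_algebraMap, transl_mulHom, hS, transl_zero, ← h] at h1
  have h0 := rootFun_ne_zero (L := L) hE n Q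
  obtain ⟨a, ha, e⟩ := exists_const_of_pow_eq (K := K) (L := L) (a := 1) hn
    (u := transl L S (rootFun L n Q) / rootFun L n Q) (by
      rw [div_pow, h1, div_self (pow_ne_zero n h0), map_one])
  exact ⟨a, ha, (div_eq_iff h0).1 e⟩

variable (L) in
/-- The Weil pairing: for `n`-torsion points `S` and `Q`, translation by `S` multiplies
`rootFun L n Q` by the constant `weil L n S Q`. -/
def weil (n : ℕ) (S Q : (E⁄K).Point) : K :=
  Classical.epsilon fun a : K =>
    a ^ n = 1 ∧ transl L S (rootFun L n Q) = algebraMap K L a * rootFun L n Q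

section

variable {n : ℕ} (hn : 0 < n)
include hE hn

lemma weil_spec {S Q : (E⁄K).Point} (hS : n • S = 0) (hQ : n • Q = 0) :
    weil L n S Q ^ n = 1 ∧
      transl L S (rootFun L n Q) = algebraMap K L (weil L n S Q) * rootFun L n Q :=
  Classical.epsilon_spec (exists_transl_rootFun hE hn hS hQ)

lemma weil_eq {S Q : (E⁄K).Point} (hS : n • S = 0) (hQ : n • Q = 0) {a : K} {g : L} (hg : g ≠ 0)
    (hQg : ConstRel K g (rootFun L n Q)) (h : transl L S g = algebraMap K L a * g) :
    weil L n S Q = a := by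
  obtain ⟨c, hc, rfl⟩ := hQg
  rw [map_mul, transl_algebraMap, (weil_spec hE hn hS hQ).2, mul_left_comm] at h
  exact (algebraMap K L).injective (mul_right_cancel₀ hg h)

lemma weil_add_left {S T Q : (E⁄K).Point} (hS : n • S = 0) (hT : n • T = 0) (hQ : n • Q = 0) :
    weil L n (S + T) Q = weil L n S Q * weil L n T Q := by
  refine weil_eq hE hn (by rw [nsmul_add, hS, hT, add_zero]) hQ (rootFun_ne_zero hE n Q) (.refl _) ?_
  rw [← transl_transl, (weil_spec hE hn hT hQ).2, map_mul, transl_algebraMap,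
    (weil_spec hE hn hS hQ).2, map_mul]
  ring

lemma weil_add_right {S P Q : (E⁄K).Point} (hS : n • S = 0) (hP : n • P = 0) (hQ : n • Q = 0) :
    weil L n S (P + Q) = weil L n S P * weil L n S Q := by
  have hPQ : n • (P + Q) = 0 := by rw [nsmul_add, hP, hQ, add_zero]
  set h := lineFun (cPt P) (cPt Q) (genPt K E L) with hh
  have h0 : mulHom L (hE n hn) h ≠ 0 := (_root_.map_ne_zero _).2 (lineFun_genPt_ne_zero P Q)
  -- Both `P + Q` and `P`, `Q` give the same function up to a constant and the factor `h ∘ [n]`.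
  have key : ConstRel K (rootFun L n P * rootFun L n Q / mulHom L (hE n hn) h)
      (rootFun L n (P + Q)) := by
    refine .of_pow hn (rootFun_ne_zero hE n _) ?_
    have e : ConstRel K (torsFun n (cPt P) (genPt K E L) * torsFun n (cPt Q) (genPt K E L))
        (h ^ n * torsFun n (cPt (P + Q)) (genPt K E L)) := by
      refine constRel_of_spanSingleton_eq (E := E) (mul_ne_zero (pow_ne_zero n
        (lineFun_genPt_ne_zero P Q)) (torsFun_genPt_ne_zero n _)) ?_
      rw [← FractionalIdeal.spanSingleton_mul_spanSingleton,
        ← FractionalIdeal.spanSingleton_mul_spanSingleton, ← FractionalIdeal.spanSingleton_pow,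
        ← ptIdeal_pow hn hP, ← ptIdeal_pow hn hQ, ← ptIdeal_pow hn hPQ, ← mul_pow, ← mul_pow,
        ptIdeal_mul_ptIdeal]
    obtain ⟨c, hc, e⟩ := e
    obtain ⟨ε₁, h₁, e₁⟩ := rootFun_pow (L := L) hE hn hP
    obtain ⟨ε₂, h₂, e₂⟩ := rootFun_pow (L := L) hE hn hQ
    obtain ⟨ε₃, h₃, e₃⟩ := rootFun_pow (L := L) hE hn hPQ
    have e' := congrArg (mulHom L (hE n hn)) e
    simp only [map_mul, map_pow, mulHom_algebraMap] at e'
    refine ⟨ε₁ * ε₂ * ε₃ * c, ?_, ?_⟩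
    · refine mul_ne_zero (mul_ne_zero (mul_ne_zero ?_ ?_) ?_) hc <;> rintro rfl <;> simp at *
    · rw [div_pow, div_eq_iff (pow_ne_zero n h0), mul_pow, e₁, e₂, e₃]
      have h₃' : algebraMap K L ε₃ ^ 2 = 1 := by rw [← map_pow, h₃, map_one]
      simp only [map_mul]
      linear_combination algebraMap K L ε₁ * algebraMap K L ε₂ * e' -
        algebraMap K L ε₁ * algebraMap K L ε₂ * algebraMap K L c *
        mulHom L (hE n hn) (torsFun n (cPt (P + Q)) (genPt K E L)) *
          mulHom L (hE n hn) h ^ n * h₃'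
  refine weil_eq hE hn hS hPQ (div_ne_zero (mul_ne_zero (rootFun_ne_zero hE n P)
    (rootFun_ne_zero hE n Q)) h0) key ?_
  rw [map_div₀, map_mul, (weil_spec hE hn hS hP).2, (weil_spec hE hn hS hQ).2, transl_mulHom, hS,
    transl_zero, map_mul]
  ring

lemma weil_map (σ : K →ₐ[k] K) {S Q : (E⁄K).Point} (hS : n • S = 0) (hQ : n • Q = 0) :
    weil L n (Point.map (W' := E) σ S) (Point.map (W' := E) σ Q) = σ (weil L n S Q) := by
  obtain ⟨φ, hc, hφ⟩ := exists_galHom (E := E) (L := L) σ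
  have hc' : φ.comp (constHom K E L) = (constHom K E L).comp σ := AlgHom.ext hc
  have hcP : ∀ T : (E⁄K).Point, Point.map (W' := E) φ (cPt (L := L) T) =
      cPt (L := L) (Point.map (W' := E) σ T) := fun T => by
    rw [map_cPt, hc', cPt, Point.map_map]
  have hG : φ (rootFun L n Q) = rootFun L n (Point.map (W' := E) σ Q) := by
    rw [rootFun, rootFun, torsFun, torsFun, map_div₀, map_prod, map_prod]
    simp only [map_lineFun, map_nsmul, hφ, hcP]
  have hτ : φ.comp (transl L S) = (transl L (Point.map (W' := E) σ S)).comp φ := by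
    refine functionField_hom_ext' (K := K) (E := E) ?_ ?_
    · rw [AlgHom.comp_assoc, AlgHom.comp_assoc, hc', transl_comp_const, ← AlgHom.comp_assoc,
        transl_comp_const, hc']
    · rw [← Point.map_map, ← Point.map_map, map_transl_genPt, map_add, hφ, map_transl_genPt, hcP]
  refine weil_eq hE hn (by rw [← map_nsmul, hS, map_zero]) (by rw [← map_nsmul, hQ, map_zero])
    (rootFun_ne_zero hE n _) (.refl _) ?_
  rw [← hG, ← hc, ← map_mul, ← (weil_spec hE hn hS hQ).2]
  exact (DFunLike.congr_fun hτ _).symm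

end

end

end SerreCurve

/-! ### The Weil pairing is non-degenerate and alternating -/

namespace SerreCurve

open WeierstrassCurve WeierstrassCurve.Affine Polynomial
open scoped Polynomial.Bivariate nonZeroDivisors

/-- Galois theory for a self-embedding `μ` of a field of finite transcendence degree. -/
lemma exists_eq_of_forall_hom {K L F : Type*} [Field K] [Field L] [Algebra K L] [CharZero K]
    [Field F] [Algebra K F] [Algebra L F] [IsScalarTower K L F] [IsAlgClosed F]
    [Algebra.IsAlgebraic L F] (h : Algebra.trdeg K L < Cardinal.aleph0) (μ : L →ₐ[K] L) (x : L)
    (hx : ∀ φ : L →ₐ[K] F, (∀ y, φ (μ y) = algebraMap L F (μ y)) → φ x = algebraMap L F x) :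
    ∃ y, μ y = x := by
  let A := μ.fieldRange
  have halg : Algebra.IsAlgebraic A L := by
    have e := AlgEquiv.trdeg_eq (AlgHom.equivFieldRange μ)
    have e' := lift_trdeg_add_eq K A L
    rw [Cardinal.lift_id, Cardinal.lift_id, Cardinal.lift_id, ← e] at e'
    exact trdeg_eq_zero_iff.1 (Cardinal.eq_of_add_eq_add_left
      (by rw [e', add_zero]) h)
  have : IsScalarTower A L F := inferInstance
  have : Algebra.IsAlgebraic A F := Algebra.IsAlgebraic.trans A L F
  have : CharZero A := charZero_of_injective_algebraMap (algebraMap K A).injective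
  have : IsAlgClosure A F := ⟨inferInstance, inferInstance⟩
  have : IsGalois A F := IsAlgClosure.isGalois A F
  have hfix := (InfiniteGalois.mem_range_algebraMap_iff_fixed (k := A) (algebraMap L F x)).2 (by
    intro σ
    refine hx ((σ.toAlgHom.restrictScalars K).comp (IsScalarTower.toAlgHom K L F)) fun y => ?_
    exact σ.commutes ⟨μ y, y, rfl⟩)
  obtain ⟨⟨_, y, rfl⟩, hy⟩ := hfix
  exact ⟨y, (algebraMap L F).injective hy⟩

section

variable {k K : Type*} [Field k] [Field K] [Algebra k K] {E : WeierstrassCurve k}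
  {L : Type*} [Field L] [Algebra k L] [Algebra K L]
  [Algebra (E⁄K).CoordinateRing L] [IsFunctionField K E L]

omit [Algebra (E⁄K).CoordinateRing L] [IsFunctionField K E L] [Algebra k L] in
variable (E K L) in
lemma trdeg_functionField_lt [Algebra k L] [Algebra (E⁄K).CoordinateRing L]
    [IsFunctionField K E L] : Algebra.trdeg K L < Cardinal.aleph0 := by
  have := Module.Finite.of_basis (CoordinateRing.basis (E⁄K))
  have : Algebra.FiniteType K (E⁄K).CoordinateRing :=
    Algebra.FiniteType.trans (S := K[X]) inferInstance inferInstance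
  have h := trdeg_lt_aleph0_of_finiteType (R := K) (S := (E⁄K).CoordinateRing)
  have := IsLocalization.isAlgebraic L (E⁄K).CoordinateRing⁰
  have : FaithfulSMul (E⁄K).CoordinateRing L := inferInstance
  have h1 := lift_trdeg_add_eq K (E⁄K).CoordinateRing L
  rw [trdeg_eq_zero (R := (E⁄K).CoordinateRing) (A := L), Cardinal.lift_zero, add_zero] at h1
  rwa [← Cardinal.lift_lt_aleph0, ← h1, Cardinal.lift_lt_aleph0]

variable [E.IsElliptic] [DecidableEq K] [DecidableEq L] [IsAlgClosed K] [CharZero K]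
variable (hE : ∀ j : ℕ, 0 < j → ∃ S : (E⁄K).Point, j • S ≠ 0)
variable {n : ℕ} (hn : 0 < n)

include hE hn

omit [CharZero K] in
/-- Embeddings of the function field that agree on functions of `n • X` differ by a translation by
a torsion point. -/
lemma exists_eq_comp_transl {F : Type*} [Field F] [Algebra k F] {φ ι : L →ₐ[k] F}
    (e : φ.comp (mulHom L (hE n hn)) = ι.comp (mulHom L (hE n hn))) :
    ∃ S : (E⁄K).Point, n • S = 0 ∧ φ = ι.comp (transl L S) := by
  classical
  have hc : φ.comp (constHom K E L) = ι.comp (constHom K E L) := by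
    rw [← mulHom_comp_const (hE n hn), ← AlgHom.comp_assoc, e, AlgHom.comp_assoc]
  have hnP : n • Point.map (W' := E) φ (genPt K E L) =
      n • Point.map (W' := E) ι (genPt K E L) := by
    rw [← map_nsmul, ← map_nsmul, ← map_mulHom_genPt (hE n hn), Point.map_map, Point.map_map, e]
  -- A torsion point is constant, since multiples of the generic point are not zero.
  obtain ⟨S, hS⟩ : ∃ S : (E⁄K).Point, Point.map (W' := E) φ (genPt K E L) -
      Point.map (W' := E) ι (genPt K E L) = Point.map (W' := E) (ι.comp (constHom K E L)) S := by
    by_contra! hS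
    obtain ⟨ψ, -, hψ⟩ := exists_hom (L := L) _ hS
    have h1 := congrArg (n • ·) hψ
    simp only [smul_sub] at h1
    rw [hnP, sub_self, ← map_nsmul, map_eq_zero_iff _ (Point.map_injective _)] at h1
    exact nsmul_genPt_ne_cPt (L := L) (hE n hn) 0 (by rw [h1, map_zero])
  refine ⟨S, ?_, ?_⟩
  · refine Point.map_injective (W' := E) (ι.comp (constHom K E L)) ?_
    rw [map_nsmul, ← hS, smul_sub, hnP, sub_self, map_zero]
  · refine functionField_hom_ext' (K := K) (E := E) ?_ ?_
    · rw [AlgHom.comp_assoc, transl_comp_const, hc]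
    · rw [← Point.map_map, map_transl_genPt, map_add, map_cPt, ← hS, add_sub_cancel]

/-- The Weil pairing is non-degenerate. If `Q` pairs trivially with all torsion points, then
`rootFun L n Q` is fixed by all conjugations over the subfield of functions of `n • X`, so that it
lies in this subfield and the function with divisor `n (Q) - n (0)` is an `n`-th power. -/
theorem eq_zero_of_weil_eq_one {Q : (E⁄K).Point} (hQ : n • Q = 0)
    (h : ∀ S : (E⁄K).Point, n • S = 0 → weil L n S Q = 1) : Q = 0 := by
  let μ : L →ₐ[K] L := { mulHom L (hE n hn) with commutes' := mulHom_algebraMap _ }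
  obtain ⟨g, hg⟩ := exists_eq_of_forall_hom (F := AlgebraicClosure L)
    (trdeg_functionField_lt K E L) μ (rootFun L n Q) fun φ hφ => by
      let _ : Algebra k (AlgebraicClosure L) := ((algebraMap L _).comp (algebraMap k L)).toAlgebra
      let ι : L →ₐ[k] AlgebraicClosure L := { algebraMap L _ with commutes' := fun _ => rfl }
      let φ' : L →ₐ[k] AlgebraicClosure L :=
        { φ with
          commutes' := fun a => by
            change φ (algebraMap k L a) = algebraMap L _ (algebraMap k L a)
            rw [IsScalarTower.algebraMap_apply k K L, φ.commutes,
              IsScalarTower.algebraMap_apply K L (AlgebraicClosure L)] }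
      obtain ⟨S, hS, e⟩ := exists_eq_comp_transl (φ := φ') (ι := ι) hE hn (AlgHom.ext hφ)
      have := (weil_spec (L := L) hE hn hS hQ).2
      rw [h S hS, map_one, one_mul] at this
      refine (DFunLike.congr_fun e (rootFun L n Q)).trans ?_
      rw [AlgHom.comp_apply, this]
      rfl
  change mulHom L (hE n hn) g = _ at hg
  obtain ⟨ε, hε, e⟩ := rootFun_pow (L := L) hE hn hQ
  have hε0 : ε ≠ 0 := by rintro rfl; simp at hε
  refine eq_zero_of_torsFun_eq_pow (L := L) hn hQ (a := ε) (g := g) hε0 ?_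
  apply (mulHom L (hE n hn)).toRingHom.injective
  change mulHom L (hE n hn) _ = mulHom L (hE n hn) _
  rw [map_mul, map_pow, hg, e, mulHom_algebraMap, ← mul_assoc, ← map_mul, ← pow_two, hε, map_one,
    one_mul]

omit [CharZero K] hE in
/-- The quotient of a function with divisor `n (Q) - n (0)` by a translate of it is an `n`-th
power, up to a constant. -/
lemma constRel_torsFun {Q d : (E⁄K).Point} (hQ : n • Q = 0) (hQ0 : Q ≠ 0) (hd : n • d ≠ 0) :
    ConstRel K (torsFun n (cPt Q) (genPt K E L))
      (transl L d (torsFun n (cPt Q) (genPt K E L)) *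
        lineFun (cPt (-d)) (cPt Q) (genPt K E L) ^ n) := by
  have hne : ∀ j : ℕ, ∀ T : (E⁄K).Point, n • T = n • d ∨ n • T = -(n • d) → XNe (j • Q) T := by
    intro j T hT
    have h1 : n • (j • Q) = 0 := by rw [smul_comm, hQ, smul_zero]
    refine ⟨?_, ?_⟩ <;> intro h <;> rw [h] at h1
    · rcases hT with h' | h' <;> rw [h'] at h1
      exacts [hd h1, hd (neg_eq_zero.1 h1)]
    · rw [smul_neg] at h1
      rcases hT with h' | h' <;> rw [h'] at h1
      exacts [hd (neg_eq_zero.1 h1), hd (by rwa [neg_neg] at h1)]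
  have hL : ∀ {S T : (E⁄K).Point}, XNe S T → XNe (cPt (L := L) S) (cPt T) := fun h =>
    ⟨fun h' => h.1 (Point.map_injective _ h'), fun h' => h.2 (Point.map_injective _
      (h'.trans (map_neg (cPt (L := L) (E := E) (K := K)) _).symm))⟩
  have hXd : ∀ S T : (E⁄K).Point, XNe (cPt S) (genPt K E L + cPt T) := fun S T =>
    ⟨fun h => genPt_add_ne_cPt T S h.symm, fun h => genPt_add_ne_cPt (L := L) T (-S) (by
      rw [map_neg, h, neg_neg])⟩
  have hd0 : d ≠ 0 := by rintro rfl; exact hd (smul_zero n)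
  have h1 := torsFun_mul_torsFun hn (Q := cPt (L := L) Q) (C := genPt K E L) (D := cPt d)
    (by rw [← map_nsmul, hQ, map_zero]) (fun j => by rw [← map_nsmul]; exact xNe_genPt _)
    (fun j => by rw [← map_nsmul]; exact hL (hne j d (.inl rfl)))
    (fun j => by rw [← map_nsmul]; exact hXd _ _)
  rw [← transl_torsFun, lineFun_eq_neg_lineFun (X := genPt K E L) (D := cPt d) (Q := cPt Q)
    (Point.some_ne_zero _) ((map_ne_zero_iff _ (Point.map_injective _)).2 hd0)
    ((map_ne_zero_iff _ (Point.map_injective _)).2 hQ0) (xNe_genPt d).symm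
    (by simpa using hL (hne 1 d (.inl rfl))) (hXd _ _)
    (by rw [← map_neg, ← map_add]; exact (xNe_genPt _).symm), ← map_neg] at h1
  have h2 : torsFun n (cPt (L := L) Q) (cPt d) = algebraMap K L (torsFun n Q d) := by
    rw [torsFun, torsFun, map_prod]
    refine Finset.prod_congr rfl fun i _ => ?_
    rw [← map_nsmul]
    exact (map_lineFun (constHom K E L) Q ((i + 1) • Q) d).symm
  have h3 : torsFun n Q d ≠ 0 := Finset.prod_ne_zero_iff.2 fun i _ => by
    refine lineFun_ne_zero (by simpa using (hne 1 d (.inl rfl)).symm) (hne _ d (.inl rfl)).symm ?_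
    rw [← succ_nsmul']
    exact (hne _ d (.inl rfl)).symm
  rw [h2] at h1
  have h4 : ∀ x : L, ConstRel K ((-x) ^ n) (x ^ n) := fun x => by
    rcases neg_one_pow_eq_or L n with h | h
    · exact ⟨1, one_ne_zero, by rw [neg_pow, h, map_one]⟩
    · exact ⟨-1, neg_ne_zero.2 one_ne_zero, by rw [neg_pow, h, map_neg, map_one]⟩
  refine ConstRel.trans ⟨(torsFun n Q d)⁻¹, inv_ne_zero h3, ?_⟩
    (ConstRel.trans (f := torsFun n (cPt Q) (genPt K E L) * algebraMap K L (torsFun n Q d)) ?_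
      ((ConstRel.refl _).mul (h4 _)))
  · rw [mul_left_comm, ← map_mul, inv_mul_cancel₀ h3, map_one, mul_one]
  · rcases h1 with h1 | h1
    · rw [h1]; exact .refl _
    · exact ⟨-1, neg_ne_zero.2 one_ne_zero, by
        rw [h1, map_neg (algebraMap K L), map_one, neg_one_mul]⟩

omit [IsAlgClosed K] [CharZero K] hE in
lemma constRel_prod_lineFun {Q : (E⁄K).Point} (hQ : n • Q = 0) (d : (E⁄K).Point) :
    ConstRel K (∏ i ∈ Finset.range n, lineFun (cPt (d + i • Q)) (cPt Q) (genPt K E L))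
      (torsFun n (cPt Q) (genPt K E L)) := by
  refine constRel_of_spanSingleton_eq (E := E) (torsFun_genPt_ne_zero n Q) ?_
  have key : ∀ m : ℕ, FractionalIdeal.spanSingleton (E⁄K).CoordinateRing⁰
      (∏ i ∈ Finset.range m, lineFun (cPt (d + i • Q)) (cPt Q) (genPt K E L)) *
        ptIdeal L (d + m • Q) = ptIdeal L d * ptIdeal L Q ^ m := by
    intro m
    induction m with
    | zero => simp
    | succ m ih =>
      rw [Finset.prod_range_succ, ← FractionalIdeal.spanSingleton_mul_spanSingleton, succ_nsmul,
        ← add_assoc, mul_assoc, ← ptIdeal_mul_ptIdeal, ← mul_assoc, ih, pow_succ, mul_assoc]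
  have h := key n
  rw [hQ, add_zero, mul_comm, ptIdeal_pow hn hQ] at h
  exact (isUnit_ptIdeal d).mul_left_cancel h

omit [CharZero K] in
/-- The product of the translates of a function with divisor `n (Q) - n (0)` by the multiples of
`Q` is constant. -/
lemma constRel_prod_transl {Q : (E⁄K).Point} (hQ : n • Q = 0) :
    ConstRel K (∏ i ∈ Finset.range n,
      transl L (-(i • Q)) (torsFun n (cPt Q) (genPt K E L))) 1 := by
  rcases eq_or_ne Q 0 with rfl | hQ0
  · have : torsFun n (cPt (0 : (E⁄K).Point)) (genPt K E L) = 1 := by simp [torsFun]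
    simp only [this, map_one, Finset.prod_const_one]
    exact .refl _
  -- The translations are performed from a base point `d` in general position.
  obtain ⟨d, hd⟩ := hE n hn
  set f := torsFun n (cPt Q) (genPt K E L) with hf
  have hf0 : f ≠ 0 := torsFun_genPt_ne_zero n Q
  have h1 : ConstRel K (∏ _i ∈ Finset.range n, f) (∏ i ∈ Finset.range n,
      (transl L (d - i • Q) f * lineFun (cPt (-d + i • Q)) (cPt Q) (genPt K E L) ^ n)) := by
    refine .prod fun i _ => ?_
    have hi : n • (d - i • Q) = n • d := by rw [smul_sub, smul_comm, hQ, smul_zero, sub_zero]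
    have := constRel_torsFun (L := L) hn hQ hQ0 (d := d - i • Q) (by rwa [hi])
    rwa [neg_sub', sub_neg_eq_add] at this
  rw [Finset.prod_const, Finset.card_range, Finset.prod_mul_distrib, Finset.prod_pow] at h1
  have h2 := h1.trans ((ConstRel.refl _).mul ((constRel_prod_lineFun hn hQ (-d)).pow n))
  obtain ⟨a, ha, h3⟩ := (ConstRel.of_mul_right (g := ∏ i ∈ Finset.range n, transl L (d - i • Q) f)
    (f := 1) (pow_ne_zero n hf0) (by rwa [one_mul])).symm
  refine ⟨a, ha, ?_⟩
  have h4 := congrArg (transl L (-d)) h3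
  rw [map_mul, transl_algebraMap, map_one, map_prod] at h4
  rw [← h4]
  refine Finset.prod_congr rfl fun i _ => ?_
  rw [transl_transl, ← add_sub_assoc, neg_add_cancel, zero_sub]

omit [CharZero K] in
/-- The Weil pairing is alternating. -/
theorem weil_self {Q R : (E⁄K).Point} (hQ : n • Q = 0) (hR : n • R = Q) : weil L n Q Q = 1 := by
  set G := rootFun L n Q
  have hG : G ≠ 0 := rootFun_ne_zero hE n Q
  set M := ∏ i ∈ Finset.range n, transl L (-(i • R)) G with hM
  have hM0 : M ≠ 0 := Finset.prod_ne_zero_iff.2 fun i _ => (_root_.map_ne_zero _).2 hG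
  -- `M` is constant, since its `n`-th power is.
  obtain ⟨c, -, hc⟩ : ConstRel K M 1 := by
    refine .of_pow hn one_ne_zero ?_
    obtain ⟨ε, hε, e⟩ := rootFun_pow (L := L) hE hn hQ
    have hε0 : ε ≠ 0 := by rintro rfl; simp at hε
    obtain ⟨a, ha, h⟩ := constRel_prod_transl (L := L) hE hn hQ
    refine ⟨ε ^ n * a, mul_ne_zero (pow_ne_zero n hε0) ha, ?_⟩
    have hcst : algebraMap K L ε ^ n = ∏ _i ∈ Finset.range n, algebraMap K L ε := by
      rw [Finset.prod_const, Finset.card_range]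
    rw [mul_one] at h
    rw [one_pow, mul_one, map_mul, ← mulHom_algebraMap (hE n hn) a, ← h, map_prod, hM,
      ← Finset.prod_pow, map_pow, hcst,
      ← Finset.prod_mul_distrib]
    refine Finset.prod_congr rfl fun i _ => ?_
    rw [← map_pow, e, map_mul, transl_algebraMap, transl_mulHom, smul_neg, smul_comm, hR]
  -- Translation by `R` moves the first factor of `M` only.
  have h1 : transl L (-R) M = M := by rw [hc, mul_one, transl_algebraMap]
  have h2 : transl L (-R) M * G = M * transl L (-Q) G := by
    have key : ∀ m : ℕ, (∏ i ∈ Finset.range m, transl L (-R) (transl L (-(i • R)) G)) * G =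
        (∏ i ∈ Finset.range m, transl L (-(i • R)) G) * transl L (-(m • R)) G := by
      intro m
      induction m with
      | zero => simp [transl_zero]
      | succ m ih =>
        rw [Finset.prod_range_succ, mul_right_comm, ih, Finset.prod_range_succ, transl_transl,
          ← neg_add, ← succ_nsmul']
    rw [hM, map_prod, key n, hR]
  rw [h1] at h2
  have h3 := mul_left_cancel₀ hM0 h2
  have hnQ : n • (-Q) = 0 := by rw [smul_neg, hQ, neg_zero]
  have h4 : weil L n (-Q) Q = 1 := weil_eq hE hn hnQ hQ hG (.refl _) (by rw [map_one, one_mul, ← h3])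
  have h5 : weil L n (0 : (E⁄K).Point) Q = 1 :=
    weil_eq hE hn (smul_zero n) hQ hG (.refl _) (by rw [map_one, one_mul, transl_zero])
  have h6 := weil_add_left (L := L) hE hn hQ hnQ hQ
  rwa [add_neg_cancel, h5, h4, mul_one, eq_comm] at h6

end

end SerreCurve

/-! ### The determinant of the Galois representation -/

namespace SerreCurve

open WeierstrassCurve WeierstrassCurve.Affine

lemma natCast_eq_of_pow_eq {F : Type*} [Field F] {n : ℕ} (hn : n ≠ 0) {ζ : F}
    (hζ : IsPrimitiveRoot ζ n) {i j : ℕ} (h : ζ ^ i = ζ ^ j) : (i : ZMod n) = j := by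
  rw [ZMod.natCast_eq_natCast_iff, hζ.eq_orderOf, ← Units.val_mk0 (hζ.ne_zero hn), orderOf_units,
    ← pow_eq_pow_iff_modEq, Units.ext_iff]
  simpa using h

variable {E : WeierstrassCurve ℚ}

instance : IsFunctionField QBar E (E⁄QBar).FunctionField where
  tower := inferInstance
  tower' := inferInstance
  frac := inferInstance

section Basis

variable (b : TorsionBasis E) (n : ℕ+)

/-- The `i`-th basis vector of `E[n]`. -/
def basisPt (i : Fin 2) : Pt E := b.iso n (Pi.single i 1)

lemma nsmul_iso (v : Fin 2 → ZMod n) : (n : ℕ) • (b.iso n v : Pt E) = 0 :=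
  AddSubgroup.torsionBy.nsmul_iff.1 (b.iso n v).2

lemma exists_iso_eq {S : Pt E} (hS : (n : ℕ) • S = 0) : ∃ v, (b.iso n v : Pt E) = S :=
  ⟨(b.iso n).symm ⟨S, AddSubgroup.torsionBy.nsmul_iff.2 hS⟩, by simp⟩

lemma iso_eq_nsmul_add_nsmul (v : Fin 2 → ZMod n) :
    (b.iso n v : Pt E) = (v 0).val • basisPt b n 0 + (v 1).val • basisPt b n 1 := by
  have : v = (v 0).val • Pi.single 0 1 + (v 1).val • Pi.single 1 1 := by
    funext i
    fin_cases i <;> simp [-ZMod.natCast_val, ZMod.natCast_zmod_val]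
  conv_lhs => rw [this]
  rw [map_add, map_nsmul, map_nsmul]
  rfl

lemma nsmul_basisPt_eq_zero_iff (i : Fin 2) (m : ℕ) : m • basisPt b n i = 0 ↔ (n : ℕ) ∣ m := by
  rw [← ZMod.natCast_eq_zero_iff, basisPt]
  have h : m • (b.iso n (Pi.single i 1) : Pt E) = (b.iso n (m • Pi.single i 1) : Tors E n) := by
    rw [map_nsmul]; rfl
  rw [h, ZeroMemClass.coe_eq_zero, map_eq_zero_iff _ (b.iso n).injective]
  constructor
  · intro h
    simpa using congrFun h i
  · intro h
    rw [nsmul_eq_mul]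
    funext j
    rw [Pi.mul_apply, Pi.natCast_apply, h, zero_mul, Pi.zero_apply]

/-- Torsion points are divisible by `n`. -/
lemma exists_nsmul_eq_iso (v : Fin 2 → ZMod n) : ∃ R : Pt E, (n : ℕ) • R = b.iso n v := by
  have h : (n : ℕ) ∣ (n * n : ℕ+) := ⟨n, rfl⟩
  refine ⟨b.iso (n * n) fun i => ((v i).val : ZMod (n * n : ℕ+)), ?_⟩
  have := b.compat n (n * n) h fun i => ((v i).val : ZMod (n * n : ℕ+))
  have e : ((n * n : ℕ+) : ℕ) / n = n := by rw [PNat.mul_coe, Nat.mul_div_cancel _ n.pos]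
  rw [e] at this
  rw [this]
  congr 2
  funext i
  rw [map_natCast, ZMod.natCast_val, ZMod.cast_id']
  rfl

include b in
lemma exists_nsmul_ne_zero (j : ℕ) (hj : 0 < j) : ∃ S : Pt E, j • S ≠ 0 := by
  let n : ℕ+ := ⟨2 * j, by omega⟩
  refine ⟨basisPt b n 0, fun h => ?_⟩
  have : 2 * j ≤ j := Nat.le_of_dvd hj ((nsmul_basisPt_eq_zero_iff b n 0 j).1 h)
  omega

lemma galPt_basisPt (σ : GalQ) (j : Fin 2) : galPt σ (basisPt b n j) =
    (galMatrixMod b n σ 0 j).val • basisPt b n 0 + (galMatrixMod b n σ 1 j).val • basisPt b n 1 := by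
  rw [basisPt, ← iso_galLin, iso_eq_nsmul_add_nsmul]
  rfl

variable [E.IsElliptic]

open Classical in
/-- The Weil pairing on the torsion points over `ℚ̄`. -/
def pairing (n : ℕ+) (S Q : Pt E) : QBar := weil (K := QBar) (E⁄QBar).FunctionField n S Q

section

include b

variable {n} {S T Q : Pt E}

lemma pairing_add_left (hS : (n : ℕ) • S = 0) (hT : (n : ℕ) • T = 0) (hQ : (n : ℕ) • Q = 0) :
    pairing n (S + T) Q = pairing n S Q * pairing n T Q := by
  classical exact weil_add_left (exists_nsmul_ne_zero b) n.pos hS hT hQ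

lemma pairing_add_right (hS : (n : ℕ) • S = 0) (hT : (n : ℕ) • T = 0) (hQ : (n : ℕ) • Q = 0) :
    pairing n S (T + Q) = pairing n S T * pairing n S Q := by
  classical exact weil_add_right (exists_nsmul_ne_zero b) n.pos hS hT hQ

lemma pairing_pow (hS : (n : ℕ) • S = 0) (hQ : (n : ℕ) • Q = 0) : pairing n S Q ^ (n : ℕ) = 1 := by
  classical exact (weil_spec (exists_nsmul_ne_zero b) n.pos hS hQ).1

lemma pairing_ne_zero (hS : (n : ℕ) • S = 0) (hQ : (n : ℕ) • Q = 0) : pairing n S Q ≠ 0 := by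
  intro h
  have := pairing_pow b hS hQ
  rw [h, zero_pow n.ne_zero] at this
  exact zero_ne_one this

lemma pairing_nsmul_left (hS : (n : ℕ) • S = 0) (hQ : (n : ℕ) • Q = 0) (m : ℕ) :
    pairing n (m • S) Q = pairing n S Q ^ m := by
  have hm : ∀ m : ℕ, (n : ℕ) • m • S = 0 := fun m => by rw [smul_comm, hS, nsmul_zero]
  induction m with
  | zero =>
    have h := pairing_add_left b (hm 0) (hm 0) hQ
    rw [zero_nsmul, add_zero] at h
    rw [zero_nsmul, pow_zero]
    exact (mul_eq_left₀ (pairing_ne_zero b (nsmul_zero _) hQ)).1 h.symm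
  | succ m ih => rw [succ_nsmul, pairing_add_left b (hm m) hS hQ, ih, pow_succ]

lemma pairing_nsmul_right (hS : (n : ℕ) • S = 0) (hQ : (n : ℕ) • Q = 0) (m : ℕ) :
    pairing n S (m • Q) = pairing n S Q ^ m := by
  have hm : ∀ m : ℕ, (n : ℕ) • m • Q = 0 := fun m => by rw [smul_comm, hQ, nsmul_zero]
  induction m with
  | zero =>
    have h := pairing_add_right b hS (hm 0) (hm 0)
    rw [zero_nsmul, add_zero] at h
    rw [zero_nsmul, pow_zero]
    exact (mul_eq_left₀ (pairing_ne_zero b hS (nsmul_zero _))).1 h.symm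
  | succ m ih => rw [succ_nsmul, pairing_add_right b hS (hm m) hQ, ih, pow_succ]

lemma pairing_self (hQ : (n : ℕ) • Q = 0) : pairing n Q Q = 1 := by
  classical
  obtain ⟨v, rfl⟩ := exists_iso_eq b n hQ
  obtain ⟨R, hR⟩ := exists_nsmul_eq_iso b n v
  exact weil_self (exists_nsmul_ne_zero b) n.pos hQ hR

lemma pairing_mul_swap (hS : (n : ℕ) • S = 0) (hQ : (n : ℕ) • Q = 0) :
    pairing n S Q * pairing n Q S = 1 := by
  have hSQ : (n : ℕ) • (S + Q) = 0 := by rw [nsmul_add, hS, hQ, add_zero]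
  have h := pairing_self b hSQ
  rwa [pairing_add_left b hS hQ hSQ, pairing_add_right b hS hS hQ, pairing_add_right b hQ hS hQ,
    pairing_self b hS, pairing_self b hQ, one_mul, mul_one] at h

lemma pairing_galPt (σ : GalQ) (hS : (n : ℕ) • S = 0) (hQ : (n : ℕ) • Q = 0) :
    pairing n (galPt σ S) (galPt σ Q) = σ (pairing n S Q) := by
  classical exact weil_map (exists_nsmul_ne_zero b) n.pos (σ : QBar →ₐ[ℚ] QBar) hS hQ

end

lemma isPrimitiveRoot_pairing :
    IsPrimitiveRoot (pairing n (basisPt b n 0) (basisPt b n 1)) n where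
  pow_eq_one := pairing_pow b (nsmul_iso ..) (nsmul_iso ..)
  dvd_of_pow_eq_one m hm := by
    classical
    rw [← nsmul_basisPt_eq_zero_iff b n 1]
    have h1 : (n : ℕ) • basisPt b n 1 = 0 := nsmul_iso ..
    have h0 : (n : ℕ) • basisPt b n 0 = 0 := nsmul_iso ..
    have hmn : (n : ℕ) • m • basisPt b n 1 = 0 := by rw [smul_comm, h1, nsmul_zero]
    refine eq_zero_of_weil_eq_one (L := (E⁄QBar).FunctionField) (exists_nsmul_ne_zero b) n.pos hmn
      fun S hS => ?_
    obtain ⟨v, rfl⟩ := exists_iso_eq b n hS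
    rw [iso_eq_nsmul_add_nsmul]
    change pairing n _ _ = 1
    rw [pairing_add_left b (by rw [smul_comm, h0, nsmul_zero]) (by rw [smul_comm, h1, nsmul_zero]) hmn,
      pairing_nsmul_left b h0 hmn, pairing_nsmul_left b h1 hmn, pairing_nsmul_right b h0 h1,
      pairing_nsmul_right b h1 h1, hm, pairing_self b h1]
    simp

theorem det_galMatrixMod (σ : GalQ) : (galMatrixMod b n σ).det = (cycMod n σ : ZMod n) := by
  have h0 : (n : ℕ) • basisPt b n 0 = 0 := nsmul_iso ..
  have h1 : (n : ℕ) • basisPt b n 1 = 0 := nsmul_iso ..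
  set ζ := pairing n (basisPt b n 0) (basisPt b n 1) with hζ
  have hprim : IsPrimitiveRoot ζ n := isPrimitiveRoot_pairing b n
  have hζ0 : ζ ≠ 0 := pairing_ne_zero b h0 h1
  set A := galMatrixMod b n σ
  have hswap : pairing n (basisPt b n 1) (basisPt b n 0) = ζ⁻¹ :=
    eq_inv_of_mul_eq_one_right (pairing_mul_swap b h0 h1)
  have hk : ∀ m : ℕ, ∀ {S : Pt E}, (n : ℕ) • S = 0 → (n : ℕ) • m • S = 0 := fun m S hS => by
    rw [smul_comm, hS, nsmul_zero]
  have hσ := pairing_galPt b σ h0 h1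
  rw [galPt_basisPt, galPt_basisPt,
    pairing_add_left b (hk _ h0) (hk _ h1) (by rw [nsmul_add, hk _ h0, hk _ h1, add_zero]),
    pairing_add_right b (hk _ h0) (hk _ h0) (hk _ h1),
    pairing_add_right b (hk _ h1) (hk _ h0) (hk _ h1)] at hσ
  simp only [pairing_nsmul_left b h0 (hk _ h0), pairing_nsmul_left b h0 (hk _ h1),
    pairing_nsmul_left b h1 (hk _ h0), pairing_nsmul_left b h1 (hk _ h1),
    pairing_nsmul_right b h0 h0, pairing_nsmul_right b h0 h1, pairing_nsmul_right b h1 h0,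
    pairing_nsmul_right b h1 h1, pairing_self b h0, pairing_self b h1, hswap, ← hζ, one_pow,
    one_mul, mul_one] at hσ
  have hcyc : σ ζ = ζ ^ (cycMod n σ : ZMod n).val := by
    have := cycMod_spec n σ (t := Units.mk0 ζ hζ0) (by
      rw [mem_rootsOfUnity, Units.ext_iff]
      simpa using hprim.pow_eq_one)
    simpa using this
  rw [hcyc, inv_pow, inv_pow, ← pow_mul, ← pow_mul, mul_inv_eq_iff_eq_mul₀ (pow_ne_zero _ hζ0),
    ← pow_add] at hσ
  have h3 := natCast_eq_of_pow_eq n.ne_zero hprim hσ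
  simp only [Nat.cast_add, Nat.cast_mul, ZMod.natCast_zmod_val] at h3
  rw [Matrix.det_fin_two]
  linear_combination h3

theorem det_rho (σ : GalQ) : Matrix.GeneralLinearGroup.det (rho b σ) = cyc σ := by
  ext n
  have h := det_galMatrixMod b n σ
  rw [Matrix.det_fin_two] at h
  have : (Matrix.GeneralLinearGroup.det (rho b σ) : ZHat) = (galMatrix b σ).det := rfl
  rw [this, Matrix.det_fin_two]
  exact h

theorem det_rhoDual (σ : GalQ) : Matrix.GeneralLinearGroup.det (rhoDual b σ) = (cyc σ)⁻¹ := by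
  rw [← map_inv, ← det_rho b]
  ext1
  exact Matrix.det_transpose _

end Basis

end SerreCurve

/-! ### Compactness of the Galois group -/

namespace SerreCurve

open WeierstrassCurve WeierstrassCurve.Affine

instance : Algebra.IsAlgebraic ℚ QBar := by
  -- The two structures of `ℚ`-algebra on `QBar` are not reducibly equal.
  have h := AlgebraicClosure.isAlgebraic ℚ
  convert h
  · rfl
  · exact Subsingleton.elim _ _

instance : IsAlgClosure ℚ QBar := ⟨inferInstance, inferInstance⟩

/-- A property of automorphisms that depends on the images of finitely many algebraic numbers
only. -/
def IsFinitary (S : Set GalQ) : Prop :=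
  ∃ s : Finset QBar, ∀ σ τ : GalQ, (∀ x ∈ s, σ x = τ x) → σ ∈ S → τ ∈ S

lemma IsFinitary.isClosed {S : Set GalQ} (hS : IsFinitary S) : IsClosed S := by
  obtain ⟨s, hs⟩ := hS
  rw [← isOpen_compl_iff, isOpen_iff_mem_nhds]
  intro σ hσ
  have h1 : IsOpen (⋂ x ∈ s, (MulAction.stabilizer GalQ x : Set GalQ)) :=
    isOpen_biInter_finset fun x _ => stabilizer_isOpen_of_isIntegral x
  refine Filter.mem_of_superset ((h1.leftCoset σ).mem_nhds
    (Set.mem_smul_set.2 ⟨1, Set.mem_iInter₂.2 fun x _ => one_mem _, mul_one σ⟩)) ?_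
  rintro _ ⟨τ, hτ, rfl⟩ h
  refine hσ (hs _ σ (fun x hx => ?_) h)
  have : τ x = x := Set.mem_iInter₂.1 hτ x hx
  change σ (τ x) = σ x
  rw [this]

lemma exists_forall_mem {S : ℕ+ → Set GalQ} (hne : ∀ n, (S n).Nonempty)
    (hdir : ∀ m n : ℕ+, (m : ℕ) ∣ n → S n ⊆ S m) (hS : ∀ n, IsFinitary (S n)) :
    ∃ σ, ∀ n, σ ∈ S n := by
  obtain ⟨σ, hσ⟩ := IsCompact.nonempty_iInter_of_directed_nonempty_isCompact_isClosed S
    (fun m n => ⟨m * n, hdir _ _ ⟨n, rfl⟩, hdir _ _ ⟨m, mul_comm _ _⟩⟩) hne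
    (fun n => (hS n).isClosed.isCompact) (fun n => (hS n).isClosed)
  exact ⟨σ, Set.mem_iInter.1 hσ⟩

lemma cycMod_eq_of_apply_eq {n : ℕ+} {ζ : QBar} (hζ : IsPrimitiveRoot ζ n) {σ : GalQ} {a : ℕ}
    (h : σ ζ = ζ ^ a) : (cycMod n σ : ZMod n) = a := by
  have hζ0 : ζ ≠ 0 := hζ.ne_zero n.ne_zero
  have h1 := cycMod_spec n σ (t := Units.mk0 ζ hζ0) (by
    rw [mem_rootsOfUnity, Units.ext_iff]
    simpa using hζ.pow_eq_one)
  rw [Units.val_mk0, h] at h1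
  rw [natCast_eq_of_pow_eq n.ne_zero hζ h1, ZMod.natCast_zmod_val]

lemma apply_eq_of_cycMod {n : ℕ+} {ζ : QBar} (hζ : ζ ^ (n : ℕ) = 1) (σ : GalQ) :
    σ ζ = ζ ^ (cycMod n σ : ZMod n).val := by
  have hζ0 : ζ ≠ 0 := by rintro rfl; simp at hζ
  simpa using cycMod_spec n σ (t := Units.mk0 ζ hζ0) (by
    rw [mem_rootsOfUnity, Units.ext_iff]
    simpa using hζ)

lemma exists_isPrimitiveRoot (n : ℕ+) : ∃ ζ : QBar, IsPrimitiveRoot ζ n :=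
  HasEnoughRootsOfUnity.exists_primitiveRoot QBar n

lemma isFinitary_cycMod (n : ℕ+) (a : ZMod n) : IsFinitary {σ | (cycMod n σ : ZMod n) = a} := by
  obtain ⟨ζ, hζ⟩ := exists_isPrimitiveRoot n
  refine ⟨{ζ}, fun σ τ h hσ => ?_⟩
  have h1 := h ζ (Finset.mem_singleton_self ζ)
  rw [apply_eq_of_cycMod hζ.pow_eq_one σ] at h1
  have := cycMod_eq_of_apply_eq hζ h1.symm
  rw [ZMod.natCast_zmod_val] at this
  exact this.trans hσ

/-- Surjectivity follows from the irreducibility of the cyclotomic polynomials. -/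
lemma cycMod_surjective (n : ℕ+) (u : (ZMod n)ˣ) : ∃ σ, (cycMod n σ : ZMod n) = u := by
  obtain ⟨ζ, hζ⟩ := exists_isPrimitiveRoot n
  have hζ' : IsPrimitiveRoot (ζ ^ (u : ZMod n).val) n :=
    hζ.pow_of_coprime _ (ZMod.val_coe_unit_coprime u)
  obtain ⟨σ, hσ⟩ := (Normal.minpoly_eq_iff_mem_orbit (F := ℚ) (E := QBar)).1
    ((Polynomial.cyclotomic_eq_minpoly_rat hζ' n.pos).symm.trans
      (Polynomial.cyclotomic_eq_minpoly_rat hζ n.pos))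
  refine ⟨σ, ?_⟩
  have := cycMod_eq_of_apply_eq hζ hσ
  rwa [ZMod.natCast_zmod_val] at this

lemma ZHat.ext_reduction {x y : ZHat} (h : ∀ n, reduction n x = reduction n y) : x = y :=
  Subtype.ext (funext h)

lemma reduction_cyc (n : ℕ+) (σ : GalQ) : reduction n (cyc σ) = (cycMod n σ : ZMod n) := rfl

lemma castHom_reduction {m n : ℕ+} (h : (m : ℕ) ∣ n) (x : ZHat) :
    ZMod.castHom h (ZMod m) (reduction n x) = reduction m x := x.2 m n h

theorem cyc_surjective : Function.Surjective cyc := by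
  intro u
  obtain ⟨σ, hσ⟩ := exists_forall_mem (S := fun n => {σ | (cycMod n σ : ZMod n) = reduction n u})
    (fun n => cycMod_surjective n (Units.map (reduction n : ZHat →* ZMod n) u))
    (fun m n h σ hσ => by
      change _ = _ at hσ
      change _ = _
      rw [← castHom_reduction h, ← hσ, cycMod_compat])
    (fun n => isFinitary_cycMod n _)
  exact ⟨σ, Units.ext (ZHat.ext_reduction hσ)⟩

variable {E : WeierstrassCurve ℚ}

lemma exists_finset_galPt (P : Pt E) :
    ∃ s : Finset QBar, ∀ σ τ : GalQ, (∀ x ∈ s, σ x = τ x) → galPt σ P = galPt τ P := by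
  classical
  rcases P with _ | ⟨x, y, h⟩
  · exact ⟨∅, fun _ _ _ => rfl⟩
  · refine ⟨{x, y}, fun σ τ h => ?_⟩
    have hx : σ x = τ x := h x (by simp)
    have hy : σ y = τ y := h y (by simp)
    simp only [galPt, Point.map_some, Point.some.injEq]
    exact ⟨hx, hy⟩

lemma galMatrixMod_congr (b : TorsionBasis E) (n : ℕ+) {σ τ : GalQ}
    (h : ∀ j, galPt σ (basisPt b n j) = galPt τ (basisPt b n j)) :
    galMatrixMod b n σ = galMatrixMod b n τ := by
  have : ∀ j, galLin b n σ (Pi.single j 1) = galLin b n τ (Pi.single j 1) := fun j =>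
    iso_ext b n (by rw [iso_galLin, iso_galLin]; exact h j)
  ext i j
  rw [galMatrixMod, galMatrixMod, LinearMap.toMatrix'_apply, LinearMap.toMatrix'_apply]
  have e : (fun j' => if j' = j then (1 : ZMod n) else 0) = Pi.single j 1 := by
    funext j'; simp [Pi.single_apply]
  simpa [Pi.single_apply, e] using! congrFun (this j) i

lemma redGL_apply (n : ℕ+) (g : GL (Fin 2) ZHat) (i j : Fin 2) :
    redGL n g i j = reduction n (g i j) := rfl

lemma redGL_rhoDual_eq (b : TorsionBasis E) (n : ℕ+) {σ τ : GalQ}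
    (h : galMatrixMod b n σ = galMatrixMod b n τ) :
    redGL n (rhoDual b σ) = redGL n (rhoDual b τ) := by
  have h1 : redGL n (rho b σ) = redGL n (rho b τ) := Units.ext (by
    ext i j
    exact congrFun (congrFun h i) j)
  have h2 : redGL n (rho b σ⁻¹) = redGL n (rho b τ⁻¹) := by
    rw [map_inv, map_inv, map_inv, map_inv, h1]
  refine Units.ext ?_
  ext i j
  exact congrArg (fun g : GL (Fin 2) (ZMod n) => g j i) h2

lemma isFinitary_redGL (b : TorsionBasis E) (n : ℕ+) (g : GL (Fin 2) (ZMod n)) :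
    IsFinitary {σ | redGL n (rhoDual b σ) = g} := by
  classical
  obtain ⟨s₀, h₀⟩ := exists_finset_galPt (basisPt b n 0)
  obtain ⟨s₁, h₁⟩ := exists_finset_galPt (basisPt b n 1)
  refine ⟨s₀ ∪ s₁, fun σ τ h hσ => ?_⟩
  change _ = g
  rw [← hσ]
  refine redGL_rhoDual_eq b n (galMatrixMod_congr b n fun j => ?_)
  fin_cases j
  · exact (h₀ σ τ fun x hx => h x (Finset.mem_union_left _ hx)).symm
  · exact (h₁ σ τ fun x hx => h x (Finset.mem_union_right _ hx)).symm

/-- The image of Galois is closed. -/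
theorem mem_imageGroup_of_forall (b : TorsionBasis E) {g : GL (Fin 2) ZHat}
    (h : ∀ n, ∃ x ∈ imageGroup b, redGL n x = redGL n g) : g ∈ imageGroup b := by
  obtain ⟨σ, hσ⟩ := exists_forall_mem (S := fun n => {σ | redGL n (rhoDual b σ) = redGL n g})
    (fun n => by
      obtain ⟨_, ⟨σ, rfl⟩, hx⟩ := h n
      exact ⟨σ, hx⟩)
    (fun m n hmn σ hσ => by
      change _ = _ at hσ
      change _ = _
      refine Units.ext ?_
      ext i j
      have := congrArg (fun x : GL (Fin 2) (ZMod n) => x i j) hσ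
      simp only [redGL_apply] at this
      rw [redGL_apply, redGL_apply, ← castHom_reduction hmn, ← castHom_reduction hmn, this])
    (fun n => isFinitary_redGL b n _)
  refine ⟨σ, Units.ext ?_⟩
  ext i j n
  exact congrArg (fun x : GL (Fin 2) (ZMod n) => x i j) (hσ n)

end SerreCurve

/-! ### Quadratic extensions of `ℚ` are cyclotomic -/

namespace SerreCurve

/-- `x` lies in a cyclotomic field. -/
def IsCyclotomic (x : QBar) : Prop := ∃ N : ℕ+, ∀ σ : GalQ, cycMod N σ = 1 → σ x = x

lemma cycMod_eq_one_of_dvd {m n : ℕ+} (h : (m : ℕ) ∣ n) {σ : GalQ} (hσ : cycMod n σ = 1) :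
    cycMod m σ = 1 := by
  ext
  rw [← cycMod_compat σ m n h, hσ, Units.val_one, map_one, Units.val_one]

namespace IsCyclotomic

variable {x y : QBar}

lemma of_map₂ {f : QBar → QBar → QBar} (hf : ∀ (σ : GalQ) a b, σ (f a b) = f (σ a) (σ b))
    (hx : IsCyclotomic x) (hy : IsCyclotomic y) : IsCyclotomic (f x y) := by
  obtain ⟨m, hm⟩ := hx
  obtain ⟨n, hn⟩ := hy
  refine ⟨m * n, fun σ hσ => ?_⟩
  rw [hf, hm σ (cycMod_eq_one_of_dvd ⟨n, rfl⟩ hσ), hn σ (cycMod_eq_one_of_dvd ⟨m, mul_comm _ _⟩ hσ)]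

lemma mul (hx : IsCyclotomic x) (hy : IsCyclotomic y) : IsCyclotomic (x * y) :=
  of_map₂ (fun σ a b => map_mul σ a b) hx hy

lemma add (hx : IsCyclotomic x) (hy : IsCyclotomic y) : IsCyclotomic (x + y) :=
  of_map₂ (fun σ a b => map_add σ a b) hx hy

lemma int (a : ℤ) : IsCyclotomic a := ⟨1, fun σ _ => map_intCast σ a⟩

lemma neg (hx : IsCyclotomic x) : IsCyclotomic (-x) := by simpa using (int (-1)).mul hx

lemma sum {ι : Type*} {s : Finset ι} {f : ι → QBar} (h : ∀ i ∈ s, IsCyclotomic (f i)) :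
    IsCyclotomic (∑ i ∈ s, f i) := by
  classical
  induction s using Finset.induction_on with
  | empty => simpa using int 0
  | insert i s hi ih =>
    rw [Finset.sum_insert hi]
    exact (h i (s.mem_insert_self i)).add (ih fun j hj => h j (Finset.mem_insert_of_mem hj))

lemma of_pow_eq_one {n : ℕ} (hn : 0 < n) (hx : x ^ n = 1) : IsCyclotomic x := by
  refine ⟨⟨n, hn⟩, fun σ hσ => ?_⟩
  rw [apply_eq_of_cycMod (n := ⟨n, hn⟩) hx, hσ, Units.val_one, ZMod.val_one_eq_one_mod]
  change x ^ (1 % n) = x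
  rw [← pow_eq_pow_mod 1 hx, pow_one]

end IsCyclotomic

lemma exists_isCyclotomic_sq_neg_one : ∃ x : QBar, x ^ 2 = -1 ∧ IsCyclotomic x := by
  obtain ⟨x, hx⟩ := IsAlgClosed.exists_pow_nat_eq (-1 : QBar) two_pos
  exact ⟨x, hx, .of_pow_eq_one four_pos (by linear_combination (x ^ 2 - 1) * hx)⟩

lemma exists_isCyclotomic_sq_two : ∃ x : QBar, x ^ 2 = 2 ∧ IsCyclotomic x := by
  obtain ⟨z, hz⟩ := IsAlgClosed.exists_pow_nat_eq (-1 : QBar) four_pos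
  have h : IsCyclotomic z := .of_pow_eq_one (n := 8) (by norm_num)
    (by linear_combination (z ^ 4 - 1) * hz)
  refine ⟨z + -(z * (z * z)), ?_, h.add (h.mul (h.mul h)).neg⟩
  linear_combination (z ^ 2 - 2) * hz

/-- The square of a quadratic Gauss sum is `± p`. -/
lemma exists_isCyclotomic_sq_prime {p : ℕ} (hp : p.Prime) (hp2 : p ≠ 2) :
    ∃ x : QBar, (x ^ 2 = p ∨ x ^ 2 = -p) ∧ IsCyclotomic x := by
  have : Fact p.Prime := ⟨hp⟩
  obtain ⟨ζ, hζ⟩ := exists_isPrimitiveRoot ⟨p, hp.pos⟩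
  have hζ' : IsPrimitiveRoot ζ p := hζ
  let ψ : AddChar (ZMod p) QBar := AddChar.zmodChar p hζ'.pow_eq_one
  let χ : MulChar (ZMod p) QBar := (quadraticChar (ZMod p)).ringHomComp (Int.castRingHom QBar)
  have hc : ringChar (ZMod p) ≠ 2 := by rwa [ZMod.ringChar_zmod_n]
  have hχq : (quadraticChar (ZMod p)).IsQuadratic := quadraticChar_isQuadratic _
  have hχ : χ.IsQuadratic := hχq.comp _
  have hχ1 : χ ≠ 1 := by
    intro h
    obtain ⟨a, ha⟩ := quadraticChar_exists_neg_one' hc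
    have h1 := congrArg (fun f : MulChar (ZMod p) QBar => f a) h
    simp only [χ, MulChar.ringHomComp_apply, ha, MulChar.one_apply_coe] at h1
    norm_num at h1
  refine ⟨gaussSum χ ψ, ?_, ?_⟩
  · rw [gaussSum_sq hχ1 hχ (AddChar.zmodChar_primitive_of_primitive_root p hζ'), ZMod.card]
    rcases hχ (-1) with h | h | h
    · have h2 := (isUnit_one.neg : IsUnit (-1 : ZMod p)).map χ
      exact absurd h h2.ne_zero
    · left; rw [h, one_mul]
    · right; rw [h, neg_one_mul]
  · refine .sum fun a _ => ?_
    refine .mul (.int _) (.of_pow_eq_one hp.pos ?_)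
    rw [AddChar.zmodChar_apply, ← pow_mul, mul_comm, pow_mul, hζ'.pow_eq_one, one_pow]

lemma exists_isCyclotomic_sq_nat (n : ℕ) : ∃ x : QBar, x ^ 2 = n ∧ IsCyclotomic x := by
  induction n using Nat.recOnMul with
  | zero => exact ⟨0, by simp, by simpa using IsCyclotomic.int 0⟩
  | one => exact ⟨1, by simp, by simpa using IsCyclotomic.int 1⟩
  | prime p hp =>
    rcases eq_or_ne p 2 with rfl | h2
    · exact exists_isCyclotomic_sq_two
    · obtain ⟨x, hx | hx, hx'⟩ := exists_isCyclotomic_sq_prime hp h2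
      · exact ⟨x, hx, hx'⟩
      · obtain ⟨i, hi, hi'⟩ := exists_isCyclotomic_sq_neg_one
        exact ⟨i * x, by rw [mul_pow, hx, hi]; ring, hi'.mul hx'⟩
  | mul a b ha hb =>
    obtain ⟨x, hx, hx'⟩ := ha
    obtain ⟨y, hy, hy'⟩ := hb
    exact ⟨x * y, by rw [mul_pow, hx, hy]; push_cast; rfl, hx'.mul hy'⟩

/-- Square roots of integers lie in cyclotomic fields. -/
theorem isCyclotomic_of_sq_eq_int {d : ℤ} {x : QBar} (hx : x ^ 2 = d) : IsCyclotomic x := by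
  obtain ⟨y, hy, hy'⟩ : ∃ y : QBar, y ^ 2 = d ∧ IsCyclotomic y := by
    obtain ⟨y, hy, hy'⟩ := exists_isCyclotomic_sq_nat d.natAbs
    rcases Int.natAbs_eq d with h | h
    · exact ⟨y, by rw [hy, h]; simp, hy'⟩
    · obtain ⟨i, hi, hi'⟩ := exists_isCyclotomic_sq_neg_one
      exact ⟨i * y, by rw [mul_pow, hy, hi, h]; simp, hi'.mul hy'⟩
  rcases sq_eq_sq_iff_eq_or_eq_neg.1 (hx.trans hy.symm) with rfl | rfl
  exacts [hy', hy'.neg]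

/-- Quadratic characters of the absolute Galois group of `ℚ` factor through the cyclotomic
character. -/
theorem exists_forall_eq_one_of_cycMod {A : Type*} [Group A]
    (hA : ∀ a b : A, a ≠ 1 → b ≠ 1 → a * b = 1) (θ : GalQ →* A)
    (hθ : IsFinitary (θ.ker : Set GalQ)) : ∃ N : ℕ+, ∀ σ, cycMod N σ = 1 → θ σ = 1 := by
  by_cases htriv : ∀ σ, θ σ = 1
  · exact ⟨1, fun σ _ => htriv σ⟩
  push Not at htriv
  obtain ⟨τ, hτ⟩ := htriv
  let H : ClosedSubgroup GalQ := ⟨θ.ker, hθ.isClosed⟩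
  obtain ⟨y, hy, hτy⟩ : ∃ y : QBar, (∀ σ, θ σ = 1 → σ y = y) ∧ τ y ≠ y := by
    by_contra! h
    refine hτ ?_
    have h1 : τ ∈ (IntermediateField.fixedField H.1).fixingSubgroup := by
      rw [IntermediateField.mem_fixingSubgroup_iff]
      exact fun y hy => h y fun σ hσ => hy ⟨σ, hσ⟩
    rw [InfiniteGalois.fixingSubgroup_fixedField H] at h1
    exact h1
  -- `δ` generates the quadratic field that corresponds to `θ`.
  set δ := y - τ y with hδ
  have hδ0 : δ ≠ 0 := sub_ne_zero.2 hτy.symm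
  have hker : ∀ σ, θ σ = 1 → σ δ = δ := fun σ hσ => by
    have h1 : τ⁻¹ (σ (τ y)) = y := hy (τ⁻¹ * σ * τ) (by simp [hσ])
    have h2 : σ (τ y) = τ y := (τ.apply_symm_apply _).symm.trans (congrArg τ h1)
    rw [hδ, map_sub, hy σ hσ, h2]
  have hτδ : τ δ = -δ := by
    have h1 : τ (τ y) = y := hy (τ * τ) (by rw [map_mul, hA _ _ hτ hτ])
    rw [hδ, map_sub, h1, neg_sub]
  have hneg : ∀ σ, θ σ ≠ 1 → σ δ = -δ := fun σ hσ => by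
    have h1 : (τ * σ) δ = δ := hker _ (by rw [map_mul, hA _ _ hτ hσ])
    have h2 : τ (-(σ δ)) = τ δ := by
      rw [map_neg, hτδ]
      exact congrArg Neg.neg h1
    exact neg_eq_iff_eq_neg.1 (τ.injective h2)
  obtain ⟨q, hq⟩ : δ ^ 2 ∈ Set.range (algebraMap ℚ QBar) := by
    rw [InfiniteGalois.mem_range_algebraMap_iff_fixed]
    intro σ
    by_cases hσ : θ σ = 1
    · rw [map_pow, hker σ hσ]
    · rw [map_pow, hneg σ hσ, neg_sq]
  obtain ⟨N, hN⟩ : IsCyclotomic (q.den * δ) := by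
    refine isCyclotomic_of_sq_eq_int (d := q.den * q.num) ?_
    rw [mul_pow, ← hq]
    have h1 : (q : QBar) * q.den = q.num := by exact_mod_cast Rat.mul_den_eq_num q
    change (q.den : QBar) ^ 2 * (q : QBar) = _
    push_cast
    linear_combination (q.den : QBar) * h1
  refine ⟨N, fun σ hσ => ?_⟩
  by_contra h
  have h1 := hN σ hσ
  rw [map_mul, map_natCast, hneg σ h] at h1
  have h2 := mul_left_cancel₀ (Nat.cast_ne_zero.2 q.den_nz) h1
  exact hδ0 (self_eq_neg.1 h2.symm)

end SerreCurve

/-! ### Units and idempotents of the profinite integers -/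

namespace SerreCurve

lemma reduction_surjective_unit (n : ℕ+) (u : (ZMod n)ˣ) : ∃ x : ZHatˣ, reduction n x = u := by
  obtain ⟨σ, hσ⟩ := cycMod_surjective n u
  exact ⟨cyc σ, hσ⟩

lemma isUnit_of_forall_reduction {x : ZHat} (h : ∀ n, IsUnit (reduction n x)) : IsUnit x := by
  choose u hu using h
  have hy : ∀ (m n : ℕ+) (h : (m : ℕ) ∣ n),
      ZMod.castHom h (ZMod m) (↑(u n)⁻¹ : ZMod n) = (↑(u m)⁻¹ : ZMod m) := by
    intro m n h
    have h1 : Units.map (ZMod.castHom h (ZMod m) : ZMod n →* ZMod m) (u n) = u m := by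
      ext1
      rw [Units.coe_map, hu m, ← castHom_reduction h, ← hu n]
      rfl
    rw [← h1, ← map_inv]
    rfl
  let y : ZHat := ⟨fun n => (↑(u n)⁻¹ : ZMod n), hy⟩
  refine .of_mul_eq_one y (ZHat.ext_reduction fun n => ?_)
  rw [map_mul, ← hu n, map_one]
  exact (u n).mul_inv

/-- The residue of a profinite integer modulo a prime detects whether it is a unit there. -/
lemma isUnit_of_forall_prime {x : ZHat}
    (h : ∀ p : ℕ+, (p : ℕ).Prime → reduction p x ≠ 0) : IsUnit x := by
  refine isUnit_of_forall_reduction fun n => ?_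
  rw [← ZMod.natCast_zmod_val (reduction n x), ZMod.isUnit_iff_coprime]
  refine Nat.coprime_of_dvd fun p hp h1 h2 => ?_
  refine h ⟨p, hp.pos⟩ hp ?_
  rw [← castHom_reduction (m := ⟨p, hp.pos⟩) (n := n) h2, ← ZMod.natCast_zmod_val (reduction n x),
    map_natCast]
  exact (ZMod.natCast_eq_zero_iff _ _).2 h1

lemma reduction_eq_of_dvd {m n : ℕ+} (h : (m : ℕ) ∣ n) {x y : ZHat}
    (hxy : reduction n x = reduction n y) : reduction m x = reduction m y := by
  rw [← castHom_reduction h, hxy, castHom_reduction h]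

lemma reduction_mul_eq_of_coprime {m n : ℕ+} (h : (m : ℕ).Coprime n) {x y : ZHat}
    (hm : reduction m x = reduction m y) (hn : reduction n x = reduction n y) :
    reduction (m * n) x = reduction (m * n) y := by
  have key : ∀ d : ℕ+, (d : ℕ) ∣ (m * n : ℕ+) → reduction d x = reduction d y →
      (reduction (m * n) x).val ≡ (reduction (m * n) y).val [MOD d] := fun d hd hxy => by
    rw [← ZMod.natCast_eq_natCast_iff, ← map_natCast (ZMod.castHom hd (ZMod d)),
      ← map_natCast (ZMod.castHom hd (ZMod d)), ZMod.natCast_zmod_val, ZMod.natCast_zmod_val,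
      castHom_reduction, castHom_reduction, hxy]
  have h1 := (Nat.modEq_and_modEq_iff_modEq_mul h).1
    ⟨key m ⟨n, rfl⟩ hm, key n ⟨m, mul_comm _ _⟩ hn⟩
  rw [← ZMod.natCast_zmod_val (reduction (m * n) x), ← ZMod.natCast_zmod_val (reduction (m * n) y)]
  exact (ZMod.natCast_eq_natCast_iff _ _ _).2 h1

/-- Every positive integer is a power of `p` times an integer prime to `p`. -/
lemma exists_eq_pow_mul {p : ℕ} (hp : p.Prime) (n : ℕ+) :
    ∃ (k : ℕ) (m : ℕ+), ¬ p ∣ m ∧ n = ⟨p ^ k, pow_pos hp.pos k⟩ * m := by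
  refine ⟨n.1.factorization p, ⟨ordCompl[p] n, Nat.ordCompl_pos p n.ne_zero⟩,
    Nat.not_dvd_ordCompl hp n.ne_zero, PNat.eq ?_⟩
  exact (Nat.ordProj_mul_ordCompl_eq_self n p).symm

section Idempotent

variable {p : ℕ}

/-- Equality of profinite integers can be tested on the `p`-part and on the part prime to `p`. -/
lemma ZHat.ext_of_prime (hp : p.Prime) {x y : ZHat}
    (h₁ : ∀ k, reduction ⟨p ^ k, pow_pos hp.pos k⟩ x = reduction ⟨p ^ k, pow_pos hp.pos k⟩ y)
    (h₂ : ∀ m : ℕ+, ¬ p ∣ m → reduction m x = reduction m y) : x = y := by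
  refine ZHat.ext_reduction fun n => ?_
  obtain ⟨k, m, hm, rfl⟩ := exists_eq_pow_mul hp n
  exact reduction_mul_eq_of_coprime (m := ⟨p ^ k, pow_pos hp.pos k⟩)
    (((Nat.Prime.coprime_iff_not_dvd hp).2 hm).pow_left k)
    (h₁ k) (h₂ m hm)

lemma exists_idempotent (hp : p.Prime) : ∃ e : ZHat,
    (∀ k, reduction ⟨p ^ k, pow_pos hp.pos k⟩ e = 1) ∧
      ∀ m : ℕ+, ¬ p ∣ m → reduction m e = 0 := by
  let f : ℕ → ℕ := fun n => (ordCompl[p] n) ^ (ordProj[p] n).totient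
  have hc : ∀ n : ℕ+, (ordProj[p] n).Coprime (ordCompl[p] n) := fun n =>
    (Nat.coprime_ordCompl hp n.ne_zero).pow_left _
  have h1 : ∀ n : ℕ+, f n ≡ 1 [MOD ordProj[p] n] := fun n => Nat.ModEq.pow_totient (hc n).symm
  have h0 : ∀ n : ℕ+, f n ≡ 0 [MOD ordCompl[p] n] := fun n =>
    (Nat.modEq_zero_iff_dvd).2 (dvd_pow_self _ (Nat.totient_pos.2 (Nat.ordProj_pos _ _)).ne')
  refine ⟨⟨fun n => (f n : ZMod n), fun m n h => ?_⟩, fun k => ?_, fun m hm => ?_⟩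
  · rw [map_natCast, ZMod.natCast_eq_natCast_iff]
    have key : f n ≡ f m [MOD ordProj[p] m * ordCompl[p] m] :=
      (Nat.modEq_and_modEq_iff_modEq_mul (hc m)).1
        ⟨((h1 n).of_dvd (Nat.ordProj_dvd_ordProj_of_dvd n.ne_zero h p)).trans (h1 m).symm,
          ((h0 n).of_dvd (Nat.ordCompl_dvd_ordCompl_of_dvd h p)).trans (h0 m).symm⟩
    rwa [Nat.ordProj_mul_ordCompl_eq_self] at key
  · change ((f (p ^ k) : ℕ) : ZMod (p ^ k)) = 1
    have : f (p ^ k) = 1 := by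
      simp only [f, hp.factorization_pow, Finsupp.single_eq_same]
      rw [Nat.div_self (pow_pos hp.pos k), one_pow]
    rw [this, Nat.cast_one]
  · change ((f m : ℕ) : ZMod m) = 0
    have : f m = m := by
      simp only [f, Nat.factorization_eq_zero_of_not_dvd hm, pow_zero, Nat.div_one,
        Nat.totient_one, pow_one]
    rw [this, ZMod.natCast_self]

/-- The idempotent of `Ẑ = ∏ ℤ_ℓ` that is one in `ℤ_p` and zero in the other factors. -/
def idem (hp : p.Prime) : ZHat := (exists_idempotent hp).choose

variable (hp : p.Prime)

lemma reduction_pow_idem (k : ℕ) : reduction ⟨p ^ k, pow_pos hp.pos k⟩ (idem hp) = 1 :=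
  (exists_idempotent hp).choose_spec.1 k

lemma reduction_idem_self : reduction ⟨p, hp.pos⟩ (idem hp) = 1 :=
  reduction_eq_of_dvd (y := 1) (n := ⟨p ^ 1, pow_pos hp.pos 1⟩) (by simp)
    (by rw [reduction_pow_idem, map_one]) |>.trans (map_one _)

lemma reduction_idem_of_not_dvd {m : ℕ+} (hm : ¬ p ∣ m) : reduction m (idem hp) = 0 :=
  (exists_idempotent hp).choose_spec.2 m hm

lemma isIdempotentElem_idem : IsIdempotentElem (idem hp) :=
  ZHat.ext_of_prime hp (fun k => by rw [map_mul, reduction_pow_idem, one_mul])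
    fun m hm => by rw [map_mul, reduction_idem_of_not_dvd hp hm, zero_mul]

lemma isUnit_idem_add {a : ZHat} (ha : reduction ⟨p, hp.pos⟩ a ≠ 0) :
    IsUnit (1 - idem hp + idem hp * a) := by
  refine isUnit_of_forall_prime fun q hq => ?_
  by_cases hqp : p = q
  · obtain rfl : q = ⟨p, hp.pos⟩ := PNat.eq hqp.symm
    rw [map_add, map_sub, map_mul, reduction_idem_self, map_one, sub_self, zero_add, one_mul]
    exact ha
  · have : ¬ p ∣ q := fun h => hqp ((Nat.prime_dvd_prime_iff_eq hp hq).1 h)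
    have : Fact (q : ℕ).Prime := ⟨hq⟩
    rw [map_add, map_sub, map_mul, reduction_idem_of_not_dvd hp ‹_›, map_one, sub_zero, zero_mul,
      add_zero]
    exact one_ne_zero

end Idempotent

end SerreCurve

/-! ### Elementary matrices and localization at an idempotent -/

namespace SerreCurve

open scoped commutatorElement

section Matrices

variable {R : Type*} [CommRing R]

/-- The upper unitriangular matrix with entry `t`. -/
def upper (t : R) : GL (Fin 2) R where
  val := !![1, t; 0, 1]
  inv := !![1, -t; 0, 1]
  val_inv := by simp [Matrix.one_fin_two]
  inv_val := by simp [Matrix.one_fin_two]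

/-- The lower unitriangular matrix with entry `t`. -/
def lower (t : R) : GL (Fin 2) R where
  val := !![1, 0; t, 1]
  inv := !![1, 0; -t, 1]
  val_inv := by simp [Matrix.one_fin_two]
  inv_val := by simp [Matrix.one_fin_two]

/-- The diagonal matrix with entries `a` and `d`. -/
def diag (a d : Rˣ) : GL (Fin 2) R where
  val := !![(a : R), 0; 0, (d : R)]
  inv := !![((a⁻¹ : Rˣ) : R), 0; 0, ((d⁻¹ : Rˣ) : R)]
  val_inv := by simp [Matrix.one_fin_two]
  inv_val := by simp [Matrix.one_fin_two]

/-- The permutation matrix of the transposition. -/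
def swap : GL (Fin 2) R where
  val := !![0, 1; 1, 0]
  inv := !![0, 1; 1, 0]
  val_inv := by simp [Matrix.one_fin_two]
  inv_val := by simp [Matrix.one_fin_two]

lemma coe_upper (t : R) : (upper t : Matrix (Fin 2) (Fin 2) R) = !![1, t; 0, 1] := rfl
lemma coe_lower (t : R) : (lower t : Matrix (Fin 2) (Fin 2) R) = !![1, 0; t, 1] := rfl
lemma coe_diag (a d : Rˣ) :
    (diag a d : Matrix (Fin 2) (Fin 2) R) = !![(a : R), 0; 0, (d : R)] := rfl
lemma coe_swap : ((swap : GL (Fin 2) R) : Matrix (Fin 2) (Fin 2) R) = !![0, 1; 1, 0] := rfl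

lemma upper_add (s t : R) : upper (s + t) = upper s * upper t := by
  rw [Units.ext_iff, Units.val_mul]
  simp [coe_upper, add_comm]

lemma upper_inv (t : R) : (upper t)⁻¹ = upper (-t) := by
  rw [inv_eq_iff_mul_eq_one, ← upper_add, add_neg_cancel, Units.ext_iff]
  simp [coe_upper, Matrix.one_fin_two]

lemma lower_add (s t : R) : lower (s + t) = lower s * lower t := by
  rw [Units.ext_iff, Units.val_mul]
  simp [coe_lower]

lemma lower_inv (t : R) : (lower t)⁻¹ = lower (-t) := by
  rw [inv_eq_iff_mul_eq_one, ← lower_add, add_neg_cancel, Units.ext_iff]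
  simp [coe_lower, Matrix.one_fin_two]

open Matrix.GeneralLinearGroup in
lemma det_upper (t : R) : det (upper t) = 1 := by
  ext; simp [coe_upper, Matrix.det_fin_two]

open Matrix.GeneralLinearGroup in
lemma det_lower (t : R) : det (lower t) = 1 := by
  ext; simp [coe_lower, Matrix.det_fin_two]

open Matrix.GeneralLinearGroup in
lemma det_diag (a d : Rˣ) : det (diag a d) = a * d := by
  ext; simp [coe_diag, Matrix.det_fin_two]

lemma coe_det (g : GL (Fin 2) R) : (Matrix.GeneralLinearGroup.det g : R) =
    g 0 0 * g 1 1 - g 0 1 * g 1 0 := Matrix.det_fin_two _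

/-- A commutator is computed by moving the inverses to the other side. -/
lemma commutatorElement_eq_of_mul_eq {G : Type*} [Group G] {a b c : G} (h : a * b = c * (b * a)) :
    ⁅a, b⁆ = c := by
  rw [commutatorElement_def, h]; group

lemma commutator_diag_upper (a d : Rˣ) (t s : R) (hs : s * d = a * t - t * d) :
    ⁅diag a d, upper t⁆ = upper s := by
  refine commutatorElement_eq_of_mul_eq ?_
  rw [Units.ext_iff, Units.val_mul, Units.val_mul, Units.val_mul]
  simp only [coe_upper, coe_diag, Matrix.mul_fin_two]
  ext i j
  fin_cases i <;> fin_cases j <;> simp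
  linear_combination -hs

end Matrices

section Loc

variable {R : Type*} [CommRing R]

/-- For an idempotent `e`, the matrix that agrees with `g` on the part of `e` and with the identity
on the part of `1 - e`. -/
def loc {e : R} (he : IsIdempotentElem e) : GL (Fin 2) R →* GL (Fin 2) R :=
  Units.map
    { toFun := fun x => (1 - e) • (1 : Matrix (Fin 2) (Fin 2) R) + e • x
      map_one' := by rw [← add_smul, sub_add_cancel, one_smul]
      map_mul' := fun x y => by
        have h1 : (1 - e) * (1 - e) = 1 - e := he.one_sub
        have h2 : e * (1 - e) = 0 := he.mul_one_sub_self
        simp only [mul_add, add_mul, Algebra.mul_smul_comm, Algebra.smul_mul_assoc, one_mul, mul_one,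
          smul_smul, smul_add, h1, h2, mul_comm (1 - e) e, zero_smul, add_zero, zero_add,
          he.eq] }

variable {e : R} (he : IsIdempotentElem e)

lemma coe_loc (g : GL (Fin 2) R) : (loc he g : Matrix (Fin 2) (Fin 2) R) =
    (1 - e) • (1 : Matrix (Fin 2) (Fin 2) R) + e • (g : Matrix (Fin 2) (Fin 2) R) := rfl

lemma coe_loc' (g : GL (Fin 2) R) : (loc he g : Matrix (Fin 2) (Fin 2) R) =
    !![1 - e + e * g 0 0, e * g 0 1; e * g 1 0, 1 - e + e * g 1 1] := by
  rw [coe_loc]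
  ext i j
  fin_cases i <;> fin_cases j <;> simp

lemma loc_upper (t : R) : loc he (upper t) = upper (e * t) := by
  rw [Units.ext_iff, coe_loc']
  simp [coe_upper]

lemma loc_lower (t : R) : loc he (lower t) = lower (e * t) := by
  rw [Units.ext_iff, coe_loc']
  simp [coe_lower]

lemma coe_det_loc (g : GL (Fin 2) R) : (Matrix.GeneralLinearGroup.det (loc he g) : R) =
    1 - e + e * Matrix.GeneralLinearGroup.det g := by
  have h : e * e = e := he
  rw [coe_det, coe_det, coe_loc']
  simp
  linear_combination (1 - g 0 0 - g 1 1 + g 0 0 * g 1 1 - g 0 1 * g 1 0) * h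

lemma det_loc_of_det_eq_one {g : GL (Fin 2) R} (hg : Matrix.GeneralLinearGroup.det g = 1) :
    Matrix.GeneralLinearGroup.det (loc he g) = 1 := by
  ext
  rw [coe_det_loc, hg]
  simp

lemma loc_mul_loc_one_sub (g : GL (Fin 2) R) : loc he g * loc he.one_sub g = g := by
  have h1 : (1 - e) * e = 0 := he.one_sub_mul_self
  have h2 : e * (1 - e) = 0 := he.mul_one_sub_self
  rw [Units.ext_iff, Units.val_mul, coe_loc, coe_loc, sub_sub_cancel]
  simp only [mul_add, add_mul, Algebra.mul_smul_comm, Algebra.smul_mul_assoc, one_mul, mul_one,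
    smul_smul, smul_add, h1, h2, zero_smul, add_zero, zero_add, he.eq, he.one_sub.eq]
  rw [← add_smul, add_sub_cancel, one_smul]

lemma commute_loc (g h : GL (Fin 2) R) : Commute (loc he.one_sub g) (loc he h) := by
  have h1 : (1 - e) * e = 0 := he.one_sub_mul_self
  have h2 : e * (1 - e) = 0 := he.mul_one_sub_self
  rw [Commute, SemiconjBy, Units.ext_iff, Units.val_mul, Units.val_mul, coe_loc, coe_loc,
    sub_sub_cancel]
  simp only [mul_add, add_mul, Algebra.mul_smul_comm, Algebra.smul_mul_assoc, one_mul, mul_one,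
    smul_smul, smul_add, h1, h2, zero_smul, add_zero, zero_add, he.eq, he.one_sub.eq]
  abel

lemma loc_loc (g : GL (Fin 2) R) : loc he (loc he g) = loc he g := by
  rw [Units.ext_iff, coe_loc, coe_loc, smul_add, smul_smul, smul_smul, he.eq, he.mul_one_sub_self,
    zero_smul, zero_add]

/-- A commutator with a localized matrix only depends on the localization of the other matrix. -/
lemma commutator_loc (g h : GL (Fin 2) R) : ⁅g, loc he h⁆ = loc he ⁅g, h⁆ := by
  have h1 := commute_loc he g h
  refine commutatorElement_eq_of_mul_eq ?_
  conv_lhs => rw [← loc_mul_loc_one_sub he g, mul_assoc, h1.eq]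
  conv_rhs => rw [← loc_mul_loc_one_sub he g]
  simp only [commutatorElement_def, map_mul, map_inv, loc_loc]
  have h2 : loc he (loc he.one_sub g) = 1 := by
    rw [Units.ext_iff, coe_loc, coe_loc, smul_add, smul_smul, smul_smul, he.mul_one_sub_self,
      sub_sub_cancel, he.eq, zero_smul, add_zero, ← add_smul, sub_add_cancel, one_smul]
    rfl
  rw [h2]
  group

/-- The Gauss decomposition of a localized matrix of determinant one. -/
lemma loc_eq_mul {g : GL (Fin 2) R} (hg : Matrix.GeneralLinearGroup.det g = 1) (a : Rˣ)
    (ha : (a : R) = 1 - e + e * g 0 0) :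
    loc he g = lower (e * (g 1 0 * (a⁻¹ : Rˣ))) * loc he (diag a a⁻¹) *
      upper (e * (g 0 1 * (a⁻¹ : Rˣ))) := by
  have h : e * e = e := he
  have hd := coe_det g
  rw [hg, Units.val_one] at hd
  have hu : (a : R) * (a⁻¹ : Rˣ) = 1 := a.mul_inv
  have hea : e * (a : R) = e * g 0 0 := by rw [ha]; linear_combination (g 0 0 - 1) * h
  rw [Units.ext_iff, Units.val_mul, Units.val_mul, coe_loc', coe_loc', coe_lower, coe_upper,
    coe_diag]
  ext i j
  fin_cases i <;> fin_cases j <;> simp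
  · linear_combination -hea
  · linear_combination -(e * g 0 1) * hu + (1 - a) * g 0 1 * (a⁻¹ : Rˣ) * h
  · linear_combination -(e * g 1 0) * hu + (1 - a) * g 1 0 * (a⁻¹ : Rˣ) * h
  · linear_combination -(e * g 1 1) * hu + (a⁻¹ : Rˣ) * g 1 1 * hea - (a⁻¹ : Rˣ) * e * hd -
      e * (a⁻¹ : Rˣ) * g 1 0 * g 0 1 * hu - (-e + e * a + a) * g 1 0 * g 0 1 * ((a⁻¹ : Rˣ) : R) ^ 2 * h

end Loc

end SerreCurve

/-! ### Levels and agreeable groups -/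

namespace SerreCurve

open scoped commutatorElement
open Matrix.GeneralLinearGroup (det scalar)

/-- `SL₂(Ẑ)` as a subgroup of `GL₂(Ẑ)`. -/
abbrev SLHat : Subgroup (GL (Fin 2) ZHat) := (det : GL (Fin 2) ZHat →* ZHatˣ).ker

lemma redGL_eq_iff {n : ℕ+} {g h : GL (Fin 2) ZHat} :
    redGL n g = redGL n h ↔ ∀ i j, reduction n (g i j) = reduction n (h i j) := by
  rw [Units.ext_iff, ← Matrix.ext_iff]
  rfl

lemma redGL_mul_eq_of_coprime {m n : ℕ+} (h : (m : ℕ).Coprime n) {g₁ g₂ : GL (Fin 2) ZHat}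
    (hm : redGL m g₁ = redGL m g₂) (hn : redGL n g₁ = redGL n g₂) :
    redGL (m * n) g₁ = redGL (m * n) g₂ := by
  rw [redGL_eq_iff] at *
  exact fun i j => reduction_mul_eq_of_coprime h (hm i j) (hn i j)

lemma redGL_eq_of_dvd {m n : ℕ+} (h : (m : ℕ) ∣ n) {g₁ g₂ : GL (Fin 2) ZHat}
    (hn : redGL n g₁ = redGL n g₂) : redGL m g₁ = redGL m g₂ := by
  rw [redGL_eq_iff] at *
  exact fun i j => reduction_eq_of_dvd h (hn i j)

section Loc

variable {e : ZHat} (he : IsIdempotentElem e) {n : ℕ+}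

lemma redGL_loc_of_eq_zero (h : reduction n e = 0) (g : GL (Fin 2) ZHat) :
    redGL n (loc he g) = 1 := by
  rw [← map_one (redGL n), redGL_eq_iff]
  intro i j
  rw [coe_loc]
  simp [h]

lemma redGL_loc_of_eq_one (h : reduction n e = 1) (g : GL (Fin 2) ZHat) :
    redGL n (loc he g) = redGL n g := by
  rw [redGL_eq_iff]
  intro i j
  rw [coe_loc]
  simp [h]

end Loc

/-- The level of `H` relative to a group `K`: the smallest positive integer `n` such that `H` contains
the kernel of reduction modulo `n` on `K`, or zero if there is none. -/
def lev (K H : Subgroup (GL (Fin 2) ZHat)) : ℕ :=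
  sInf {n : ℕ | ∃ h : 0 < n, K ⊓ (redGL ⟨n, h⟩).ker ≤ H}

lemma levelGL_eq_lev (H : Subgroup (GL (Fin 2) ZHat)) : levelGL H = lev ⊤ H := by
  simp only [levelGL, lev, top_inf_eq]

lemma levelSL_eq_lev (H : Subgroup (GL (Fin 2) ZHat)) : levelSL (interSL H) = lev SLHat H := by
  have key : ∀ n : ℕ+, (redSL n).ker ≤ interSL H ↔ SLHat ⊓ (redGL n).ker ≤ H := fun n => by
    constructor
    · rintro h g ⟨hg, hg'⟩
      have hd : (g : Matrix (Fin 2) (Fin 2) ZHat).det = 1 := congrArg Units.val hg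
      let s : Matrix.SpecialLinearGroup (Fin 2) ZHat := ⟨g, hd⟩
      have hs : s ∈ (redSL n).ker := by
        change redSL n s = 1
        ext i j
        exact congrArg (fun x : GL (Fin 2) (ZMod n) => x i j) hg'
      have h1 : Matrix.SpecialLinearGroup.toGL s ∈ H := h hs
      have h2 : Matrix.SpecialLinearGroup.toGL s = g := Units.ext rfl
      exact h2 ▸ h1
    · intro h g hg
      refine h ⟨Matrix.SpecialLinearGroup.coeToGL_det g, ?_⟩
      refine Units.ext ?_
      ext i j
      exact congrArg (fun x : Matrix.SpecialLinearGroup (Fin 2) (ZMod n) => x i j) hg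
  exact congrArg sInf (Set.ext fun n => exists_congr fun h => key ⟨n, h⟩)

section Lev

variable {K H : Subgroup (GL (Fin 2) ZHat)}

lemma lev_spec (h : ∃ n : ℕ+, K ⊓ (redGL n).ker ≤ H) :
    ∃ h : 0 < lev K H, K ⊓ (redGL ⟨lev K H, h⟩).ker ≤ H :=
  Nat.sInf_mem (s := {n : ℕ | ∃ h : 0 < n, K ⊓ (redGL ⟨n, h⟩).ker ≤ H})
    (by obtain ⟨n, hn⟩ := h; exact ⟨n, n.pos, hn⟩)

lemma lev_le (n : ℕ+) (h : K ⊓ (redGL n).ker ≤ H) : lev K H ≤ n := Nat.sInf_le ⟨n.pos, h⟩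

/-- A prime does not divide the level if and only if the group contains the full factor at this
prime. -/
lemma not_dvd_lev_iff {p : ℕ} (hp : p.Prime)
    (hK : ∀ g ∈ K, loc (isIdempotentElem_idem hp) g ∈ K) (h : ∃ n : ℕ+, K ⊓ (redGL n).ker ≤ H) :
    ¬ p ∣ lev K H ↔ ∀ g ∈ K, loc (isIdempotentElem_idem hp) g ∈ H := by
  obtain ⟨hpos, hle⟩ := lev_spec h
  constructor
  · intro hd g hg
    exact hle ⟨hK g hg, redGL_loc_of_eq_zero _ (reduction_idem_of_not_dvd hp (m := ⟨lev K H, hpos⟩) hd) g⟩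
  · intro hg hd
    obtain ⟨k, m, hm, hn⟩ := exists_eq_pow_mul hp ⟨lev K H, hpos⟩
    have hn' : lev K H = p ^ k * m := congrArg PNat.val hn
    have hk : k ≠ 0 := by
      rintro rfl
      rw [pow_zero, one_mul] at hn'
      exact hm (hn' ▸ hd)
    have h1 : lev K H ≤ m := by
      refine lev_le m fun g ⟨hgK, hgm⟩ => ?_
      set e := idem hp
      have he := isIdempotentElem_idem hp
      rw [← loc_mul_loc_one_sub he g]
      refine mul_mem (hg g hgK) (hle ⟨?_, ?_⟩)
      · have := mul_mem (inv_mem (hK g hgK)) hgK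
        conv at this => enter [2, 2]; rw [← loc_mul_loc_one_sub he g]
        rwa [inv_mul_cancel_left] at this
      · rw [hn]
        change redGL _ _ = 1
        rw [← map_one (redGL _)]
        have h0 := redGL_loc_of_eq_zero he.one_sub (n := ⟨p ^ k, pow_pos hp.pos k⟩)
          (by rw [map_sub, map_one, reduction_pow_idem hp k, sub_self]) g
        refine redGL_mul_eq_of_coprime (m := ⟨p ^ k, pow_pos hp.pos k⟩)
          (((Nat.Prime.coprime_iff_not_dvd hp).2 hm).pow_left k) (h0.trans (map_one _).symm) ?_
        · rw [redGL_loc_of_eq_one _ (by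
            rw [map_sub, map_one, reduction_idem_of_not_dvd hp hm, sub_zero]), map_one]
          exact hgm
    have h2 : 2 ≤ p ^ k := hp.two_le.trans (Nat.le_self_pow hk p)
    have h3 := m.pos
    nlinarith

end Lev

/-! ### Generation by elementary matrices -/

/-- The lemma of Whitehead. -/
lemma diag_inv_eq {R : Type*} [CommRing R] (a : Rˣ) : diag a a⁻¹ =
    upper (a : R) * lower (-(a⁻¹ : Rˣ) : R) * upper (a : R) *
      (upper (-1) * lower 1 * upper (-1)) := by
  rw [Units.ext_iff]
  simp only [Units.val_mul, coe_diag, coe_upper, coe_lower, Matrix.mul_fin_two]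
  ext i j
  fin_cases i <;> fin_cases j <;> simp

lemma loc_diag_inv_mem {R : Type*} [CommRing R] {e : R} (he : IsIdempotentElem e)
    {K : Subgroup (GL (Fin 2) R)} (hu : ∀ t, upper (e * t) ∈ K) (hl : ∀ t, lower (e * t) ∈ K)
    (a : Rˣ) : loc he (diag a a⁻¹) ∈ K := by
  rw [diag_inv_eq]
  simp only [map_mul, loc_upper, loc_lower]
  exact mul_mem (mul_mem (mul_mem (hu _) (hl _)) (hu _)) (mul_mem (mul_mem (hu _) (hl _)) (hu _))

lemma loc_mem_of_elementary {p : ℕ} (hp : p.Prime) {K : Subgroup (GL (Fin 2) ZHat)}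
    (hu : ∀ t, upper (idem hp * t) ∈ K) (hl : ∀ t, lower (idem hp * t) ∈ K)
    {g : GL (Fin 2) ZHat} (hg : det g = 1) : loc (isIdempotentElem_idem hp) g ∈ K := by
  have he := isIdempotentElem_idem hp
  have key : ∀ {g : GL (Fin 2) ZHat}, det g = 1 → reduction ⟨p, hp.pos⟩ (g 0 0) ≠ 0 →
      loc he g ∈ K := fun {g} hg h => by
    obtain ⟨a, ha⟩ := isUnit_idem_add hp h
    rw [loc_eq_mul he hg a ha]
    exact mul_mem (mul_mem (hl _) (loc_diag_inv_mem he hu hl a)) (hu _)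
  by_cases h : reduction ⟨p, hp.pos⟩ (g 0 0) = 0
  · have h1 := key (g := upper 1 * g) (by rw [map_mul, det_upper, hg, one_mul]) (by
      rw [Units.val_mul, coe_upper, Matrix.mul_apply, Fin.sum_univ_two]
      simp only [Matrix.of_apply, Matrix.cons_val_zero, Matrix.cons_val_one, one_mul, map_add, h,
        zero_add]
      intro h0
      have := coe_det g
      rw [hg, Units.val_one] at this
      have h2 := congrArg (reduction ⟨p, hp.pos⟩) this
      rw [map_one, map_sub, map_mul, map_mul, h, h0, zero_mul, mul_zero, sub_zero] at h2
      have : Fact (1 < p) := ⟨hp.one_lt⟩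
      exact one_ne_zero (α := ZMod p) h2)
    rw [map_mul, loc_upper] at h1
    exact (Subgroup.mul_mem_cancel_left K (hu 1)).1 h1
  · exact key hg h

/-! ### The agreeable group attached to an open group -/

/-- The group generated by `U`, the scalars and the kernel of reduction modulo `n`. -/
def hull (U : Subgroup (GL (Fin 2) ZHat)) (n : ℕ+) : Subgroup (GL (Fin 2) ZHat) :=
  (((scalar (Fin 2) : ZHatˣ →* GL (Fin 2) ZHat).range ⊔ U).map (redGL n)).comap (redGL n)

section Hull

variable {U : Subgroup (GL (Fin 2) ZHat)} {n : ℕ+}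

lemma le_hull : U ≤ hull U n := le_sup_right.trans (Subgroup.le_comap_map _ _)

lemma scalar_mem_hull (a : ZHatˣ) : scalar (Fin 2) a ∈ hull U n :=
  (le_sup_left.trans (Subgroup.le_comap_map _ _) : _ ≤ hull U n) ⟨a, rfl⟩

lemma ker_le_hull : (redGL n).ker ≤ hull U n := fun g hg => by
  rw [hull, Subgroup.mem_comap, MonoidHom.mem_ker.1 hg]
  exact one_mem _

/-- Commutators do not see the scalars. -/
lemma commutator_mem_of_mem_hull (hU : SLHat ⊓ (redGL n).ker ≤ U) {g h : GL (Fin 2) ZHat}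
    (hg : g ∈ hull U n) (hh : h ∈ hull U n) : ⁅g, h⁆ ∈ U := by
  have hs : ∀ (a : ZHatˣ) (x : GL (Fin 2) ZHat), Commute (scalar (Fin 2) a) x := fun a x =>
    Matrix.GeneralLinearGroup.scalar_commute a x
  have key : ∀ x ∈ hull U n, ∃ a : ZHatˣ, ∃ u ∈ U,
      redGL n x = redGL n (scalar (Fin 2) a * u) := by
    rintro x ⟨y, hy, hyx⟩
    have hy' : y ∈ (scalar (Fin 2) : ZHatˣ →* GL (Fin 2) ZHat).range ⊔ U := hy
    have : (scalar (Fin 2) : ZHatˣ →* GL (Fin 2) ZHat).range.Normal :=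
      ⟨by rintro _ ⟨a, rfl⟩ x; exact ⟨a, by rw [← (hs a x).eq, mul_inv_cancel_right]⟩⟩
    obtain ⟨_, ⟨a, rfl⟩, u, hu, rfl⟩ := Subgroup.mem_sup_of_normal_left.1 hy'
    exact ⟨a, u, hu, hyx.symm⟩
  obtain ⟨a, u, hu, h1⟩ := key g hg
  obtain ⟨b, v, hv, h2⟩ := key h hh
  have h3 : redGL n ⁅g, h⁆ = redGL n ⁅u, v⁆ := by
    rw [map_commutatorElement, h1, h2, ← map_commutatorElement]
    congr 1
    have e1 : (scalar (Fin 2) a * u) * (scalar (Fin 2) b * v) =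
        scalar (Fin 2) a * scalar (Fin 2) b * (u * v) := by
      rw [mul_assoc, ← mul_assoc u, ← (hs b u).eq]; simp only [mul_assoc]
    have e2 : (scalar (Fin 2) b * v) * (scalar (Fin 2) a * u) =
        scalar (Fin 2) a * scalar (Fin 2) b * (v * u) := by
      rw [mul_assoc, ← mul_assoc v, ← (hs a v).eq, ← mul_assoc, ← mul_assoc, (hs b _).eq]
      simp only [mul_assoc]
    refine commutatorElement_eq_of_mul_eq ?_
    rw [e1, e2, ← mul_assoc ⁅u, v⁆, ← ((hs a ⁅u, v⁆).mul_left (hs b ⁅u, v⁆)).eq, mul_assoc,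
      mul_assoc, mul_assoc]
    simp [commutatorElement_def]
  have h4 : ⁅g, h⁆ * ⁅u, v⁆⁻¹ ∈ U := hU ⟨by
    change det _ = 1
    rw [map_mul, map_inv, map_commutatorElement, map_commutatorElement]
    simp [commutatorElement_def], by
    change redGL n _ = 1
    rw [map_mul, map_inv, h3, mul_inv_cancel]⟩
  exact (Subgroup.mul_mem_cancel_right U (inv_mem (by
    rw [commutatorElement_def]
    exact mul_mem (mul_mem (mul_mem hu hv) (inv_mem hu)) (inv_mem hv)))).1 h4

end Hull

end SerreCurve

/-! ### Commutators of the agreeable closure -/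

namespace SerreCurve

open scoped commutatorElement
open Matrix.GeneralLinearGroup (det scalar)

lemma commutator_diag_lower {R : Type*} [CommRing R] (a d : Rˣ) (t s : R)
    (hs : s * a = d * t - t * a) : ⁅diag a d, lower t⁆ = lower s := by
  refine commutatorElement_eq_of_mul_eq ?_
  rw [Units.ext_iff, Units.val_mul, Units.val_mul, Units.val_mul]
  simp only [coe_lower, coe_diag, Matrix.mul_fin_two]
  ext i j
  fin_cases i <;> fin_cases j <;> simp
  linear_combination -hs

section Hull

variable {U : Subgroup (GL (Fin 2) ZHat)} {n : ℕ+}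

/-- If the hull of `U` contains the `p`-part of `SL₂(Ẑ)` for an odd prime `p`, then so does `U`:
the matrices `diag 2 1` at `p` are available, and their commutators with elementary matrices give
all elementary matrices. -/
theorem loc_mem_of_loc_mem_hull {p : ℕ} (hp : p.Prime) (hp2 : p ≠ 2) (hdet : U.map det = ⊤)
    (hU : SLHat ⊓ (redGL n).ker ≤ U)
    (hloc : ∀ x ∈ SLHat, loc (isIdempotentElem_idem hp) x ∈ hull U n) :
    ∀ x ∈ SLHat, loc (isIdempotentElem_idem hp) x ∈ U := by
  have he := isIdempotentElem_idem hp
  have he' : idem hp * idem hp = idem hp := he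
  have h2 : reduction ⟨p, hp.pos⟩ 2 ≠ 0 := by
    rw [map_ofNat]
    intro h
    have h' : ((2 : ℕ) : ZMod p) = 0 := by exact_mod_cast h
    rw [ZMod.natCast_eq_zero_iff] at h'
    exact hp2 ((Nat.prime_dvd_prime_iff_eq hp Nat.prime_two).1 h')
  obtain ⟨w, hw⟩ := isUnit_idem_add hp h2
  obtain ⟨h, hhU, hh⟩ : w ∈ U.map det := hdet ▸ Subgroup.mem_top w
  set D : GL (Fin 2) ZHat := diag w 1
  have hD : loc he D = D := by
    have h1 : 1 - idem hp + idem hp * D 0 0 = w := by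
      change 1 - idem hp + idem hp * w = w
      rw [hw]
      linear_combination he'
    have h2 : 1 - idem hp + idem hp * D 1 1 = 1 := by
      change 1 - idem hp + idem hp * 1 = 1
      ring
    rw [Units.ext_iff, coe_loc', h1, h2]
    simp [D, coe_diag]
  have hdl : det (loc he h) = w := by
    rw [Units.ext_iff, coe_det_loc, hh, hw]
    linear_combination he'
  set y := (loc he h)⁻¹ * D with hy
  have hly : loc he y = y := by rw [hy, map_mul, map_inv, loc_loc, hD]
  have hyH : y ∈ hull U n := by
    rw [← hly]
    refine hloc y ?_
    rw [MonoidHom.mem_ker, hy, map_mul, map_inv, hdl, det_diag, mul_one, inv_mul_cancel]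
  have hlD : loc he (h * y) = D := by rw [map_mul, hly, hy, mul_inv_cancel_left]
  have key : ∀ x ∈ SLHat, ⁅D, loc he x⁆ ∈ U := fun x hx => by
    have := commutator_mem_of_mem_hull hU (mul_mem (le_hull hhU) hyH) (hloc x hx)
    rwa [← loc_loc he x, commutator_loc, map_commutatorElement, hlD, loc_loc] at this
  refine fun x hx => loc_mem_of_elementary hp (fun t => ?_) (fun t => ?_) hx
  · have h1 := key (upper t) (det_upper t)
    rwa [loc_upper, commutator_diag_upper w 1 _ (idem hp * t)] at h1
    rw [hw, Units.val_one]
    linear_combination -t * he'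
  · have h1 := key (lower (-2 * t)) (det_lower _)
    rwa [loc_lower, commutator_diag_lower w 1 _ (idem hp * t)] at h1
    rw [hw, Units.val_one]
    linear_combination -t * he'

lemma isOpen_ker_redGL (n : ℕ+) : IsOpen ((redGL n).ker : Set (GL (Fin 2) ZHat)) := by
  have hc : ∀ i j, Continuous fun g : GL (Fin 2) ZHat => reduction n (g i j) := fun i j =>
    (continuous_apply n).comp (continuous_subtype_val.comp
      (Units.continuous_val.matrix_elem i j))
  have : ((redGL n).ker : Set (GL (Fin 2) ZHat)) =
      ⋂ i, ⋂ j, {g | reduction n (g i j) = reduction n ((1 : GL (Fin 2) ZHat) i j)} := by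
    ext g
    simp only [Set.mem_iInter, Set.mem_ofPred_eq, ← redGL_eq_iff, map_one]
    rfl
  rw [this]
  exact isOpen_iInter_of_finite fun i => isOpen_iInter_of_finite fun j =>
    (isOpen_discrete {reduction n ((1 : GL (Fin 2) ZHat) i j)}).preimage (hc i j)

lemma isOpen_of_ker_le {H : Subgroup (GL (Fin 2) ZHat)} (h : (redGL n).ker ≤ H) :
    IsOpen (H : Set (GL (Fin 2) ZHat)) :=
  Subgroup.isOpen_mono h (isOpen_ker_redGL n)

/-- The condition on odd primes in the definition of agreeable groups: the group contains the factor
of `GL₂(Ẑ)` at `p` as soon as it contains that of `SL₂(Ẑ)`. -/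
lemma odd_primes_iff {H : Subgroup (GL (Fin 2) ZHat)} (h : (redGL n).ker ≤ H)
    {p : ℕ} (hp : p.Prime) : (p ∣ levelGL H ↔ p ∣ levelSL (interSL H)) ↔
      ((∀ x ∈ SLHat, loc (isIdempotentElem_idem hp) x ∈ H) →
        ∀ x, loc (isIdempotentElem_idem hp) x ∈ H) := by
  have h1 := not_dvd_lev_iff hp (K := ⊤) (H := H) (fun _ _ => Subgroup.mem_top _)
    ⟨n, inf_le_right.trans h⟩
  have h2 := not_dvd_lev_iff hp (K := SLHat) (H := H)
    (fun g hg => det_loc_of_det_eq_one _ hg) ⟨n, inf_le_right.trans h⟩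
  rw [levelGL_eq_lev, levelSL_eq_lev, ← not_iff_not (a := p ∣ _), h1, h2]
  exact ⟨fun h h' x => h.2 h' x (Subgroup.mem_top _), fun h => ⟨fun h' x _ =>
    h' x (Subgroup.mem_top _), fun h' x _ => h h' x⟩⟩

/-- The hull of a group `U`, taken at the level `n` of `U ∩ SL₂(Ẑ)`, is agreeable: an odd prime that does
not divide the level of its intersection with `SL₂(Ẑ)` does not divide `n`, hence does not divide the
level of the hull. -/
theorem isAgreeable_hull (hdet : U.map det = ⊤) (hn : lev SLHat U = n)
    (hU : SLHat ⊓ (redGL n).ker ≤ U) : IsAgreeable (hull U n) where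
  isOpen := isOpen_of_ker_le ker_le_hull
  det_full := top_le_iff.1 (hdet.ge.trans (Subgroup.map_mono le_hull))
  scalar_mem := scalar_mem_hull
  odd_primes p hp hp2 := by
    rw [odd_primes_iff ker_le_hull hp]
    intro h x
    have h1 := (not_dvd_lev_iff hp (fun g hg => det_loc_of_det_eq_one _ hg) ⟨n, hU⟩).2
      (loc_mem_of_loc_mem_hull hp hp2 hdet hU h)
    rw [hn] at h1
    exact ker_le_hull (redGL_loc_of_eq_zero _ (reduction_idem_of_not_dvd hp h1) x)

/-- Commutators of elements of the agreeable closure of a group are contained in all open groups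
that contain the group. If the agreeable closure contains the factors of `SL₂(Ẑ)` at all odd primes,
then so do these open groups. -/
theorem commutator_mem_of_mem_agreeableClosure {G : Subgroup (GL (Fin 2) ZHat)}
    (hdet : G.map det = ⊤) (hG : G ≤ U) (hU : (redGL n).ker ≤ U) :
    (∀ g ∈ agreeableClosure G, ∀ h ∈ agreeableClosure G, ⁅g, h⁆ ∈ U) ∧
    ((∀ (p : ℕ) (hp : p.Prime), p ≠ 2 → ∀ x ∈ SLHat,
      loc (isIdempotentElem_idem hp) x ∈ agreeableClosure G) →
      ∀ x ∈ SLHat, loc (isIdempotentElem_idem Nat.prime_two).one_sub x ∈ U) := by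
  have hdet' : U.map det = ⊤ := top_le_iff.1 (hdet.ge.trans (Subgroup.map_mono hG))
  obtain ⟨hpos, hle⟩ := lev_spec (K := SLHat) ⟨n, inf_le_right.trans hU⟩
  set m : ℕ+ := ⟨lev SLHat U, hpos⟩ with hm
  have hA : agreeableClosure G ≤ hull U m :=
    sInf_le ⟨isAgreeable_hull hdet' rfl hle, hG.trans le_hull⟩
  refine ⟨fun g hg h hh => commutator_mem_of_mem_hull hle (hA hg) (hA hh), fun hloc x hx => ?_⟩
  have hodd : ∀ p : ℕ, p.Prime → p ≠ 2 → ¬ p ∣ lev SLHat U := fun p hp hp2 =>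
    (not_dvd_lev_iff hp (fun g hg => det_loc_of_det_eq_one _ hg) ⟨m, hle⟩).2
      (loc_mem_of_loc_mem_hull hp hp2 hdet' hle fun x hx => hA (hloc p hp hp2 x hx))
  obtain ⟨k, hk⟩ | ⟨p, hp, hpd, hpo⟩ := Nat.eq_two_pow_or_exists_odd_prime_and_dvd (lev SLHat U)
  · have hmk : m = ⟨2 ^ k, pow_pos Nat.prime_two.pos k⟩ := PNat.eq hk
    refine hle ⟨det_loc_of_det_eq_one _ hx, redGL_loc_of_eq_zero _ ?_ x⟩
    rw [hmk, map_sub, map_one, reduction_pow_idem Nat.prime_two k, sub_self]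
  · exact absurd hpd (hodd p hp (by rintro rfl; exact absurd hpo (by decide)))

end Hull

end SerreCurve

/-! ### The subgroup of level two and index two -/

namespace SerreCurve

open scoped commutatorElement
open Matrix.GeneralLinearGroup (det scalar)

/-- The sign of the permutation of the three nonzero vectors defined by the matrix with rows
`(a, b)` and `(c, d)`. -/
def signFormula (a b c d : ZMod 2) : ZMod 2 := b + c + 1 + a + d + a * d

lemma signFormula_mul (a b c d a' b' c' d' : ZMod 2) (h : a * d - b * c = 1)
    (h' : a' * d' - b' * c' = 1) :
    signFormula (a * a' + b * c') (a * b' + b * d') (c * a' + d * c') (c * b' + d * d') =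
      signFormula a b c d + signFormula a' b' c' d' := by
  revert a b c d a' b' c' d'
  decide

lemma coe_det_zmod_two (g : GL (Fin 2) (ZMod 2)) : g 0 0 * g 1 1 - g 0 1 * g 1 0 = 1 := by
  rw [← coe_det]
  have : ∀ u : (ZMod 2)ˣ, (u : ZMod 2) = 1 := by decide
  exact this _

/-- The sign character of `GL₂(ℤ/2ℤ)`. -/
def sign : GL (Fin 2) (ZMod 2) →* Multiplicative (ZMod 2) where
  toFun g := .ofAdd (signFormula (g 0 0) (g 0 1) (g 1 0) (g 1 1))
  map_one' := by
    simp only [Units.val_one, Matrix.one_apply_eq, ne_eq, zero_ne_one, one_ne_zero,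
      not_false_eq_true, Matrix.one_apply_ne]
    decide
  map_mul' g h := by
    rw [← ofAdd_add, ← signFormula_mul _ _ _ _ _ _ _ _ (coe_det_zmod_two g) (coe_det_zmod_two h)]
    simp only [Units.val_mul, Matrix.mul_apply, Fin.sum_univ_two]

lemma commutator_upper_lower_zmod_two :
    ((⁅upper (1 : ZMod 2), lower (1 : ZMod 2)⁆ : GL (Fin 2) (ZMod 2)) : Matrix (Fin 2) (Fin 2) (ZMod 2)) =
      !![1, 1; 1, 0] := by
  rw [commutatorElement_def, upper_inv, lower_inv]
  simp only [Units.val_mul, coe_upper, coe_lower, Matrix.mul_fin_two]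
  decide

lemma commutator_lower_upper_zmod_two :
    ((⁅lower (1 : ZMod 2), upper (1 : ZMod 2)⁆ : GL (Fin 2) (ZMod 2)) : Matrix (Fin 2) (Fin 2) (ZMod 2)) =
      !![0, 1; 1, 1] := by
  rw [commutatorElement_def, upper_inv, lower_inv]
  simp only [Units.val_mul, coe_upper, coe_lower, Matrix.mul_fin_two]
  decide

lemma eq_of_sign_eq_one {g : GL (Fin 2) (ZMod 2)} (h : sign g = 1) :
    g = 1 ∨ g = ⁅upper (1 : ZMod 2), lower 1⁆ ∨ g = ⁅lower (1 : ZMod 2), upper 1⁆ := by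
  have h1 : signFormula (g 0 0) (g 0 1) (g 1 0) (g 1 1) = 0 := h
  have h2 := coe_det_zmod_two g
  simp only [Units.ext_iff, commutator_upper_lower_zmod_two, commutator_lower_upper_zmod_two,
    Units.val_one, Matrix.one_fin_two, ← Matrix.ext_iff, Fin.forall_fin_two, Matrix.of_apply,
    Matrix.cons_val_zero, Matrix.cons_val_one]
  generalize g 0 0 = a at *
  generalize g 0 1 = b at *
  generalize g 1 0 = c at *
  generalize g 1 1 = d at *
  revert a b c d
  decide

lemma mem_commutator_iff (g : GL (Fin 2) (ZMod 2)) :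
    g ∈ commutator (GL (Fin 2) (ZMod 2)) ↔ sign g = 1 := by
  constructor
  · exact fun h => Abelianization.commutator_subset_ker sign h
  · intro h
    obtain rfl | rfl | rfl := eq_of_sign_eq_one h
    · exact one_mem _
    · exact Subgroup.commutator_mem_commutator (Subgroup.mem_top _) (Subgroup.mem_top _)
    · exact Subgroup.commutator_mem_commutator (Subgroup.mem_top _) (Subgroup.mem_top _)

/-- The sign character of `GL₂(Ẑ)`. -/
def sgn : GL (Fin 2) ZHat →* Multiplicative (ZMod 2) := sign.comp (redGL 2)

lemma mem_levelTwo_iff {g : GL (Fin 2) ZHat} : g ∈ levelTwo ↔ sgn g = 1 := mem_commutator_iff _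

lemma mem_levelTwo_of_redGL_eq_one {g : GL (Fin 2) ZHat} (h : redGL 2 g = 1) : g ∈ levelTwo := by
  rw [levelTwo, Subgroup.mem_comap, h]
  exact one_mem _

lemma sgn_diag (a d : ZHatˣ) : sgn (diag a d) = 1 := by
  have h : ∀ u v : (ZMod 2)ˣ, signFormula u 0 0 v = 0 := by decide
  have := h (Units.map ((reduction 2 : ZHat →+* ZMod (2 : ℕ+)) : ZHat →* ZMod (2 : ℕ+)) a)
    (Units.map ((reduction 2 : ZHat →+* ZMod (2 : ℕ+)) : ZHat →* ZMod (2 : ℕ+)) d)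
  change Multiplicative.ofAdd (signFormula (reduction 2 a) (reduction 2 0) (reduction 2 0)
    (reduction 2 d)) = 1
  rw [map_zero]
  exact congrArg Multiplicative.ofAdd this

lemma sgn_upper (t : ZHat) : sgn (upper t) = .ofAdd (reduction 2 t) := by
  change Multiplicative.ofAdd (signFormula (reduction 2 1) (reduction 2 t) (reduction 2 0)
    (reduction 2 1)) = _
  have h : ∀ x : ZMod 2, signFormula 1 x 0 1 = x := by decide
  rw [map_zero, map_one]
  exact congrArg Multiplicative.ofAdd (h _)

/-- The quotient of `GL₂(Ẑ)` by its subgroup of level `2` and index `2`. -/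
abbrev SignQuotient : Type := GL (Fin 2) ZHat ⧸ levelTwo

/-- The class of a matrix in the quotient by the subgroup of level `2` and index `2`. -/
abbrev cls : GL (Fin 2) ZHat →* SignQuotient := QuotientGroup.mk' levelTwo

lemma cls_eq_iff {g h : GL (Fin 2) ZHat} : cls g = cls h ↔ sgn g = sgn h := by
  rw [QuotientGroup.mk'_apply, QuotientGroup.mk'_apply, QuotientGroup.eq, mem_levelTwo_iff,
    map_mul, map_inv, inv_mul_eq_one]

lemma cls_eq_one_iff {g : GL (Fin 2) ZHat} : cls g = 1 ↔ sgn g = 1 := by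
  rw [← map_one cls, cls_eq_iff, map_one]

lemma mul_eq_one_of_ne_one {a b : SignQuotient} (ha : a ≠ 1) (hb : b ≠ 1) : a * b = 1 := by
  obtain ⟨g, rfl⟩ := QuotientGroup.mk'_surjective _ a
  obtain ⟨h, rfl⟩ := QuotientGroup.mk'_surjective _ b
  rw [ne_eq, cls_eq_one_iff] at ha hb
  rw [← map_mul, cls_eq_one_iff, map_mul]
  generalize sgn g = x at *
  generalize sgn h = y at *
  revert x y
  decide

lemma eq_of_ne_one {a b : SignQuotient} (ha : a ≠ 1) (hb : b ≠ 1) : a = b := by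
  exact mul_right_cancel ((mul_eq_one_of_ne_one ha hb).trans (mul_eq_one_of_ne_one hb hb).symm)

lemma eq_of_iff {a b : SignQuotient} (h : a = 1 ↔ b = 1) : a = b := by
  by_cases ha : a = 1
  · rw [ha, h.1 ha]
  · exact eq_of_ne_one ha fun hb => ha (h.2 hb)

lemma cls_upper_one_ne : cls (upper 1) ≠ 1 := by
  rw [ne_eq, cls_eq_one_iff, sgn_upper, map_one]
  decide

section GroupOf

variable {γ : ZHatˣ →* SignQuotient}

lemma mem_groupOf {g : GL (Fin 2) ZHat} : g ∈ groupOf γ ↔ cls g = γ (det g) := Iff.rfl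

lemma diag_mem_groupOf {a d : ZHatˣ} : diag a d ∈ groupOf γ ↔ γ (a * d) = 1 := by
  rw [mem_groupOf, det_diag, cls_eq_one_iff.2 (sgn_diag a d), eq_comm]

lemma mem_groupOf_of_det_eq_one {g : GL (Fin 2) ZHat} (h : det g = 1) :
    g ∈ groupOf γ ↔ g ∈ levelTwo := by
  rw [mem_groupOf, h, map_one, cls_eq_one_iff, mem_levelTwo_iff]

lemma index_groupOf (γ : ZHatˣ →* SignQuotient) : (groupOf γ).index = 2 := by
  rw [Subgroup.index_eq_two_iff]
  refine ⟨upper 1, fun g => ?_⟩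
  rw [mem_groupOf, mem_groupOf, map_mul, map_mul, det_upper, mul_one]
  by_cases h : cls g = γ (det g)
  · exact .inr ⟨h, fun h' => cls_upper_one_ne (mul_eq_left.1 (h'.trans h.symm))⟩
  · refine .inl ⟨?_, h⟩
    by_cases h1 : cls g = 1
    · rw [h1, one_mul]
      exact eq_of_ne_one cls_upper_one_ne fun h2 => h (h1.trans h2.symm)
    · rw [mul_eq_one_of_ne_one h1 cls_upper_one_ne]
      by_contra h2
      exact h (eq_of_ne_one h1 (Ne.symm h2))

end GroupOf

end SerreCurve

/-! ### Commutators of the groups attached to characters ramified at two -/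

namespace SerreCurve

open scoped commutatorElement
open Matrix.GeneralLinearGroup (det scalar)

/-- An even profinite integer is divisible by two. -/
lemma exists_eq_two_mul {x : ZHat} (hx : reduction 2 x = 0) : ∃ y, x = 2 * y := by
  have heven : ∀ n : ℕ+, 2 ∣ (reduction (2 * n) x).val := fun n => by
    have h := castHom_reduction (m := 2) (n := 2 * n) ⟨n, rfl⟩ x
    rw [hx, ZMod.castHom_apply, ZMod.cast_eq_val] at h
    exact (ZMod.natCast_eq_zero_iff _ 2).1 h
  refine ⟨⟨fun n => (((reduction (2 * n) x).val / 2 : ℕ) : ZMod n), fun m n h => ?_⟩, ?_⟩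
  · rw [map_natCast, ZMod.natCast_eq_natCast_iff]
    refine Nat.ModEq.mul_left_cancel' two_ne_zero ?_
    rw [Nat.mul_div_cancel' (heven n), Nat.mul_div_cancel' (heven m)]
    have hd : ((2 * m : ℕ+) : ℕ) ∣ (2 * n : ℕ+) := Nat.mul_dvd_mul_left 2 h
    have h1 := castHom_reduction hd x
    rw [ZMod.castHom_apply, ZMod.cast_eq_val, ← ZMod.natCast_zmod_val (reduction (2 * m) x)] at h1
    exact (ZMod.natCast_eq_natCast_iff _ _ (2 * m : ℕ+)).1 h1
  · refine ZHat.ext_reduction fun n => ?_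
    rw [map_mul, map_ofNat]
    change _ = (2 : ZMod n) * (((reduction (2 * n) x).val / 2 : ℕ) : ZMod n)
    have h1 := castHom_reduction (m := n) (n := 2 * n) ⟨2, mul_comm _ _⟩ x
    rw [ZMod.castHom_apply, ZMod.cast_eq_val] at h1
    rw [← h1]
    exact_mod_cast congrArg (Nat.cast : ℕ → ZMod n) (Nat.mul_div_cancel' (heven n)).symm

lemma redGL_upper (n : ℕ+) (t : ZHat) : redGL n (upper t) = upper (reduction n t) := by
  refine Units.ext (Matrix.ext fun i j => ?_)
  change reduction n _ = _
  fin_cases i <;> fin_cases j <;> simp [coe_upper]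

lemma redGL_lower (n : ℕ+) (t : ZHat) : redGL n (lower t) = lower (reduction n t) := by
  refine Units.ext (Matrix.ext fun i j => ?_)
  change reduction n _ = _
  fin_cases i <;> fin_cases j <;> simp [coe_lower]

lemma redGL_diag (n : ℕ+) (a d : ZHatˣ) : redGL n (diag a d) =
    diag (Units.map (reduction n : ZHat →* ZMod n) a) (Units.map (reduction n : ZHat →* ZMod n) d) := by
  refine Units.ext (Matrix.ext fun i j => ?_)
  change reduction n _ = _
  fin_cases i <;> fin_cases j <;> simp [coe_diag]

section LocUnit

variable {R : Type*} [CommRing R] {e : R} (he : IsIdempotentElem e)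

/-- The unit that agrees with `u` on the part of the idempotent `e` and with `1` elsewhere. -/
def locUnit : Rˣ →* Rˣ :=
  Units.map
    { toFun := fun x => 1 - e + e * x
      map_one' := by ring
      map_mul' := fun x y => by
        have h : e * e = e := he
        linear_combination (1 - x) * (1 - y) * -h }

lemma coe_locUnit (u : Rˣ) : (locUnit he u : R) = 1 - e + e * u := rfl

lemma loc_diag (a d : Rˣ) : loc he (diag a d) = diag (locUnit he a) (locUnit he d) := by
  rw [Units.ext_iff, coe_loc', coe_diag (locUnit he a), coe_locUnit, coe_locUnit]
  simp [coe_diag]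

end LocUnit

/-- A factor of the second entry of a commutator that commutes with the first entry can be dropped. -/
lemma commutator_mul_of_commute {G : Type*} [Group G] {x y z : G} (h : Commute x z) :
    ⁅x, y * z⁆ = ⁅x, y⁆ := by
  refine commutatorElement_eq_of_mul_eq ?_
  rw [mul_assoc y z x, ← h.eq, commutatorElement_def]
  group

lemma commute_diag {R : Type*} [CommRing R] (a b c d : Rˣ) : Commute (diag a b) (diag c d) := by
  rw [Commute, SemiconjBy, Units.ext_iff, Units.val_mul, Units.val_mul]
  simp [coe_diag, mul_comm]

lemma commutator_diag_swap {R : Type*} [CommRing R] (a : Rˣ) :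
    ⁅diag a 1, (swap : GL (Fin 2) R)⁆ = diag a a⁻¹ := by
  refine commutatorElement_eq_of_mul_eq ?_
  rw [Units.ext_iff, Units.val_mul, Units.val_mul, Units.val_mul]
  simp [coe_diag, coe_swap]

section Commutators

variable {U : Subgroup (GL (Fin 2) ZHat)} {γ : ZHatˣ →* SignQuotient}

lemma mul_diag_mem_groupOf {g : GL (Fin 2) ZHat} {u : ZHatˣ} (h : cls g = γ (det g * u)) :
    g * diag 1 u ∈ groupOf γ := by
  rw [mem_groupOf, map_mul, map_mul, det_diag, one_mul, ← h, cls_eq_one_iff.2 (sgn_diag 1 u),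
    mul_one]

lemma exists_mul_diag_mem_groupOf {u : ZHatˣ} (hu : γ u ≠ 1) (g : GL (Fin 2) ZHat) :
    ∃ v, g * diag 1 v ∈ groupOf γ := by
  have : ∃ v, cls g = γ v := by
    by_cases h : cls g = 1
    · exact ⟨1, by rw [h, map_one]⟩
    · exact ⟨u, eq_of_ne_one h hu⟩
  obtain ⟨v, hv⟩ := this
  exact ⟨(det g)⁻¹ * v, mul_diag_mem_groupOf (by rw [mul_inv_cancel_left, hv])⟩

/-- Let `γ` be nontrivial at `5`. A group that contains the commutators of the group attached to
`γ` and the prime-to-two part of `SL₂(Ẑ)` contains all matrices of determinant one in the group of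
level and index two. -/
theorem inf_levelTwo_le (h5 : ∀ u : ZHatˣ, reduction 8 (u : ZHat) = 5 → γ u ≠ 1)
    (hc : ∀ g ∈ groupOf γ, ∀ h ∈ groupOf γ, ⁅g, h⁆ ∈ U)
    (hodd : ∀ x ∈ SLHat, loc (isIdempotentElem_idem Nat.prime_two).one_sub x ∈ U) :
    SLHat ⊓ levelTwo ≤ U := by
  have he := isIdempotentElem_idem Nat.prime_two
  set e := idem Nat.prime_two with hedef
  have he' : e * e = e := he
  have he8 : reduction 8 e = 1 := reduction_pow_idem Nat.prime_two 3
  have hunit : ∀ k : ℤ, (k : ZMod 2) ≠ 0 → ∃ u : ZHatˣ, (u : ZHat) = 1 - e + e * k := fun k hk =>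
    isUnit_idem_add Nat.prime_two (by rw [map_intCast]; exact hk)
  obtain ⟨v₅, hv₅⟩ := hunit 5 (by decide)
  have hγ₅ : γ v₅ ≠ 1 := h5 _ (by
    rw [hv₅, map_add, map_sub, map_mul, he8, map_one, map_intCast, sub_self, zero_add, one_mul]
    rfl)
  -- One of the units `3` and `-1` has trivial character.
  obtain ⟨a₀, ha₀, hγ⟩ : ∃ a₀ : ZHatˣ, ((a₀ : ZHat) - 1 = 2 * e ∨ (a₀ : ZHat) - 1 = -(2 * e)) ∧
      γ a₀ = 1 := by
    obtain ⟨v₃, hv₃⟩ := hunit 3 (by decide)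
    obtain ⟨v₇, hv₇⟩ := hunit (-1) (by decide)
    have h37 : γ (v₃ * v₇) ≠ 1 := h5 _ (by
      rw [Units.val_mul, hv₃, hv₇, map_mul, map_add, map_add, map_sub, map_mul, map_mul, he8,
        map_one, map_intCast, map_intCast, sub_self, zero_add, zero_add, one_mul, one_mul]
      rfl)
    by_cases h3 : γ v₃ = 1
    · exact ⟨v₃, .inl (by rw [hv₃]; push_cast; ring), h3⟩
    by_cases h7 : γ v₇ = 1
    · exact ⟨v₇, .inr (by rw [hv₇]; push_cast; ring), h7⟩
    · exact absurd (by rw [map_mul, mul_eq_one_of_ne_one h3 h7]) h37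
  have hcomm : ∀ (a b : ZHatˣ), γ (a * b) = 1 → ∀ g, ⁅diag a b, g⁆ ∈ U := fun a b hab g => by
    obtain ⟨v, hv⟩ := exists_mul_diag_mem_groupOf hγ₅ g
    rw [← commutator_mul_of_commute (commute_diag a b 1 v)]
    exact hc _ (diag_mem_groupOf.2 hab) _ hv
  have hup : ∀ t, upper (2 * e * t) ∈ U := fun t => by
    have h1 := hcomm a₀ 1 (by rwa [mul_one]) (upper t)
    rw [commutator_diag_upper a₀ 1 t ((a₀ - 1) * t) (by rw [Units.val_one]; ring)] at h1
    obtain h | h := ha₀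
    · rwa [h] at h1
    · have := inv_mem h1
      rwa [h, upper_inv, neg_mul, neg_neg] at this
  have hlow : ∀ t, lower (2 * e * t) ∈ U := fun t => by
    have h1 := hcomm 1 a₀ (by rwa [one_mul]) (lower t)
    rw [commutator_diag_lower 1 a₀ t ((a₀ - 1) * t) (by rw [Units.val_one]; ring)] at h1
    obtain h | h := ha₀
    · rwa [h] at h1
    · have := inv_mem h1
      rwa [h, lower_inv, neg_mul, neg_neg] at this
  have hdiag₁ : ∀ a : ZHatˣ, γ (locUnit he a) = 1 → loc he (diag a a⁻¹) ∈ U := fun a ha => by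
    have h1 := hcomm (locUnit he a) 1 (by rwa [mul_one]) swap
    rwa [commutator_diag_swap, ← map_inv, ← loc_diag] at h1
  have hdiag₅ : loc he (diag v₅ v₅⁻¹) ∈ U := by
    set g : GL (Fin 2) ZHat := upper (2 * e * 1) * lower (2 * e * 1) with hg
    have hgU : g ∈ U := mul_mem (hup 1) (hlow 1)
    have hgc : (g : Matrix (Fin 2) (Fin 2) ZHat) =
        !![1 + 2 * e * 1 * (2 * e * 1), 2 * e * 1; 2 * e * 1, 1] := by
      rw [hg, Units.val_mul, coe_upper, coe_lower, Matrix.mul_fin_two]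
      simp
    have h1 : (v₅ : ZHat) = 1 - e + e * g 0 0 := by
      rw [hgc, hv₅]
      simp only [Matrix.of_apply, Matrix.cons_val_zero, Int.cast_ofNat]
      linear_combination (-4 * (e + 1)) * he'
    have hlg : loc he g = g := by
      rw [hg, map_mul, loc_upper, loc_lower]
      congr 2 <;> linear_combination 2 * he'
    have h2 := loc_eq_mul he (g := g) (by rw [hg, map_mul, det_upper, det_lower, mul_one]) v₅ h1
    rw [hlg, hgc] at h2
    simp only [Matrix.of_apply, Matrix.cons_val_zero, Matrix.cons_val_one] at h2
    have hl : lower (e * (2 * e * 1 * (v₅⁻¹ : ZHatˣ))) ∈ U := by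
      rw [show e * (2 * e * 1 * ((v₅⁻¹ : ZHatˣ) : ZHat)) = 2 * e * (e * (v₅⁻¹ : ZHatˣ)) by ring]
      exact hlow _
    have hu : upper (e * (2 * e * 1 * (v₅⁻¹ : ZHatˣ))) ∈ U := by
      rw [show e * (2 * e * 1 * ((v₅⁻¹ : ZHatˣ) : ZHat)) = 2 * e * (e * (v₅⁻¹ : ZHatˣ)) by ring]
      exact hup _
    rw [h2] at hgU
    exact (Subgroup.mul_mem_cancel_left U hl).1 ((Subgroup.mul_mem_cancel_right U hu).1 hgU)
  have hdiag : ∀ a : ZHatˣ, loc he (diag a a⁻¹) ∈ U := fun a => by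
    by_cases ha : γ (locUnit he a) = 1
    · exact hdiag₁ a ha
    · have h55 : locUnit he v₅ = v₅ := by
        rw [Units.ext_iff, coe_locUnit, hv₅]
        linear_combination ((5 : ℤ) - 1 : ZHat) * he'
      have h1 := hdiag₁ (a * v₅) (by rw [map_mul, map_mul, h55, mul_eq_one_of_ne_one ha hγ₅])
      have h2 : diag (a * v₅) (a * v₅)⁻¹ = diag a a⁻¹ * diag v₅ v₅⁻¹ := by
        rw [Units.ext_iff, Units.val_mul]
        simp [coe_diag, mul_comm]
      rw [h2, map_mul] at h1
      exact (Subgroup.mul_mem_cancel_right U hdiag₅).1 h1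
  have htwo : ∀ x ∈ SLHat, redGL 2 x = 1 → x ∈ U := fun x hx hx2 => by
    rw [← loc_mul_loc_one_sub he x]
    refine mul_mem ?_ (hodd x hx)
    have hx2' : ∀ i j, reduction 2 (x i j) = reduction 2 ((1 : GL (Fin 2) ZHat) i j) :=
      redGL_eq_iff.1 (hx2.trans (map_one _).symm)
    obtain ⟨a, ha⟩ := isUnit_idem_add Nat.prime_two (a := x 0 0) (by
      change reduction 2 (x 0 0) ≠ 0
      rw [hx2' 0 0, Units.val_one, Matrix.one_apply_eq, map_one]
      decide)
    obtain ⟨y, hy⟩ := exists_eq_two_mul (x := x 0 1) ((hx2' 0 1).trans (map_zero _))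
    obtain ⟨z, hz⟩ := exists_eq_two_mul (x := x 1 0) ((hx2' 1 0).trans (map_zero _))
    rw [loc_eq_mul he hx a ha, hy, hz]
    refine mul_mem (mul_mem ?_ (hdiag a)) ?_
    · rw [show e * (2 * z * ((a⁻¹ : ZHatˣ) : ZHat)) = 2 * e * (z * (a⁻¹ : ZHatˣ)) by ring]
      exact hlow _
    · rw [show e * (2 * y * ((a⁻¹ : ZHatˣ) : ZHat)) = 2 * e * (y * (a⁻¹ : ZHatˣ)) by ring]
      exact hup _
  obtain ⟨r, hr, hsgn, hd, hup₁, hlow₁⟩ : ∃ r : GL (Fin 2) ZHat →* GL (Fin 2) (ZMod 2),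
      (∀ g, r g = 1 → redGL 2 g = 1) ∧ (∀ g, sgn g = 1 → sign (r g) = 1) ∧
      (∀ u : ZHatˣ, r (diag 1 u) = 1) ∧ r (upper 1) = upper 1 ∧ r (lower 1) = lower 1 := by
    have h : ∀ u v : (ZMod 2)ˣ, (diag u v : GL (Fin 2) (ZMod 2)) = 1 := by decide
    refine ⟨redGL 2, fun _ => id, fun _ => id, fun u => (redGL_diag 2 1 u).trans (h _ _),
      (redGL_upper 2 1).trans ?_, (redGL_lower 2 1).trans ?_⟩
    · rw [map_one]
      rfl
    · rw [map_one]
      rfl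
  -- An element of `U` of order three modulo two.
  obtain ⟨z, hzU, hz1, hz2⟩ : ∃ z ∈ U, det z = 1 ∧
      r z = ⁅upper (1 : ZMod 2), lower (1 : ZMod 2)⁆ := by
    obtain ⟨v, hv⟩ := exists_mul_diag_mem_groupOf hγ₅ (upper 1)
    obtain ⟨w, hw⟩ := exists_mul_diag_mem_groupOf hγ₅ (lower 1)
    refine ⟨⁅upper 1 * diag 1 v, lower 1 * diag 1 w⁆, hc _ hv _ hw, ?_, ?_⟩
    · rw [map_commutatorElement, commutatorElement_eq_one_iff_mul_comm, mul_comm]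
    · rw [map_commutatorElement, map_mul, map_mul, hd, hd, hup₁, hlow₁, mul_one, mul_one]
  rintro x ⟨hx, hx2⟩
  have hx' : det x = 1 := hx
  obtain h | h | h := eq_of_sign_eq_one (hsgn x (mem_levelTwo_iff.1 hx2))
  · exact htwo x hx (hr x h)
  · refine (Subgroup.mul_mem_cancel_left U (inv_mem hzU)).1 (htwo (z⁻¹ * x) ?_ (hr _ ?_))
    · rw [MonoidHom.mem_ker, map_mul, map_inv, hz1, hx', inv_one, mul_one]
    · rw [map_mul, map_inv, hz2, h, inv_mul_cancel]
  · refine (Subgroup.mul_mem_cancel_left U hzU).1 (htwo (z * x) ?_ (hr _ ?_))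
    · rw [MonoidHom.mem_ker, map_mul, hz1, hx', mul_one]
    · rw [map_mul, hz2, h, ← commutatorElement_inv, inv_mul_cancel]

end Commutators

end SerreCurve

/-! ### The image of Galois and the quadratic character attached to it -/

namespace SerreCurve

open scoped commutatorElement
open Matrix.GeneralLinearGroup (det scalar)

lemma loc_mem_groupOf {γ : ZHatˣ →* SignQuotient} {p : ℕ} (hp : p.Prime) (hp2 : p ≠ 2)
    {x : GL (Fin 2) ZHat} (hx : x ∈ SLHat) : loc (isIdempotentElem_idem hp) x ∈ groupOf γ := by
  rw [mem_groupOf_of_det_eq_one (det_loc_of_det_eq_one _ hx)]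
  refine mem_levelTwo_of_redGL_eq_one (redGL_loc_of_eq_zero _ ?_ x)
  exact reduction_idem_of_not_dvd hp fun h =>
    hp2 ((Nat.prime_dvd_prime_iff_eq hp Nat.prime_two).1 h)

variable {E : WeierstrassCurve ℚ} (b : TorsionBasis E)

lemma isFinitary_of_redGL (n : ℕ+) {S : Set GalQ}
    (h : ∀ σ τ, redGL n (rhoDual b σ) = redGL n (rhoDual b τ) → σ ∈ S → τ ∈ S) :
    IsFinitary S := by
  have := Fintype.ofFinite (GL (Fin 2) (ZMod n))
  choose s hs using isFinitary_redGL b n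
  refine ⟨Finset.univ.biUnion s, fun σ τ hst hσ => h σ τ ?_ hσ⟩
  exact (hs _ σ τ (fun x hx => hst x (Finset.mem_biUnion.2 ⟨_, Finset.mem_univ _, hx⟩)) rfl).symm

variable [E.IsElliptic]

lemma map_det_imageGroup : (imageGroup b).map det = ⊤ := by
  refine top_le_iff.1 fun u _ => ?_
  obtain ⟨σ, hσ⟩ := cyc_surjective u⁻¹
  exact ⟨_, ⟨σ, rfl⟩, by rw [det_rhoDual, hσ, inv_inv]⟩

/-- The image of Galois is contained in the group attached to a quadratic character: the character
that describes the quadratic field generated by a square root of the discriminant. -/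
theorem exists_imageGroup_le_groupOf : ∃ (γ : ZHatˣ →* SignQuotient) (N : ℕ+),
    imageGroup b ≤ groupOf γ ∧ ∀ u : ZHatˣ, reduction N (u : ZHat) = 1 → γ u = 1 := by
  set θ : GalQ →* SignQuotient := cls.comp (rhoDual b) with hθ
  obtain ⟨N, hN⟩ := exists_forall_eq_one_of_cycMod (fun _ _ => mul_eq_one_of_ne_one) θ
    (isFinitary_of_redGL b 2 fun σ τ h hσ => by
      have hσ' : cls (rhoDual b σ) = 1 := hσ
      change cls (rhoDual b τ) = 1
      rw [cls_eq_one_iff] at hσ' ⊢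
      rw [← hσ']
      exact congrArg sign h.symm)
  have hker : cyc.ker ≤ θ.ker := fun σ hσ => hN σ (by
    rw [Units.ext_iff, ← reduction_cyc, MonoidHom.mem_ker.1 hσ, Units.val_one, map_one,
      Units.val_one])
  set γ₀ : ZHatˣ →* SignQuotient := cyc.liftOfSurjective cyc_surjective ⟨θ, hker⟩
  have hγ₀ : ∀ σ, γ₀ (cyc σ) = θ σ := cyc.liftOfRightInverse_comp_apply _ _ ⟨θ, hker⟩
  refine ⟨γ₀.comp invMonoidHom, N, ?_, fun u hu => ?_⟩
  · rintro _ ⟨σ, rfl⟩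
    rw [mem_groupOf, det_rhoDual]
    simp [hγ₀, hθ]
  · obtain ⟨σ, hσ⟩ := cyc_surjective u
    have h1 : γ₀ u = 1 := by
      rw [← hσ, hγ₀]
      exact hN σ (by rw [Units.ext_iff, ← reduction_cyc, hσ, hu, Units.val_one])
    simp [h1]

/-- An image of Galois that contains all matrices of determinant one in the group of level and
index two has index two. -/
theorem isSerreCurve_of_inf_levelTwo_le (h : SLHat ⊓ levelTwo ≤ imageGroup b) :
    IsSerreCurve b := by
  obtain ⟨γ, -, hγ, -⟩ := exists_imageGroup_le_groupOf b
  have : imageGroup b = groupOf γ := by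
    refine le_antisymm hγ fun g hg => ?_
    obtain ⟨x, hx, hxg⟩ : det g ∈ (imageGroup b).map det :=
      map_det_imageGroup b ▸ Subgroup.mem_top _
    have hd : det (x⁻¹ * g) = 1 := by rw [map_mul, map_inv, hxg, inv_mul_cancel]
    refine (Subgroup.mul_mem_cancel_left _ (inv_mem hx)).1 (h ⟨hd, ?_⟩)
    exact (mem_groupOf_of_det_eq_one hd).1 (mul_mem (inv_mem (hγ hx)) hg)
  rw [IsSerreCurve, this, index_groupOf]

/-- If the agreeable closure contains the group attached to a character that is nontrivial at `5`,
then the curve is a Serre curve. -/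
theorem isSerreCurve_of_groupOf_le {γ : ZHatˣ →* SignQuotient}
    (h5 : ∀ u : ZHatˣ, reduction 8 (u : ZHat) = 5 → γ u ≠ 1)
    (hγ : groupOf γ ≤ agreeableClosure (imageGroup b)) : IsSerreCurve b := by
  refine isSerreCurve_of_inf_levelTwo_le b fun g hg => mem_imageGroup_of_forall b fun n => ?_
  obtain ⟨hc, hodd⟩ := commutator_mem_of_mem_agreeableClosure (n := n) (map_det_imageGroup b)
    le_sup_left (le_sup_right : _ ≤ imageGroup b ⊔ (redGL n).ker)
  have h1 := inf_levelTwo_le h5 (fun x hx y hy => hc x (hγ hx) y (hγ hy))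
    (hodd fun p hp hp2 x hx => hγ (loc_mem_groupOf hp hp2 hx)) hg
  obtain ⟨x, hx, y, hy, hxy⟩ := Subgroup.mem_sup_of_normal_right.1 h1
  exact ⟨x, hx, by rw [← hxy, map_mul, MonoidHom.mem_ker.1 hy, mul_one]⟩

end SerreCurve

/-! ### The characters of the square roots of two and minus two -/

namespace SerreCurve

open scoped commutatorElement
open Matrix.GeneralLinearGroup (det scalar)

lemma IsGamma.unique {d : ℤ} {γ γ' : ZHatˣ →* SignQuotient} (h : IsGamma d γ)
    (h' : IsGamma d γ') : γ = γ' := by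
  refine MonoidHom.ext fun u => eq_of_iff ?_
  obtain ⟨σ, hσ⟩ := cyc_surjective u⁻¹
  rw [← inv_inv u, ← hσ, h σ, h' σ]

lemma IsGamma.gamma_eq {d : ℤ} {γ : ZHatˣ →* SignQuotient} (h : IsGamma d γ) : gamma d = γ := by
  have hex : ∃ γ, IsGamma d γ := ⟨γ, h⟩
  rw [gamma, dif_pos hex]
  exact hex.choose_spec.unique h

lemma mem_fixingSubgroup_adjoin_iff {s : QBar} {d : ℤ} (hs : s ^ 2 = d) (σ : GalQ) :
    σ ∈ (IntermediateField.adjoin ℚ {x : QBar | x ^ 2 = (d : QBar)}).fixingSubgroup ↔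
      σ s = s := by
  rw [← Subgroup.zpowers_le, ← IntermediateField.le_iff_le, IntermediateField.adjoin_le_iff]
  constructor
  · intro h
    exact h hs ⟨σ, Subgroup.mem_zpowers σ⟩
  · rintro h x hx ⟨τ, hτ⟩
    have h1 : Subgroup.zpowers σ ≤ MulAction.stabilizer GalQ s := Subgroup.zpowers_le.2 h
    have h2 : τ s = s := h1 hτ
    change τ x = x
    obtain rfl | rfl := sq_eq_sq_iff_eq_or_eq_neg.1 (hx.trans hs.symm)
    · exact h2
    · rw [map_neg, h2]

lemma reduction_eight (u : ZHatˣ) : reduction 8 (u : ZHat) = 1 ∨ reduction 8 (u : ZHat) = 3 ∨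
    reduction 8 (u : ZHat) = 5 ∨ reduction 8 (u : ZHat) = 7 := by
  have h : ∀ w : (ZMod 8)ˣ, (w : ZMod 8) = 1 ∨ (w : ZMod 8) = 3 ∨ (w : ZMod 8) = 5 ∨
    (w : ZMod 8) = 7 := by decide
  exact h (Units.map ((reduction 8 : ZHat →+* ZMod (8 : ℕ+)) : ZHat →* ZMod (8 : ℕ+)) u)

lemma apply_eq_one_iff_of_apply_neg_one {γ : ZHatˣ →* SignQuotient}
    (h1 : ∀ u : ZHatˣ, reduction 8 (u : ZHat) = 1 → γ u = 1)
    (h5 : ∀ u : ZHatˣ, reduction 8 (u : ZHat) = 5 → γ u ≠ 1) (u : ZHatˣ) :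
    (γ (-1) = 1 → (γ u = 1 ↔ reduction 8 (u : ZHat) = 1 ∨ reduction 8 (u : ZHat) = 7)) ∧
    (γ (-1) ≠ 1 → (γ u = 1 ↔ reduction 8 (u : ZHat) = 1 ∨ reduction 8 (u : ZHat) = 3)) := by
  have hu : γ u = γ (-1) * γ (-u) := by rw [← map_mul, neg_one_mul, neg_neg]
  have hr : reduction 8 ((-u : ZHatˣ) : ZHat) = -reduction 8 (u : ZHat) := by
    rw [Units.val_neg, map_neg]
  have c1 : (1 : ZMod 8) = 1 ∨ (1 : ZMod 8) = 7 := by decide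
  have c1' : (1 : ZMod 8) = 1 ∨ (1 : ZMod 8) = 3 := by decide
  have c3 : ¬ ((3 : ZMod 8) = 1 ∨ (3 : ZMod 8) = 7) := by decide
  have c3' : (3 : ZMod 8) = 1 ∨ (3 : ZMod 8) = 3 := by decide
  have c5 : ¬ ((5 : ZMod 8) = 1 ∨ (5 : ZMod 8) = 7) := by decide
  have c5' : ¬ ((5 : ZMod 8) = 1 ∨ (5 : ZMod 8) = 3) := by decide
  have c7 : (7 : ZMod 8) = 1 ∨ (7 : ZMod 8) = 7 := by decide
  have c7' : ¬ ((7 : ZMod 8) = 1 ∨ (7 : ZMod 8) = 3) := by decide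
  obtain h | h | h | h := reduction_eight u <;> rw [h]
  · exact ⟨fun _ => iff_of_true (h1 u h) c1, fun _ => iff_of_true (h1 u h) c1'⟩
  · have h' : γ (-u) ≠ 1 := h5 _ (by rw [hr, h]; rfl)
    exact ⟨fun hm => iff_of_false (by rwa [hu, hm, one_mul]) c3,
      fun hm => iff_of_true (by rw [hu, mul_eq_one_of_ne_one hm h']) c3'⟩
  · exact ⟨fun _ => iff_of_false (h5 u h) c5, fun _ => iff_of_false (h5 u h) c5'⟩
  · have h' : γ (-u) = 1 := h1 _ (by rw [hr, h]; rfl)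
    exact ⟨fun hm => iff_of_true (by rw [hu, hm, h', one_mul]) c7,
      fun hm => iff_of_false (by rwa [hu, h', mul_one]) c7'⟩

lemma exists_apply_eq_pow (ζ : QBar) (hζ : ζ ^ 8 = 1) (σ : GalQ) :
    reduction 8 (cyc σ : ZHat) = 1 ∧ σ ζ = ζ ∨ reduction 8 (cyc σ : ZHat) = 3 ∧ σ ζ = ζ ^ 3 ∨
    reduction 8 (cyc σ : ZHat) = 5 ∧ σ ζ = ζ ^ 5 ∨
    reduction 8 (cyc σ : ZHat) = 7 ∧ σ ζ = ζ ^ 7 := by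
  have h := apply_eq_of_cycMod (n := 8) hζ σ
  rw [← reduction_cyc] at h
  obtain h1 | h1 | h1 | h1 := reduction_eight (cyc σ) <;> rw [h1] at h
  · exact .inl ⟨h1, h.trans (pow_one ζ)⟩
  · exact .inr (.inl ⟨h1, h⟩)
  · exact .inr (.inr (.inl ⟨h1, h⟩))
  · exact .inr (.inr (.inr ⟨h1, h⟩))

lemma exists_pow_four_eq_neg_one : ∃ ζ : QBar, ζ ^ 4 = -1 := by
  obtain ⟨ζ, hζ⟩ := exists_isPrimitiveRoot 8
  have h8 : ζ ^ 8 = 1 := hζ.pow_eq_one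
  have h4 : ζ ^ 4 ≠ 1 := hζ.pow_ne_one_of_pos_of_lt (by norm_num) (by decide)
  refine ⟨ζ, ?_⟩
  have h : ζ ^ 4 * ζ ^ 4 = 1 := by rw [← pow_add]; exact h8
  exact (mul_self_eq_one_iff.1 h).resolve_left h4

lemma ne_zero_of_sq_eq_int {s : QBar} {d : ℤ} (hd : d ≠ 0) (hs : s ^ 2 = d) : s ≠ 0 := by
  rintro rfl
  rw [zero_pow two_ne_zero, eq_comm, Int.cast_eq_zero] at hs
  exact hd hs

/-- If `ζ⁴ = -1`, then `ζ - ζ³` is a square root of `2`. -/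
lemma isGamma_two {γ : ZHatˣ →* SignQuotient}
    (h : ∀ u, γ u = 1 ↔ reduction 8 (u : ZHat) = 1 ∨ reduction 8 (u : ZHat) = 7) :
    IsGamma 2 γ := by
  obtain ⟨ζ, h4⟩ := exists_pow_four_eq_neg_one
  have hs : (ζ - ζ ^ 3) ^ 2 = ((2 : ℤ) : QBar) := by
    push_cast
    linear_combination (ζ ^ 2 - 2) * h4
  have hne : -(ζ - ζ ^ 3) ≠ ζ - ζ ^ 3 := neg_ne_self.2 (ne_zero_of_sq_eq_int two_ne_zero hs)
  have c3 : ¬ ((3 : ZMod 8) = 1 ∨ (3 : ZMod 8) = 7) := by decide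
  have c5 : ¬ ((5 : ZMod 8) = 1 ∨ (5 : ZMod 8) = 7) := by decide
  intro σ
  rw [mem_fixingSubgroup_adjoin_iff hs, map_inv, inv_eq_one, h, map_sub, map_pow]
  obtain ⟨h1, h2⟩ | ⟨h1, h2⟩ | ⟨h1, h2⟩ | ⟨h1, h2⟩ := exists_apply_eq_pow ζ
    (by linear_combination (ζ ^ 4 - 1) * h4) σ <;> rw [h1, h2]
  · exact iff_of_true (.inl rfl) rfl
  · refine iff_of_false c3 fun h' => hne (Eq.trans ?_ h')
    linear_combination (ζ ^ 5 - ζ) * h4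
  · refine iff_of_false c5 fun h' => hne (Eq.trans ?_ h')
    linear_combination (ζ ^ 11 - ζ ^ 7 + ζ ^ 3 - ζ) * h4
  · refine iff_of_true (.inr rfl) ?_
    linear_combination (ζ ^ 3 - ζ ^ 17 + ζ ^ 13 - ζ ^ 9 + ζ ^ 5 - ζ) * h4

/-- If `ζ⁴ = -1`, then `ζ + ζ³` is a square root of `-2`. -/
lemma isGamma_neg_two {γ : ZHatˣ →* SignQuotient}
    (h : ∀ u, γ u = 1 ↔ reduction 8 (u : ZHat) = 1 ∨ reduction 8 (u : ZHat) = 3) :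
    IsGamma (-2) γ := by
  obtain ⟨ζ, h4⟩ := exists_pow_four_eq_neg_one
  have hs : (ζ + ζ ^ 3) ^ 2 = ((-2 : ℤ) : QBar) := by
    push_cast
    linear_combination (ζ ^ 2 + 2) * h4
  have hne : -(ζ + ζ ^ 3) ≠ ζ + ζ ^ 3 := neg_ne_self.2 (ne_zero_of_sq_eq_int (by norm_num) hs)
  have c5 : ¬ ((5 : ZMod 8) = 1 ∨ (5 : ZMod 8) = 3) := by decide
  have c7 : ¬ ((7 : ZMod 8) = 1 ∨ (7 : ZMod 8) = 3) := by decide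
  intro σ
  rw [mem_fixingSubgroup_adjoin_iff hs, map_inv, inv_eq_one, h, map_add, map_pow]
  obtain ⟨h1, h2⟩ | ⟨h1, h2⟩ | ⟨h1, h2⟩ | ⟨h1, h2⟩ := exists_apply_eq_pow ζ
    (by linear_combination (ζ ^ 4 - 1) * h4) σ <;> rw [h1, h2]
  · exact iff_of_true (.inl rfl) rfl
  · refine iff_of_true (.inr rfl) ?_
    linear_combination (ζ ^ 5 - ζ) * h4
  · refine iff_of_false c5 fun h' => hne (Eq.trans ?_ h')
    linear_combination (-ζ ^ 11 + ζ ^ 7 - ζ ^ 3 - ζ) * h4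
  · refine iff_of_false c7 fun h' => hne (Eq.trans ?_ h')
    linear_combination (-ζ ^ 3 - ζ ^ 17 + ζ ^ 13 - ζ ^ 9 + ζ ^ 5 - ζ) * h4

/-- A quadratic character modulo `8` defines a character of `Ẑˣ` with values in the quotient of
order two. -/
lemma exists_eq_one_iff_mulChar {χ : MulChar (ZMod (8 : ℕ+)) ℤ} (hχ : χ.IsQuadratic) :
    ∃ γ : ZHatˣ →* SignQuotient, ∀ u, γ u = 1 ↔ χ (reduction 8 (u : ZHat)) = 1 := by
  have h : ∀ u : ZHatˣ, χ (reduction 8 (u : ZHat)) = 1 ∨ χ (reduction 8 (u : ZHat)) = -1 :=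
    fun u => (hχ _).resolve_left ((u.isUnit.map (reduction 8)).map χ).ne_zero
  have hq := mul_eq_one_of_ne_one cls_upper_one_ne cls_upper_one_ne
  refine ⟨⟨⟨fun u => if χ (reduction 8 (u : ZHat)) = 1 then 1 else cls (upper 1), ?_⟩,
    fun u v => ?_⟩, fun u => ?_⟩
  · rw [Units.val_one, map_one, map_one, if_pos rfl]
  · dsimp only
    rw [Units.val_mul, map_mul, map_mul]
    obtain hu | hu := h u <;> obtain hv | hv := h v <;> rw [hu, hv] <;> norm_num
    exact hq.symm
  · change (if χ (reduction 8 (u : ZHat)) = 1 then 1 else cls (upper 1)) = 1 ↔ _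
    split_ifs with h
    · exact iff_of_true rfl h
    · exact iff_of_false cls_upper_one_ne h

lemma gamma_two_eq_one_iff (u : ZHatˣ) :
    gamma 2 u = 1 ↔ reduction 8 (u : ZHat) = 1 ∨ reduction 8 (u : ZHat) = 7 := by
  have h : ∀ x : ZMod 8, ZMod.χ₈ x = 1 ↔ x = 1 ∨ x = 7 := by decide
  obtain ⟨γ, hγ⟩ := exists_eq_one_iff_mulChar (χ := ZMod.χ₈) ZMod.isQuadratic_χ₈
  have hγ' := fun u => (hγ u).trans (h _)
  rw [(isGamma_two hγ').gamma_eq]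
  exact hγ' u

lemma gamma_neg_two_eq_one_iff (u : ZHatˣ) :
    gamma (-2) u = 1 ↔ reduction 8 (u : ZHat) = 1 ∨ reduction 8 (u : ZHat) = 3 := by
  have h : ∀ x : ZMod 8, ZMod.χ₈' x = 1 ↔ x = 1 ∨ x = 3 := by decide
  obtain ⟨γ, hγ⟩ := exists_eq_one_iff_mulChar (χ := ZMod.χ₈') ZMod.isQuadratic_χ₈'
  have hγ' := fun u => (hγ u).trans (h _)
  rw [(isGamma_neg_two hγ').gamma_eq]
  exact hγ' u

lemma gamma_two_ne_one (u : ZHatˣ) (hu : reduction 8 (u : ZHat) = 5) : gamma 2 u ≠ 1 := by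
  have h : ¬ ((5 : ZMod 8) = 1 ∨ (5 : ZMod 8) = 7) := by decide
  rw [ne_eq, gamma_two_eq_one_iff, hu]
  exact h

lemma gamma_neg_two_ne_one (u : ZHatˣ) (hu : reduction 8 (u : ZHat) = 5) : gamma (-2) u ≠ 1 := by
  have h : ¬ ((5 : ZMod 8) = 1 ∨ (5 : ZMod 8) = 3) := by decide
  rw [ne_eq, gamma_neg_two_eq_one_iff, hu]
  exact h

/-- A character that is nontrivial at `5` and factors through `(ℤ/8ℤ)ˣ` is one of the characters of
the square roots of `2` and `-2`. -/
lemma eq_gamma_of_apply_five_ne_one {γ : ZHatˣ →* SignQuotient}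
    (h1 : ∀ u : ZHatˣ, reduction 8 (u : ZHat) = 1 → γ u = 1)
    (h5 : ∀ u : ZHatˣ, reduction 8 (u : ZHat) = 5 → γ u ≠ 1) : γ = gamma 2 ∨ γ = gamma (-2) := by
  have h := apply_eq_one_iff_of_apply_neg_one h1 h5
  by_cases hm : γ (-1) = 1
  · exact .inl (isGamma_two fun u => (h u).1 hm).gamma_eq.symm
  · exact .inr (isGamma_neg_two fun u => (h u).2 hm).gamma_eq.symm

end SerreCurve

/-! ### A cocycle modulo four -/

namespace SerreCurve

open scoped commutatorElement
open Matrix.GeneralLinearGroup (det scalar)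

/-- A function of the entries of a matrix of determinant `δ` in `GL₂(ℤ/4ℤ)`. On `SL₂(ℤ/4ℤ)` it is the
character of order four by which the sixth power of the Dedekind eta function transforms. -/
def etaFormula (a b c d δ : ZMod 4) : ZMod 4 :=
  (1 - c * c) * (b * d + 3 * (c - 1) * (d * δ) + c + 3) + c * (a + d * δ - 3)

lemma etaFormula_upper (a b c d : ZMod 4) :
    (a * d - b * c) * (a * d - b * c) = 1 →
    etaFormula a (a + b) c (c + d) (a * d - b * c) =
      etaFormula a b c d (a * d - b * c) + (a * d - b * c) := by
  revert a b c d
  decide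

lemma etaFormula_lower (a b c d : ZMod 4) :
    (a * d - b * c) * (a * d - b * c) = 1 →
    etaFormula (a + b) b (c + d) d (a * d - b * c) =
      etaFormula a b c d (a * d - b * c) + (a * d - b * c) * 3 := by
  revert a b c d
  decide

lemma etaFormula_diag (a b c d : ZMod 4) :
    (a * d - b * c) * (a * d - b * c) = 1 →
    etaFormula a (-b) c (-d) (-(a * d - b * c)) = etaFormula a b c d (a * d - b * c) := by
  revert a b c d
  decide

lemma two_mul_etaFormula_eq_zero_iff (a b c d : ZMod 4) :
    (a * d - b * c) * (a * d - b * c) = 1 →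
    (2 * etaFormula a b c d (a * d - b * c) = 0 ↔
      signFormula (ZMod.castHom (by decide : 2 ∣ 4) (ZMod 2) a)
        (ZMod.castHom (by decide : 2 ∣ 4) (ZMod 2) b)
        (ZMod.castHom (by decide : 2 ∣ 4) (ZMod 2) c)
        (ZMod.castHom (by decide : 2 ∣ 4) (ZMod 2) d) = 0) := by
  revert a b c d
  decide

lemma unit_mul_self_zmod_four (u : (ZMod 4)ˣ) : (u : ZMod 4) * u = 1 := by
  revert u
  decide

/-- The value of the formula at a matrix. -/
def eta (g : GL (Fin 2) (ZMod 4)) : ZMod 4 :=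
  etaFormula (g 0 0) (g 0 1) (g 1 0) (g 1 1) (det g : (ZMod 4)ˣ)

lemma det_mul_self (g : GL (Fin 2) (ZMod 4)) :
    (g 0 0 * g 1 1 - g 0 1 * g 1 0) * (g 0 0 * g 1 1 - g 0 1 * g 1 0) = 1 := by
  rw [← coe_det]
  exact unit_mul_self_zmod_four _

lemma eta_one : eta 1 = 0 := by
  simp only [eta, map_one, Units.val_one, Matrix.one_apply_eq, ne_eq, zero_ne_one, one_ne_zero,
    not_false_eq_true, Matrix.one_apply_ne]
  decide

/-- The matrices `h` at which the cocycle identity holds. -/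
def cocycleGroup : Subgroup (GL (Fin 2) (ZMod 4)) where
  carrier := {h | ∀ g, eta (g * h) = eta g + (det g : (ZMod 4)ˣ) * eta h}
  one_mem' g := by rw [mul_one, eta_one, mul_zero, add_zero]
  mul_mem' {h h'} hh hh' g := by
    rw [← mul_assoc, hh', hh, hh' h, map_mul, Units.val_mul]
    ring
  inv_mem' {h} hh g := by
    have h1 := hh (g * h⁻¹)
    have h2 := hh h⁻¹
    rw [inv_mul_cancel_right, map_mul, Units.val_mul] at h1
    rw [inv_mul_cancel, eta_one] at h2
    linear_combination -h1 + (det g : (ZMod 4)ˣ) * h2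

lemma upper_mem_cocycleGroup (t : ZMod 4) : upper t ∈ cocycleGroup := by
  have h1 : upper 1 ∈ cocycleGroup := fun g => by
    have h : eta (upper 1) = 1 := by
      rw [eta, det_upper]; decide
    rw [h, eta, eta, map_mul, det_upper, mul_one, mul_one, coe_det,
      ← etaFormula_upper _ _ _ _ (det_mul_self g), Units.val_mul, coe_upper]
    simp [Matrix.mul_apply, Fin.sum_univ_two]
  have h2 : ∀ n : ℕ, upper (n : ZMod 4) ∈ cocycleGroup := fun n => by
    induction n with
    | zero =>
      have : upper (0 : ZMod 4) = 1 := by decide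
      rw [Nat.cast_zero, this]
      exact one_mem _
    | succ n ih =>
      rw [Nat.cast_succ, upper_add]
      exact mul_mem ih h1
  exact ZMod.natCast_zmod_val t ▸ h2 t.val

lemma lower_mem_cocycleGroup (t : ZMod 4) : lower t ∈ cocycleGroup := by
  have h1 : lower 1 ∈ cocycleGroup := fun g => by
    have h : eta (lower 1) = 3 := by
      rw [eta, det_lower]; decide
    rw [h, eta, eta, map_mul, det_lower, mul_one, coe_det,
      ← etaFormula_lower _ _ _ _ (det_mul_self g), Units.val_mul, coe_lower]
    simp [Matrix.mul_apply, Fin.sum_univ_two]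
  have h2 : ∀ n : ℕ, lower (n : ZMod 4) ∈ cocycleGroup := fun n => by
    induction n with
    | zero =>
      have : lower (0 : ZMod 4) = 1 := by decide
      rw [Nat.cast_zero, this]
      exact one_mem _
    | succ n ih =>
      rw [Nat.cast_succ, lower_add]
      exact mul_mem ih h1
  exact ZMod.natCast_zmod_val t ▸ h2 t.val

lemma diag_mem_cocycleGroup (u : (ZMod 4)ˣ) : diag 1 u ∈ cocycleGroup := by
  have hu : ∀ u : (ZMod 4)ˣ, u = 1 ∨ u = -1 := by decide
  obtain rfl | rfl := hu u
  · have : (diag 1 1 : GL (Fin 2) (ZMod 4)) = 1 := by decide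
    rw [this]
    exact one_mem _
  · intro g
    have h : eta (diag 1 (-1)) = 0 := by
      rw [eta, det_diag]; decide
    rw [h, eta, eta, map_mul, det_diag, one_mul, mul_zero, add_zero, coe_det,
      ← etaFormula_diag _ _ _ _ (det_mul_self g), Units.val_mul, Units.val_mul, coe_det, coe_diag]
    simp [Matrix.mul_apply, Fin.sum_univ_two]

/-- The cocycle identity. -/
theorem eta_mul (g h : GL (Fin 2) (ZMod 4)) :
    eta (g * h) = eta g + (det g : (ZMod 4)ˣ) * eta h := by
  suffices hall : ∀ x, x ∈ cocycleGroup from hall h g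
  have he : IsIdempotentElem (1 : ZMod 4) := one_mul 1
  have hloc : ∀ x : GL (Fin 2) (ZMod 4), loc he x = x := fun x => by
    rw [Units.ext_iff, coe_loc, sub_self, zero_smul, zero_add, one_smul]
  have key : ∀ x : GL (Fin 2) (ZMod 4), det x = 1 → IsUnit (x 0 0) → x ∈ cocycleGroup := by
    rintro x hx ⟨a, ha⟩
    have h1 := loc_eq_mul he hx a (by rw [ha]; ring)
    rw [hloc, hloc] at h1
    rw [h1]
    refine mul_mem (mul_mem (lower_mem_cocycleGroup _) ?_) (upper_mem_cocycleGroup _)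
    rw [diag_inv_eq]
    exact mul_mem (mul_mem (mul_mem (upper_mem_cocycleGroup _) (lower_mem_cocycleGroup _))
      (upper_mem_cocycleGroup _)) (mul_mem (mul_mem (upper_mem_cocycleGroup _)
      (lower_mem_cocycleGroup _)) (upper_mem_cocycleGroup _))
  have key' : ∀ x : GL (Fin 2) (ZMod 4), det x = 1 → x ∈ cocycleGroup := fun x hx => by
    have h1 : ∀ a b c d : ZMod 4, a * d - b * c = 1 → IsUnit a ∨ IsUnit (a + c) := by
      have h2 : ∀ a b c d : ZMod 4, a * d - b * c = 1 → a * a = 1 ∨ (a + c) * (a + c) = 1 := by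
        decide
      exact fun a b c d h => (h2 a b c d h).imp (IsUnit.of_mul_eq_one _) (IsUnit.of_mul_eq_one _)
    obtain h | h := h1 _ _ _ _ ((coe_det x).symm.trans (congrArg Units.val hx))
    · exact key x hx h
    · refine (Subgroup.mul_mem_cancel_left _ (upper_mem_cocycleGroup 1)).1 (key (upper 1 * x) ?_ ?_)
      · rw [map_mul, det_upper, hx, one_mul]
      · rw [Units.val_mul, coe_upper]
        simpa [Matrix.mul_apply, Fin.sum_univ_two] using h
  intro x
  refine (Subgroup.mul_mem_cancel_right _ (diag_mem_cocycleGroup (det x)⁻¹)).1 (key' _ ?_)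
  rw [map_mul, det_diag, one_mul, mul_inv_cancel]

/-- The cocycle of `(ℤ/4ℤ)ˣ` that is `0` at `1` and `1` at `-1`. -/
def unitCocycle (x : ZMod 4) : ZMod 4 := if x = 3 then 1 else 0

/-- The difference of the cocycle of `GL₂(ℤ/4ℤ)` and a multiple of a cocycle of the determinant. -/
def twistedEta (m : ZMod 4) (g : GL (Fin 2) (ZMod 4)) : ZMod 4 :=
  eta g - m * unitCocycle (det g : (ZMod 4)ˣ)

lemma twistedEta_mul (m : ZMod 4) (g h : GL (Fin 2) (ZMod 4)) :
    twistedEta m (g * h) = twistedEta m g + (det g : (ZMod 4)ˣ) * twistedEta m h := by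
  have h1 : ∀ u v : (ZMod 4)ˣ, unitCocycle ((u * v : (ZMod 4)ˣ)) =
      unitCocycle u + u * unitCocycle v := by decide
  rw [twistedEta, twistedEta, twistedEta, eta_mul, map_mul, h1]
  ring

/-- The quadratic character defined by the cocycle on matrices where its values are even. -/
def etaSign (x : ZMod 4) : ℤˣ := if x = 0 then 1 else -1

lemma etaSign_add (x y : ZMod 4) (u : (ZMod 4)ˣ) (hx : 2 * x = 0) (hy : 2 * y = 0) :
    etaSign (x + u * y) = etaSign x * etaSign y := by
  revert x y u
  decide

/-- Reduction modulo four. -/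
def redFour : GL (Fin 2) ZHat →* GL (Fin 2) (ZMod 4) := redGL 4

lemma sgn_eq_one_iff (g : GL (Fin 2) ZHat) : sgn g = 1 ↔ 2 * eta (redFour g) = 0 := by
  have h1 := two_mul_etaFormula_eq_zero_iff _ _ _ _ (det_mul_self (redFour g))
  rw [eta, coe_det, h1]
  have h2 : ∀ i j, ZMod.castHom (by decide : 2 ∣ 4) (ZMod 2) (redFour g i j) =
      (redGL 2 g i j : ZMod 2) := fun i j =>
    castHom_reduction (m := 2) (n := 4) (by decide) (g i j)
  rw [h2, h2, h2, h2]
  rfl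

end SerreCurve

/-! ### The quadratic character of a Serre curve -/

namespace SerreCurve

open scoped commutatorElement
open Matrix.GeneralLinearGroup (det scalar)

lemma mul_self_eq_one (a : SignQuotient) : a * a = 1 := by
  by_cases h : a = 1
  · rw [h, one_mul]
  · exact mul_eq_one_of_ne_one h h

/-- On the group attached to a character that factors through `(ℤ/4ℤ)ˣ` the cocycle, suitably
twisted, takes even values. -/
lemma exists_two_mul_twistedEta_eq_zero {γ : ZHatˣ →* SignQuotient}
    (h4 : ∀ u : ZHatˣ, reduction 4 (u : ZHat) = 1 → γ u = 1) :
    ∃ m : ZMod 4, ∀ g ∈ groupOf γ, 2 * twistedEta m (redFour g) = 0 := by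
  obtain ⟨r, hr, hdet⟩ : ∃ r : ZHat →+* ZMod 4, (∀ u : ZHatˣ, r u = 1 → γ u = 1) ∧
      ∀ g, ((det (redFour g) : (ZMod 4)ˣ) : ZMod 4) = r (det g : ZHatˣ) := by
    refine ⟨reduction 4, h4, fun g => ?_⟩
    rw [coe_det, coe_det]
    refine Eq.trans ?_ (map_sub (reduction 4) _ _).symm
    rw [map_mul, map_mul]
    rfl
  have hneg : ∀ u, γ u = γ (-1) * γ (-u) := fun u => by rw [← map_mul, neg_one_mul, neg_neg]
  have hmod : ∀ u : ZHatˣ, r u = 1 ∨ r u = 3 := fun u => by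
    have h : ∀ w : (ZMod 4)ˣ, (w : ZMod 4) = 1 ∨ (w : ZMod 4) = 3 := by decide
    exact h (Units.map (r : ZHat →* ZMod 4) u)
  have hthree : ∀ u : ZHatˣ, r u = 3 → γ u = γ (-1) := fun u hu => by
    rw [hneg u, hr (-u) (by rw [Units.val_neg, map_neg, hu]; rfl), mul_one]
  have hsgn : ∀ g ∈ groupOf γ, (2 * eta (redFour g) = 0 ↔ γ (det g) = 1) := fun g hg => by
    rw [← sgn_eq_one_iff, ← cls_eq_one_iff, mem_groupOf.1 hg]
  have c1 : unitCocycle 1 = 0 := by decide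
  have c3 : unitCocycle 3 = 1 := by decide
  by_cases hγ : γ (-1) = 1
  · refine ⟨0, fun g hg => ?_⟩
    rw [twistedEta, zero_mul, sub_zero, hsgn g hg]
    exact (hmod (det g)).elim (hr _) fun h => (hthree _ h).trans hγ
  · refine ⟨1, fun g hg => ?_⟩
    rw [twistedEta, hdet]
    obtain h | h := hmod (det g) <;> rw [h]
    · rw [c1, mul_zero, sub_zero, hsgn g hg]
      exact hr _ h
    · have h5 : ∀ x : ZMod 4, 2 * x ≠ 0 → 2 * (x - 1 * 1) = 0 := by decide
      rw [c3]
      refine h5 _ fun h6 => hγ ?_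
      rw [← hthree _ h]
      exact (hsgn g hg).1 h6

/-- The character of the cocycle at the unipotent matrix with entry two. -/
lemma etaSign_twistedEta_upper_two (m : ZMod 4) : etaSign (twistedEta m (upper 2)) ≠ 1 := by
  have h1 : eta (upper 2) = 2 := by
    rw [eta, det_upper]
    decide
  have h2 : unitCocycle 1 = 0 := by decide
  rw [twistedEta, h1, det_upper, Units.val_one, h2, mul_zero, sub_zero]
  decide

section Image

variable {E : WeierstrassCurve ℚ} [E.IsElliptic] (b : TorsionBasis E)

/-- The image of Galois is not the full group attached to a character that factors through
`(ℤ/4ℤ)ˣ`: such a group has a quadratic character that is nontrivial at a matrix of determinant one,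
whereas quadratic characters of the Galois group factor through the cyclotomic character. -/
theorem imageGroup_ne_groupOf {γ : ZHatˣ →* SignQuotient}
    (h4 : ∀ u : ZHatˣ, reduction 4 (u : ZHat) = 1 → γ u = 1) : imageGroup b ≠ groupOf γ := by
  intro hG
  obtain ⟨m, hm⟩ := exists_two_mul_twistedEta_eq_zero h4
  have hpos : ∀ σ, 2 * twistedEta m (redFour (rhoDual b σ)) = 0 := fun σ => hm _ (hG ▸ ⟨σ, rfl⟩)
  obtain ⟨f, hf⟩ : ∃ f : GalQ → ℤˣ, ∀ σ, f σ = etaSign (twistedEta m (redFour (rhoDual b σ))) :=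
    ⟨_, fun _ => rfl⟩
  have hmul : ∀ σ τ, f (σ * τ) = f σ * f τ := fun σ τ => by
    rw [hf, hf, hf, map_mul, map_mul, twistedEta_mul]
    exact etaSign_add _ _ _ (hpos σ) (hpos τ)
  obtain ⟨θ, hθ⟩ : ∃ θ : GalQ →* ℤˣ, ∀ σ, θ σ = f σ := ⟨MonoidHom.mk' f hmul, fun _ => rfl⟩
  obtain ⟨N, hN⟩ := exists_forall_eq_one_of_cycMod (by decide) θ
    (isFinitary_of_redGL b 4 fun σ τ h hσ => by
      have h' : redFour (rhoDual b σ) = redFour (rhoDual b τ) := h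
      have hσ' : θ σ = 1 := hσ
      change θ τ = 1
      rw [hθ, hf, ← h', ← hf, ← hθ, hσ'])
  obtain ⟨σ, hσ⟩ : upper 2 ∈ imageGroup b := by
    rw [hG, mem_groupOf_of_det_eq_one (det_upper 2), mem_levelTwo_iff, sgn_upper, map_ofNat]
    rfl
  have hcyc : cyc σ = 1 := by
    rw [← inv_eq_one, ← det_rhoDual b σ, hσ, det_upper]
  have h1 := hN σ (by
    rw [Units.ext_iff, ← reduction_cyc, hcyc, Units.val_one, map_one, Units.val_one])
  have h3 : redFour (upper 2) = upper (2 : ZMod 4) := by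
    refine (redGL_upper 4 2).trans ?_
    rw [map_ofNat]
    rfl
  rw [hθ, hf, hσ, h3] at h1
  exact etaSign_twistedEta_upper_two m h1

end Image

/-- Integers that are `1` modulo `8` are squares modulo all powers of two. -/
lemma exists_two_pow_dvd_sq_sub {u : ℤ} (hu : 8 ∣ u - 1) (k : ℕ) :
    ∃ w : ℤ, 2 ^ (k + 3) ∣ w ^ 2 - u := by
  induction k with
  | zero => exact ⟨1, by rw [one_pow, ← dvd_neg, neg_sub]; exact hu⟩
  | succ k ih =>
    obtain ⟨w, c, hc⟩ := ih
    have hw : Odd w := by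
      rw [← Int.not_even_iff_odd]
      rintro ⟨v, rfl⟩
      obtain ⟨d, hd⟩ := hu
      have h1 : 4 * (v * v) - u = 8 * (2 ^ k * c) := by linear_combination hc
      omega
    obtain ⟨v, hv⟩ := hw
    -- The correction by a multiple of `2 ^ (k + 2)` that makes `c` even.
    refine ⟨w + c * 2 ^ (k + 2), c * (1 + v) + c ^ 2 * 2 ^ k, ?_⟩
    rw [hv] at hc ⊢
    linear_combination hc

/-- A character of order two that factors through the units modulo a power of two factors through
the units modulo eight. -/
lemma eq_one_of_reduction_eight {γ : ZHatˣ →* SignQuotient} {k : ℕ}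
    (hk : ∀ u : ZHatˣ, reduction ⟨2 ^ k, pow_pos two_pos k⟩ (u : ZHat) = 1 → γ u = 1)
    {u : ZHatˣ} (hu : reduction 8 (u : ZHat) = 1) : γ u = 1 := by
  set n : ℕ+ := ⟨2 ^ (k + 3), pow_pos two_pos _⟩ with hn
  have hval : ((reduction n (u : ZHat)).val : ZMod n) = reduction n (u : ZHat) :=
    ZMod.natCast_zmod_val _
  obtain ⟨w, hw⟩ := exists_two_pow_dvd_sq_sub (u := (reduction n (u : ZHat)).val) (by
    refine (ZMod.intCast_zmod_eq_zero_iff_dvd _ 8).1 ?_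
    rw [Int.cast_sub, Int.cast_natCast, Int.cast_one,
      sub_eq_zero]
    have h8 : ((8 : ℕ+) : ℕ) ∣ n := ⟨2 ^ k, by rw [hn, PNat.mk_coe, pow_add, mul_comm]; rfl⟩
    have h := castHom_reduction h8 (u : ZHat)
    rwa [hu, ZMod.castHom_apply, ZMod.cast_eq_val] at h) k
  have hw' : (w : ZMod n) * w = reduction n (u : ZHat) := by
    have h : ((n : ℕ) : ℤ) ∣ w ^ 2 - (reduction n (u : ZHat)).val := by
      have hn' : ((n : ℕ) : ℤ) = 2 ^ (k + 3) := by rw [hn, PNat.mk_coe]; push_cast; rfl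
      exact hn' ▸ hw
    rw [← ZMod.intCast_zmod_eq_zero_iff_dvd] at h
    push_cast at h
    rw [hval] at h
    linear_combination h
  have hwu : IsUnit (w : ZMod n) := isUnit_of_mul_isUnit_left (hw' ▸ u.isUnit.map (reduction n))
  obtain ⟨x, hx⟩ := reduction_surjective_unit n hwu.unit
  have h1 : γ (u * (x * x)⁻¹) = 1 := hk _ (by
    refine (reduction_eq_of_dvd (n := n) (y := 1) (pow_dvd_pow 2 (Nat.le_add_right k 3)) ?_).trans
      (map_one _)
    rw [← Units.val_one, ← mul_inv_cancel (x * x), Units.val_mul, Units.val_mul, map_mul, map_mul,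
      ← hw', Units.val_mul, map_mul, hx]
    rfl)
  rw [map_mul, map_inv, map_mul, mul_self_eq_one, inv_one, mul_one] at h1
  exact h1

end SerreCurve

/-! ### Agreeable closures of groups of index two -/

namespace SerreCurve

open Matrix.GeneralLinearGroup (det scalar)

section Closure

variable {G : Subgroup (GL (Fin 2) ZHat)}

lemma agreeableClosure_eq_self (h : IsAgreeable G) : agreeableClosure G = G :=
  agreeableClosure_eq_of_isLeast ⟨⟨h, le_rfl⟩, fun _ hA => hA.2⟩

/-- A group of index two is only contained in itself and in the full group. -/
lemma agreeableClosure_eq_top (hG : G.index = 2) (h : ¬ IsAgreeable G) :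
    agreeableClosure G = ⊤ := by
  refine sInf_eq_top.2 fun A ⟨hA, hGA⟩ => ?_
  have h1 := Subgroup.relIndex_mul_index hGA
  rw [hG] at h1
  obtain h2 | h2 := (Nat.dvd_prime Nat.prime_two).1 (Dvd.intro_left _ h1)
  · exact Subgroup.index_eq_one.1 h2
  · have h3 : G.relIndex A = 1 := by rw [h2] at h1; omega
    exact absurd (le_antisymm hGA (Subgroup.relIndex_eq_one.1 h3) ▸ hA) h

end Closure

lemma redGL_diag_eq_one {n : ℕ+} {v : ZHatˣ} (hv : reduction n (v : ZHat) = 1) :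
    redGL n (diag v 1) = 1 := by
  have h : Units.map (reduction n : ZHat →* ZMod n) v = 1 := Units.ext hv
  rw [redGL_diag, map_one, h, Units.ext_iff, coe_diag, Units.val_one, Units.val_one,
    Matrix.one_fin_two]

/-- If the group attached to a character is agreeable, then the character factors through
`(ℤ/8ℤ)ˣ`. -/
lemma eq_one_of_isAgreeable_groupOf {γ : ZHatˣ →* SignQuotient} {N : ℕ+}
    (hN : ∀ u : ZHatˣ, reduction N (u : ZHat) = 1 → γ u = 1) (h : IsAgreeable (groupOf γ))
    {u : ZHatˣ} (hu : reduction 8 (u : ZHat) = 1) : γ u = 1 := by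
  have hker : (redGL (2 * N)).ker ≤ groupOf γ := fun g hg => by
    have hg' : redGL (2 * N) g = redGL (2 * N) 1 := hg.trans (map_one _).symm
    have h2 : redGL 2 g = 1 := (redGL_eq_of_dvd ⟨N, rfl⟩ hg').trans (map_one _)
    have h3 := redGL_eq_iff.1 (redGL_eq_of_dvd (m := N) ⟨2, mul_comm _ _⟩ hg')
    rw [mem_groupOf, cls_eq_one_iff.2 (mem_levelTwo_iff.1 (mem_levelTwo_of_redGL_eq_one h2))]
    refine (hN _ ?_).symm
    rw [coe_det, map_sub, map_mul, map_mul, h3, h3, h3, h3]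
    simp
  obtain ⟨hpos, hle⟩ := lev_spec (K := ⊤) (H := groupOf γ) ⟨2 * N, inf_le_right.trans hker⟩
  obtain ⟨k, hk⟩ | ⟨p, hp, hpd, hpo⟩ :=
    Nat.eq_two_pow_or_exists_odd_prime_and_dvd (lev ⊤ (groupOf γ))
  · refine eq_one_of_reduction_eight (k := k) (fun v hv => ?_) hu
    have hmk : (⟨lev ⊤ (groupOf γ), hpos⟩ : ℕ+) = ⟨2 ^ k, pow_pos two_pos k⟩ := PNat.eq hk
    rw [hmk] at hle
    have h1 : diag v 1 ∈ groupOf γ := hle ⟨Subgroup.mem_top _, redGL_diag_eq_one hv⟩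
    rwa [diag_mem_groupOf, mul_one] at h1
  · have hp2 : p ≠ 2 := by
      rintro rfl
      exact absurd hpo (by decide)
    refine absurd hpd ((not_dvd_lev_iff hp (fun _ _ => Subgroup.mem_top _)
      ⟨2 * N, inf_le_right.trans hker⟩).2 fun x _ => ?_)
    exact (odd_primes_iff hker hp).1 (h.odd_primes p hp hp2)
      (fun y hy => loc_mem_groupOf hp hp2 hy) x

section Image

variable {E : WeierstrassCurve ℚ} [E.IsElliptic] (b : TorsionBasis E)

theorem agreeableClosure_of_isSerreCurve (h : IsSerreCurve b) :
    agreeableClosure (imageGroup b) = ⊤ ∨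
      agreeableClosure (imageGroup b) = groupOf (gamma 2) ∨
      agreeableClosure (imageGroup b) = groupOf (gamma (-2)) := by
  by_cases hA : IsAgreeable (imageGroup b)
  swap
  · exact .inl (agreeableClosure_eq_top h hA)
  rw [agreeableClosure_eq_self hA]
  obtain ⟨γ, N, hle, hN⟩ := exists_imageGroup_le_groupOf b
  have hG : imageGroup b = groupOf γ := by
    refine le_antisymm hle (Subgroup.relIndex_eq_one.1 ?_)
    have h1 := Subgroup.relIndex_mul_index hle
    rw [index_groupOf, show (imageGroup b).index = 2 from h] at h1
    omega
  have h1 : ∀ u : ZHatˣ, reduction 8 (u : ZHat) = 1 → γ u = 1 := fun u hu =>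
    eq_one_of_isAgreeable_groupOf hN (hG ▸ hA) hu
  by_cases h5 : ∀ u : ZHatˣ, reduction 8 (u : ZHat) = 5 → γ u ≠ 1
  · rw [hG]
    exact .inr ((eq_gamma_of_apply_five_ne_one h1 h5).imp (congrArg groupOf) (congrArg groupOf))
  · push Not at h5
    obtain ⟨v, hv, hγv⟩ := h5
    refine absurd hG (imageGroup_ne_groupOf b fun u hu => ?_)
    have h84 := castHom_reduction (m := 4) (n := 8) (by decide) (u : ZHat)
    rw [hu] at h84
    have c3 : ZMod.castHom (by decide : 4 ∣ 8) (ZMod 4) 3 ≠ 1 := by decide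
    have c7 : ZMod.castHom (by decide : 4 ∣ 8) (ZMod 4) 7 ≠ 1 := by decide
    obtain h | h | h | h := reduction_eight u <;> rw [h] at h84
    · exact h1 u h
    · exact absurd h84 c3
    · have h2 : γ (u * v) = 1 := h1 _ (by
        rw [Units.val_mul, map_mul, h, hv]
        rfl)
      rwa [map_mul, hγv, mul_one] at h2
    · exact absurd h84 c7

end Image

end SerreCurve

end

theorem mainTheorem5 (E : WeierstrassCurve ℚ) [E.IsElliptic] (hE : ¬ SerreCurve.HasCM E)
    (b : SerreCurve.TorsionBasis E) :
    SerreCurve.IsSerreCurve b ↔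
      (SerreCurve.agreeableClosure (SerreCurve.imageGroup b) = ⊤ ∨
        SerreCurve.agreeableClosure (SerreCurve.imageGroup b) =
          SerreCurve.groupOf (SerreCurve.gamma 2) ∨
        SerreCurve.agreeableClosure (SerreCurve.imageGroup b) =
          SerreCurve.groupOf (SerreCurve.gamma (-2))) := by
  refine ⟨SerreCurve.agreeableClosure_of_isSerreCurve b, ?_⟩
  rintro (h | h | h)
  · exact SerreCurve.isSerreCurve_of_groupOf_le b SerreCurve.gamma_two_ne_one (h ▸ le_top)
  · exact SerreCurve.isSerreCurve_of_groupOf_le b SerreCurve.gamma_two_ne_one h.ge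
  · exact SerreCurve.isSerreCurve_of_groupOf_le b SerreCurve.gamma_neg_two_ne_one h.ge
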